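/- Let $\overset{\circ}{\mathfrak g}$ be a finite dimensional simple complex Lie algebra with Cartan subalgebra $\overset{\circ}{\mathfrak h}$, simple roots $\alpha_1,\dots,\alpha_n$, highest root $\theta$, and a non-degenerate symmetric invariant bilinear form $\langle\cdot,\cdot\rangle$. Let $A$ be a finitely generated commutative associative unital $\mathbb C$-algebra. Let $\mathfrak L = (\overset{\circ}{\mathfrak g}\otimes\mathbb C[t,t^{-1}]\oplus\mathbb C K)\rtimes \mathrm{Vir}$, where $\mathrm{Vir}$ has basis $\{d_n, C: n\in\mathbb Z\}$, with brackets $$[x\otimes t^n,y\otimes t^m]=[x,y]\otimes t^{n+m}+n\,\delta_{n+m,0}\langle x,y\rangle K,\qquad [d_n,x\otimes t^m]=m\,x\otimes t^{n+m},$$ $$[d_n,d_m]=(m-n)d_{n+m}+\delta_{n+m,0}\tfrac{n^3-n}{12}C,\qquad K, C \text{ central},$$ and let $\mathfrak L(A)=\mathfrak L\otimes A$ with $[X\otimes a,Y\otimes b]=[X,Y]\otimes ab$. Put $\mathfrak h'=\overset{\circ}{\mathfrak h}\oplus\mathbb C K$ and $\bar{\mathfrak h}=\mathfrak h'\oplus\mathbb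 C d_0\oplus\mathbb C C$. Let $\mathfrak L^+$ be the span of the positive root vectors $x\otimes t^0$ of $\overset{\circ}{\mathfrak g}$ and of all $x\otimes t^n$ ($x\in\overset{\circ}{\mathfrak g}$) and $d_n$ with $n>0$. For a linear map $\psi:\bar{\mathfrak h}\otimes A\to\mathbb C$, let $M(\psi)$ be the $\mathfrak L(A)$-module induced from the one-dimensional module $\mathbb C v_\psi$ of $(\bar{\mathfrak h}\oplus\mathfrak L^+)\otimes A$ on which $\mathfrak L^+\otimes A$ acts by $0$ and $\bar{\mathfrak h}\otimes A$ by $\psi$, and let $V(\psi)$ be the quotient of $M(\psi)$ by its largest proper submodule. It is the irreducible highest weight module with highest weight $\psi$. An $\mathfrak L(A)$-module $V$ is called integrable if it is the direct sum of its weight spaces $V_\mu=\{v: (h\otimes 1)v=\mu(h)v \ \forall h\in\bar{\mathfrak h}\}$, $\mu\in\bar{\mathfrak h}^*$, these are finite dimensional, and for every root $\alpha$ of $\overset{\circ}{\mathfrak g}$, $x\in\overset{\circ}{\mathfrak g}_\alpha$, $n\in\mathbb Z$ and $a\in A$ the element $(x\otimes t^n)\otimes a$ acts locally nilpotently on $V$.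 A linear functional $\mu$ on $\mathfrak h'$ is called dominant integral if $\mu(\alpha_i^\vee)\in\mathbb Z_{\ge 0}$ for $0\le i\le n$, where $\alpha_1^\vee,\dots,\alpha_n^\vee$ are the simple coroots of $\overset{\circ}{\mathfrak g}$ and $\alpha_0^\vee=-\theta^\vee+\frac{2}{\langle\theta,\theta\rangle}K$. Let $I$ be a cofinite ideal of $A$, i.e. $\dim_{\mathbb C} A/I<\infty$. Then $\sqrt I$ is the intersection of the finitely many maximal ideals $\mathcal M_1,\dots,\mathcal M_s$ that contain it, and $\mathfrak h'\otimes A/\sqrt I\cong\bigoplus_{i=1}^s\mathfrak h'_i$ with $\mathfrak h'_i=\mathfrak h'\otimes A/\mathcal M_i\cong\mathfrak h'$. If $\psi(\mathfrak h'\otimes\sqrt I)=0$, then $\psi$ is called dominant integral with respect to $\sqrt I$ if the restriction to each $\mathfrak h'_i$ of the functional induced by $\psi$ on $\mathfrak h'\otimes A/\sqrt I$ is dominant integral. **Theorem.** Let $\psi:\bar{\mathfrak h}\otimes A\to\mathbb C$ be linear. Suppose there is a cofinite ideal $I$ of $A$ such that $\psi(d_0\otimes I)=0$, $\psi(C\otimes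 I)=0$, $\psi((\overset{\circ}{\mathfrak h}\oplus\mathbb C K)\otimes\sqrt I)=0$, and $\psi$ is dominant integral with respect to $\sqrt I$. Then $V(\psi)$ is integrable; in particular its weight spaces are finite dimensional. -/

import Mathlib

open scoped TensorProduct

noncomputable section

namespace LoopAffineVirasoro

/-- A non-degenerate symmetric invariant bilinear form on a complex Lie algebra. -/
structure InvariantForm (g : Type*) [LieRing g] [LieAlgebra ℂ g] where
  form : LinearMap.BilinForm ℂ g
  symm : ∀ x y : g, form x y = form y x
  nondegenerate : form.Nondegenerate
  invariant : ∀ x y z : g, form ⁅x, y⁆ z = form x ⁅y, z⁆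

section FinsuppBilinear

variable {M N P : Type*} [AddCommGroup M] [Module ℂ M] [AddCommGroup N] [Module ℂ N]
  [AddCommGroup P] [Module ℂ P]

/-- The bilinear map with `(single n x, single m y) ↦ φ n m x y`. -/
def bilin (φ : ℤ → ℤ → M →ₗ[ℂ] N →ₗ[ℂ] P) : (ℤ →₀ M) →ₗ[ℂ] (ℤ →₀ N) →ₗ[ℂ] P :=
  Finsupp.lsum ℂ fun n => LinearMap.flip (Finsupp.lsum ℂ fun m => (φ n m).flip)

@[simp]
theorem bilin_single (φ : ℤ → ℤ → M →ₗ[ℂ] N →ₗ[ℂ] P) (n m : ℤ) (x : M) (y : N) :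
    bilin φ (Finsupp.single n x) (Finsupp.single m y) = φ n m x y := by
  simp [bilin]

theorem eq_zero_of_eq_neg {x : M} (hx : x = -x) : x = 0 := by
  have h2 : (2 : ℂ) • x = 0 := by rw [two_smul]; exact add_eq_zero_iff_eq_neg.mpr hx
  exact (smul_eq_zero.mp h2).resolve_left two_ne_zero

end FinsuppBilinear

section Algebra

variable {g : Type*} [LieRing g] [LieAlgebra ℂ g]

/-- The underlying space of `(g ⊗ ℂ[t, t⁻¹] ⊕ ℂ K) ⋊ Vir`: the element with components `f, k, u, c`
stands for `∑ₙ f n ⊗ tⁿ + k K + ∑ₙ u n dₙ + c C`. -/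
@[ext]
structure AffVir (B : InvariantForm g) where
  loopPart : ℤ →₀ g
  kPart : ℂ
  virPart : ℤ →₀ ℂ
  cPart : ℂ

variable (B : InvariantForm g)

namespace AffVir

/-- Elements as quadruples; the vector space structure is transported along this. -/
def equivProd : AffVir B ≃ (ℤ →₀ g) × ℂ × (ℤ →₀ ℂ) × ℂ where
  toFun X := (X.loopPart, X.kPart, X.virPart, X.cPart)
  invFun p := ⟨p.1, p.2.1, p.2.2.1, p.2.2.2⟩
  left_inv _ := rfl
  right_inv _ := rfl

instance : AddCommGroup (AffVir B) := (equivProd B).addCommGroup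

instance : Module ℂ (AffVir B) := (equivProd B).module ℂ

@[simp] theorem add_loopPart (X Y : AffVir B) : (X + Y).loopPart = X.loopPart + Y.loopPart := rfl
@[simp] theorem add_kPart (X Y : AffVir B) : (X + Y).kPart = X.kPart + Y.kPart := rfl
@[simp] theorem add_virPart (X Y : AffVir B) : (X + Y).virPart = X.virPart + Y.virPart := rfl
@[simp] theorem add_cPart (X Y : AffVir B) : (X + Y).cPart = X.cPart + Y.cPart := rfl
@[simp] theorem smul_loopPart (r : ℂ) (X : AffVir B) : (r • X).loopPart = r • X.loopPart := rfl
@[simp] theorem smul_kPart (r : ℂ) (X : AffVir B) : (r • X).kPart = r * X.kPart := rfl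
@[simp] theorem smul_virPart (r : ℂ) (X : AffVir B) : (r • X).virPart = r • X.virPart := rfl
@[simp] theorem smul_cPart (r : ℂ) (X : AffVir B) : (r • X).cPart = r * X.cPart := rfl
@[simp] theorem zero_loopPart : (0 : AffVir B).loopPart = 0 := rfl
@[simp] theorem zero_kPart : (0 : AffVir B).kPart = 0 := rfl
@[simp] theorem zero_virPart : (0 : AffVir B).virPart = 0 := rfl
@[simp] theorem zero_cPart : (0 : AffVir B).cPart = 0 := rfl

/-- The element `x ⊗ tⁿ`, linear in `x`. -/
@[simps]
def loop (n : ℤ) : g →ₗ[ℂ] AffVir B where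
  toFun x := ⟨Finsupp.single n x, 0, 0, 0⟩
  map_add' x y := by ext1 <;> simp
  map_smul' r x := by ext1 <;> simp

/-- The affine central element `K`. -/
@[simps]
def K : AffVir B := ⟨0, 1, 0, 0⟩

/-- The Virasoro element `dₙ`. -/
@[simps]
def d (n : ℤ) : AffVir B := ⟨0, 0, Finsupp.single n 1, 0⟩

/-- The Virasoro central element `C`. -/
@[simps]
def C : AffVir B := ⟨0, 0, 0, 1⟩

/-- `(x ⊗ tⁿ, y ⊗ tᵐ) ↦ [x, y] ⊗ tⁿ⁺ᵐ` -/
def loopLoop (g : Type*) [LieRing g] [LieAlgebra ℂ g] :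
    (ℤ →₀ g) →ₗ[ℂ] (ℤ →₀ g) →ₗ[ℂ] (ℤ →₀ g) :=
  bilin fun n m => (LieModule.toEnd ℂ g g : g →ₗ[ℂ] g →ₗ[ℂ] g).compr₂ (Finsupp.lsingle (n + m))

/-- `(x ⊗ tⁿ, y ⊗ tᵐ) ↦ n δ_{n+m,0} ⟨x, y⟩` -/
def loopK : (ℤ →₀ g) →ₗ[ℂ] (ℤ →₀ g) →ₗ[ℂ] ℂ :=
  bilin fun n m => if n + m = 0 then (n : ℂ) • B.form else 0

/-- `(dₙ, x ⊗ tᵐ) ↦ m x ⊗ tⁿ⁺ᵐ` -/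
def virLoop (g : Type*) [LieRing g] [LieAlgebra ℂ g] :
    (ℤ →₀ ℂ) →ₗ[ℂ] (ℤ →₀ g) →ₗ[ℂ] (ℤ →₀ g) :=
  bilin fun n m => (m : ℂ) • (LinearMap.lsmul ℂ g).compr₂ (Finsupp.lsingle (n + m))

/-- `(dₙ, dₘ) ↦ (m - n) dₙ₊ₘ` -/
def virVir : (ℤ →₀ ℂ) →ₗ[ℂ] (ℤ →₀ ℂ) →ₗ[ℂ] (ℤ →₀ ℂ) :=
  bilin fun n m => ((m : ℂ) - n) • (LinearMap.lsmul ℂ ℂ).compr₂ (Finsupp.lsingle (n + m))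

/-- `(dₙ, dₘ) ↦ δ_{n+m,0} (n³ - n) / 12` -/
def virC : (ℤ →₀ ℂ) →ₗ[ℂ] (ℤ →₀ ℂ) →ₗ[ℂ] ℂ :=
  bilin fun n m => if n + m = 0 then (((n : ℂ) ^ 3 - n) / 12) • LinearMap.mul ℂ ℂ else 0

@[simp]
theorem loopLoop_single (n m : ℤ) (x y : g) :
    loopLoop g (Finsupp.single n x) (Finsupp.single m y) = Finsupp.single (n + m) ⁅x, y⁆ := by
  simp [loopLoop]

@[simp]
theorem loopK_single (n m : ℤ) (x y : g) :
    loopK B (Finsupp.single n x) (Finsupp.single m y) =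
      if n + m = 0 then (n : ℂ) * B.form x y else 0 := by
  simp only [loopK, bilin_single]
  split_ifs <;> simp

@[simp]
theorem virLoop_single (n m : ℤ) (a : ℂ) (x : g) :
    virLoop g (Finsupp.single n a) (Finsupp.single m x) =
      Finsupp.single (n + m) (((m : ℂ) * a) • x) := by
  simp [virLoop, mul_smul]

@[simp]
theorem virVir_single (n m : ℤ) (a b : ℂ) :
    virVir (Finsupp.single n a) (Finsupp.single m b) =
      Finsupp.single (n + m) (((m : ℂ) - n) * (a * b)) := by
  simp only [virVir, bilin_single, LinearMap.smul_apply, LinearMap.compr₂_apply,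
    LinearMap.lsmul_apply, Finsupp.lsingle_apply, Finsupp.smul_single, smul_eq_mul]

@[simp]
theorem virC_single (n m : ℤ) (a b : ℂ) :
    virC (Finsupp.single n a) (Finsupp.single m b) =
      if n + m = 0 then ((n : ℂ) ^ 3 - n) / 12 * (a * b) else 0 := by
  simp only [virC, bilin_single]
  split_ifs <;> simp

theorem loopLoop_skew (f h : ℤ →₀ g) : loopLoop g f h = -loopLoop g h f := by
  induction f using Finsupp.induction_linear with
  | zero => simp
  | add f₁ f₂ h₁ h₂ => simp only [map_add, LinearMap.add_apply, h₁, h₂, neg_add]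
  | single n x =>
    induction h using Finsupp.induction_linear with
    | zero => simp
    | add f₁ f₂ h₁ h₂ => simp only [map_add, LinearMap.add_apply, h₁, h₂, neg_add]
    | single m y =>
      rw [loopLoop_single, loopLoop_single, add_comm n m, ← lie_skew, Finsupp.single_neg]

theorem loopK_skew (f h : ℤ →₀ g) : loopK B f h = -loopK B h f := by
  induction f using Finsupp.induction_linear with
  | zero => simp
  | add f₁ f₂ h₁ h₂ => simp only [map_add, LinearMap.add_apply, h₁, h₂, neg_add]
  | single n x =>
    induction h using Finsupp.induction_linear with
    | zero => simp
    | add f₁ f₂ h₁ h₂ => simp only [map_add, LinearMap.add_apply, h₁, h₂, neg_add]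
    | single m y =>
      rw [loopK_single, loopK_single, add_comm n m, B.symm x y]
      split_ifs with hnm
      · obtain rfl : n = -m := by omega
        push_cast; ring
      · simp

theorem virVir_skew (u v : ℤ →₀ ℂ) : virVir u v = -virVir v u := by
  induction u using Finsupp.induction_linear with
  | zero => simp
  | add f₁ f₂ h₁ h₂ => simp only [map_add, LinearMap.add_apply, h₁, h₂, neg_add]
  | single n x =>
    induction v using Finsupp.induction_linear with
    | zero => simp
    | add f₁ f₂ h₁ h₂ => simp only [map_add, LinearMap.add_apply, h₁, h₂, neg_add]
    | single m y =>
      rw [virVir_single, virVir_single, add_comm n m, ← Finsupp.single_neg]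
      congr 1; ring

theorem virC_skew (u v : ℤ →₀ ℂ) : virC u v = -virC v u := by
  induction u using Finsupp.induction_linear with
  | zero => simp
  | add f₁ f₂ h₁ h₂ => simp only [map_add, LinearMap.add_apply, h₁, h₂, neg_add]
  | single n x =>
    induction v using Finsupp.induction_linear with
    | zero => simp
    | add f₁ f₂ h₁ h₂ => simp only [map_add, LinearMap.add_apply, h₁, h₂, neg_add]
    | single m y =>
      rw [virC_single, virC_single, add_comm n m]
      split_ifs with hnm
      · obtain rfl : n = -m := by omega
        push_cast; ring
      · simp

theorem loopLoop_jacobi (f h k : ℤ →₀ g) :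
    loopLoop g f (loopLoop g h k) =
      loopLoop g (loopLoop g f h) k + loopLoop g h (loopLoop g f k) := by
  induction f using Finsupp.induction_linear with
  | zero => simp
  | add f₁ f₂ h₁ h₂ =>
    simp only [map_add, LinearMap.add_apply, h₁, h₂]; abel
  | single n x =>
    induction h using Finsupp.induction_linear with
    | zero => simp
    | add f₁ f₂ h₁ h₂ =>
      simp only [map_add, LinearMap.add_apply, h₁, h₂]; abel
    | single m y =>
      induction k using Finsupp.induction_linear with
      | zero => simp
      | add f₁ f₂ h₁ h₂ =>
        simp only [map_add, LinearMap.add_apply, h₁, h₂]; abel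
      | single l z =>
        simp only [loopLoop_single]
        rw [← add_assoc, ← add_assoc, add_comm m n, ← Finsupp.single_add, leibniz_lie]

theorem virLoop_loopLoop (u : ℤ →₀ ℂ) (f h : ℤ →₀ g) :
    virLoop g u (loopLoop g f h) =
      loopLoop g (virLoop g u f) h + loopLoop g f (virLoop g u h) := by
  induction u using Finsupp.induction_linear with
  | zero => simp
  | add f₁ f₂ h₁ h₂ =>
    simp only [map_add, LinearMap.add_apply, h₁, h₂]; abel
  | single n x =>
    induction f using Finsupp.induction_linear with
    | zero => simp
    | add f₁ f₂ h₁ h₂ =>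
      simp only [map_add, LinearMap.add_apply, h₁, h₂]; abel
    | single m y =>
      induction h using Finsupp.induction_linear with
      | zero => simp
      | add f₁ f₂ h₁ h₂ =>
        simp only [map_add, LinearMap.add_apply, h₁, h₂]; abel
      | single l z =>
        simp only [loopLoop_single, virLoop_single, smul_lie, lie_smul]
        rw [add_left_comm m n l, ← add_assoc, ← Finsupp.single_add, ← add_smul]
        push_cast
        congr 2; ring

theorem virLoop_virLoop (u v : ℤ →₀ ℂ) (f : ℤ →₀ g) :
    virLoop g u (virLoop g v f) =
      virLoop g (virVir u v) f + virLoop g v (virLoop g u f) := by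
  induction u using Finsupp.induction_linear with
  | zero => simp
  | add f₁ f₂ h₁ h₂ =>
    simp only [map_add, LinearMap.add_apply, h₁, h₂]; abel
  | single n x =>
    induction v using Finsupp.induction_linear with
    | zero => simp
    | add f₁ f₂ h₁ h₂ =>
      simp only [map_add, LinearMap.add_apply, h₁, h₂]; abel
    | single m y =>
      induction f using Finsupp.induction_linear with
      | zero => simp
      | add f₁ f₂ h₁ h₂ =>
        simp only [map_add, LinearMap.add_apply, h₁, h₂]; abel
      | single l z =>
        simp only [virVir_single, virLoop_single, smul_smul]
        rw [add_left_comm m n l, ← add_assoc, ← Finsupp.single_add, ← add_smul]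
        push_cast
        congr 2; ring

theorem virVir_jacobi (u v w : ℤ →₀ ℂ) :
    virVir u (virVir v w) = virVir (virVir u v) w + virVir v (virVir u w) := by
  induction u using Finsupp.induction_linear with
  | zero => simp
  | add f₁ f₂ h₁ h₂ =>
    simp only [map_add, LinearMap.add_apply, h₁, h₂]; abel
  | single n x =>
    induction v using Finsupp.induction_linear with
    | zero => simp
    | add f₁ f₂ h₁ h₂ =>
      simp only [map_add, LinearMap.add_apply, h₁, h₂]; abel
    | single m y =>
      induction w using Finsupp.induction_linear with
      | zero => simp
      | add f₁ f₂ h₁ h₂ =>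
        simp only [map_add, LinearMap.add_apply, h₁, h₂]; abel
      | single l z =>
        simp only [virVir_single]
        rw [add_left_comm m n l, ← add_assoc, ← Finsupp.single_add]
        push_cast
        congr 1; ring

theorem loopK_jacobi (f h k : ℤ →₀ g) :
    loopK B f (loopLoop g h k) = loopK B (loopLoop g f h) k + loopK B h (loopLoop g f k) := by
  induction f using Finsupp.induction_linear with
  | zero => simp
  | add f₁ f₂ h₁ h₂ =>
    simp only [map_add, LinearMap.add_apply, h₁, h₂]; abel
  | single n x =>
    induction h using Finsupp.induction_linear with
    | zero => simp
    | add f₁ f₂ h₁ h₂ =>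
      simp only [map_add, LinearMap.add_apply, h₁, h₂]; abel
    | single m y =>
      induction k using Finsupp.induction_linear with
      | zero => simp
      | add f₁ f₂ h₁ h₂ =>
        simp only [map_add, LinearMap.add_apply, h₁, h₂]; abel
      | single l z =>
        simp only [loopLoop_single, loopK_single]
        rw [add_left_comm m n l, ← add_assoc]
        split_ifs with hs
        · have e₁ : B.form ⁅x, y⁆ z = B.form x ⁅y, z⁆ := B.invariant x y z
          have e₂ : B.form y ⁅x, z⁆ = -B.form x ⁅y, z⁆ := by
            rw [← B.invariant, ← lie_skew, map_neg, LinearMap.neg_apply, e₁]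
          rw [e₁, e₂]; push_cast; ring
        · simp

theorem loopK_virLoop (u : ℤ →₀ ℂ) (f h : ℤ →₀ g) :
    loopK B (virLoop g u f) h + loopK B f (virLoop g u h) = 0 := by
  induction u using Finsupp.induction_linear with
  | zero => simp
  | add f₁ f₂ h₁ h₂ =>
    simp only [map_add, LinearMap.add_apply, h₁, h₂]; grind
  | single n x =>
    induction f using Finsupp.induction_linear with
    | zero => simp
    | add f₁ f₂ h₁ h₂ =>
      simp only [map_add, LinearMap.add_apply, h₁, h₂]; grind
    | single m y =>
      induction h using Finsupp.induction_linear with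
      | zero => simp
      | add f₁ f₂ h₁ h₂ =>
        simp only [map_add, LinearMap.add_apply, h₁, h₂]; grind
      | single l z =>
        simp only [virLoop_single, loopK_single, map_smul, LinearMap.smul_apply, smul_eq_mul]
        rw [add_left_comm m n l, ← add_assoc]
        split_ifs with hs
        · obtain rfl : l = -(n + m) := by omega
          push_cast; ring
        · simp

theorem virC_jacobi (u v w : ℤ →₀ ℂ) :
    virC u (virVir v w) = virC (virVir u v) w + virC v (virVir u w) := by
  induction u using Finsupp.induction_linear with
  | zero => simp
  | add f₁ f₂ h₁ h₂ =>
    simp only [map_add, LinearMap.add_apply, h₁, h₂]; abel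
  | single n x =>
    induction v using Finsupp.induction_linear with
    | zero => simp
    | add f₁ f₂ h₁ h₂ =>
      simp only [map_add, LinearMap.add_apply, h₁, h₂]; abel
    | single m y =>
      induction w using Finsupp.induction_linear with
      | zero => simp
      | add f₁ f₂ h₁ h₂ =>
        simp only [map_add, LinearMap.add_apply, h₁, h₂]; abel
      | single l z =>
        simp only [virVir_single, virC_single]
        rw [add_left_comm m n l, ← add_assoc]
        split_ifs with hs
        · obtain rfl : l = -(n + m) := by omega
          push_cast; ring
        · simp

instance : Bracket (AffVir B) (AffVir B) where
  bracket X Y :=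
    ⟨loopLoop g X.loopPart Y.loopPart + virLoop g X.virPart Y.loopPart
        - virLoop g Y.virPart X.loopPart,
      loopK B X.loopPart Y.loopPart,
      virVir X.virPart Y.virPart,
      virC X.virPart Y.virPart⟩

@[simp] theorem lie_loopPart (X Y : AffVir B) : ⁅X, Y⁆.loopPart =
    loopLoop g X.loopPart Y.loopPart + virLoop g X.virPart Y.loopPart
      - virLoop g Y.virPart X.loopPart := rfl
@[simp] theorem lie_kPart (X Y : AffVir B) : ⁅X, Y⁆.kPart = loopK B X.loopPart Y.loopPart := rfl
@[simp] theorem lie_virPart (X Y : AffVir B) : ⁅X, Y⁆.virPart = virVir X.virPart Y.virPart := rfl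
@[simp] theorem lie_cPart (X Y : AffVir B) : ⁅X, Y⁆.cPart = virC X.virPart Y.virPart := rfl

instance : LieRing (AffVir B) where
  add_lie X Y Z := by
    ext1 <;> simp only [lie_loopPart, lie_kPart, lie_virPart, lie_cPart, add_loopPart, add_kPart,
      add_virPart, add_cPart, map_add, LinearMap.add_apply]
    abel
  lie_add X Y Z := by
    ext1 <;> simp only [lie_loopPart, lie_kPart, lie_virPart, lie_cPart, add_loopPart, add_kPart,
      add_virPart, add_cPart, map_add, LinearMap.add_apply]
    abel
  lie_self X := by
    ext1
    · simp [eq_zero_of_eq_neg (loopLoop_skew X.loopPart X.loopPart)]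
    · exact eq_zero_of_eq_neg (loopK_skew B X.loopPart X.loopPart)
    · exact eq_zero_of_eq_neg (virVir_skew X.virPart X.virPart)
    · exact eq_zero_of_eq_neg (virC_skew X.virPart X.virPart)
  leibniz_lie X Y Z := by
    ext1
    · simp only [lie_loopPart, lie_virPart, add_loopPart, map_add, map_sub, LinearMap.add_apply,
        LinearMap.sub_apply]
      rw [loopLoop_jacobi X.loopPart, virLoop_loopLoop, virLoop_loopLoop, virLoop_loopLoop,
        virLoop_virLoop X.virPart Y.virPart, virLoop_virLoop X.virPart Z.virPart,
        virLoop_virLoop Y.virPart Z.virPart,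
        loopLoop_skew Y.loopPart (virLoop g Z.virPart X.loopPart)]
      abel
    · simp only [lie_loopPart, lie_kPart, add_kPart, map_add, map_sub, LinearMap.add_apply,
        LinearMap.sub_apply]
      have e₁ := loopK_jacobi B X.loopPart Y.loopPart Z.loopPart
      have e₂ := loopK_virLoop B X.virPart Y.loopPart Z.loopPart
      have e₃ := loopK_virLoop B Y.virPart X.loopPart Z.loopPart
      have e₄ := loopK_virLoop B Z.virPart X.loopPart Y.loopPart
      have e₅ := loopK_skew B Y.loopPart (virLoop g Z.virPart X.loopPart)
      linear_combination e₁ - e₂ + e₃ - e₄ + e₅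
    · exact virVir_jacobi _ _ _
    · exact virC_jacobi _ _ _

instance : LieAlgebra ℂ (AffVir B) where
  lie_smul r X Y := by
    ext1 <;> simp [smul_sub]

/-! The defining brackets. -/

theorem loop_lie_loop (n m : ℤ) (x y : g) : ⁅loop B n x, loop B m y⁆ =
    loop B (n + m) ⁅x, y⁆ + (if n + m = 0 then (n : ℂ) * B.form x y else 0) • K B := by
  ext1 <;> simp [-ite_smul]

theorem d_lie_loop (n m : ℤ) (x : g) : ⁅d B n, loop B m x⁆ = (m : ℂ) • loop B (n + m) x := by
  ext1 <;> simp

theorem d_lie_d (n m : ℤ) : ⁅d B n, d B m⁆ =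
    ((m : ℂ) - n) • d B (n + m) + (if n + m = 0 then ((n : ℂ) ^ 3 - n) / 12 else 0) • C B := by
  ext1 <;> simp [-ite_smul]

theorem K_lie (X : AffVir B) : ⁅K B, X⁆ = 0 := by
  ext1 <;> simp

theorem C_lie (X : AffVir B) : ⁅C B, X⁆ = 0 := by
  ext1 <;> simp

end AffVir
end Algebra

section Modules

open LieAlgebra.IsKilling

attribute [local instance 100] LieRing.ofAssociativeRing

variable {g : Type*} [LieRing g] [LieAlgebra ℂ g] [FiniteDimensional ℂ g] [LieAlgebra.IsSimple ℂ g]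
  (B : InvariantForm g) {H : LieSubalgebra ℂ g} [H.IsCartanSubalgebra]
  (A : Type*) [CommRing A] [Algebra ℂ A]

/-- The loop affine-Virasoro algebra: the tensor product of `AffVir B` with `A`, with bracket
`[a ⊗ X, b ⊗ Y] = ab ⊗ [X, Y]`. -/
abbrev LoopAffVir : Type _ := A ⊗[ℂ] AffVir B

/-- `h' = H ⊕ ℂ K`; the pair `(h, k)` stands for `h + k K`. -/
abbrev DerivedCartan (H : LieSubalgebra ℂ g) : Type _ := H × ℂ

/-- `h̄ = h' ⊕ ℂ d₀ ⊕ ℂ C`; the triple `(x, s, c)` stands for `x + s d₀ + c C`. -/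
abbrev ExtCartan (H : LieSubalgebra ℂ g) : Type _ := DerivedCartan H × ℂ × ℂ

/-- The inclusion of `h̄` in `AffVir B`. -/
def cartanIncl : ExtCartan H →ₗ[ℂ] AffVir B where
  toFun x := AffVir.loop B 0 (x.1.1 : g) + x.1.2 • AffVir.K B + x.2.1 • AffVir.d B 0
    + x.2.2 • AffVir.C B
  map_add' x y := by
    have e : ((x + y).1.1 : g) = (x.1.1 : g) + (y.1.1 : g) := rfl
    rw [e]
    simp only [Prod.fst_add, Prod.snd_add, map_add, add_smul]; abel
  map_smul' r x := by
    have e : ((r • x).1.1 : g) = r • (x.1.1 : g) := rfl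
    rw [e]
    simp only [Prod.smul_fst, Prod.smul_snd, map_smul, smul_eq_mul, mul_smul, smul_add,
      RingHom.id_apply]

/-- The space `n₊ ⊕ Vir⁺`, where the positive system of `g` is the one given by the base `b`:
it is spanned by the `x ⊗ t⁰` with `x` a positive root vector of `g`, and by the
`x ⊗ tⁿ` with `x` in `g` and the `dₙ` for `n > 0`. -/
def posPart (b : (rootSystem H).Base) : Submodule ℂ (AffVir B) :=
  Submodule.span ℂ
    ({X | ∃ α : H.root, b.IsPos α ∧ ∃ x ∈ LieAlgebra.rootSpace H α.1, X = AffVir.loop B 0 x} ∪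
     {X | ∃ n : ℤ, 0 < n ∧ ∃ x : g, X = AffVir.loop B n x} ∪
     {X | ∃ n : ℤ, 0 < n ∧ X = AffVir.d B n})

section HighestWeightModule

variable {A} (b : (rootSystem H).Base) (ψ : A ⊗[ℂ] ExtCartan H →ₗ[ℂ] ℂ)

/-- The left ideal of the enveloping algebra of `LoopAffVir B A` generated by `A ⊗ (n₊ ⊕ Vir⁺)`
and by the elements `y - ψ(y)` with `y` in `A ⊗ h̄`. -/
def vermaIdeal : Submodule (UniversalEnvelopingAlgebra ℂ (LoopAffVir B A))
    (UniversalEnvelopingAlgebra ℂ (LoopAffVir B A)) :=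
  Submodule.span _
    ({u | ∃ a : A, ∃ X ∈ posPart B b, u = UniversalEnvelopingAlgebra.ι ℂ (a ⊗ₜ[ℂ] X)} ∪
     {u | ∃ y : A ⊗[ℂ] ExtCartan H,
        u = UniversalEnvelopingAlgebra.ι ℂ ((cartanIncl B).lTensor A y) -
          algebraMap ℂ (UniversalEnvelopingAlgebra ℂ (LoopAffVir B A)) (ψ y)})

/-- The Verma module `M(ψ)`: the module induced from the one-dimensional module of
`A ⊗ (h̄ ⊕ n₊ ⊕ Vir⁺)` given by `ψ`, as a quotient of the enveloping algebra. -/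
abbrev Verma : Type _ := UniversalEnvelopingAlgebra ℂ (LoopAffVir B A) ⧸ vermaIdeal B b ψ

/-- The largest proper submodule of `M(ψ)`: the sum of all proper submodules. -/
def vermaMax : Submodule (UniversalEnvelopingAlgebra ℂ (LoopAffVir B A)) (Verma B b ψ) :=
  sSup {N | N ≠ ⊤}

/-- The irreducible highest weight module `V(ψ)`. -/
abbrev IrrHW : Type _ := Verma B b ψ ⧸ vermaMax B b ψ

/-- The action of `LoopAffVir B A` on `V(ψ)`. -/
def irrHWAction : LoopAffVir B A →ₗ⁅ℂ⁆ Module.End ℂ (IrrHW B b ψ) :=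
  ((Algebra.lsmul ℂ ℂ (IrrHW B b ψ) : UniversalEnvelopingAlgebra ℂ (LoopAffVir B A) →ₐ[ℂ]
    Module.End ℂ (IrrHW B b ψ)) : UniversalEnvelopingAlgebra ℂ (LoopAffVir B A) →ₗ⁅ℂ⁆
    Module.End ℂ (IrrHW B b ψ)).comp (UniversalEnvelopingAlgebra.ι ℂ)

end HighestWeightModule

section Integrable

variable {A} {V : Type*} [AddCommGroup V] [Module ℂ V]

/-- The weight space `V_μ = {v | h v = μ(h) v for all h in h̄}`. -/
def weightSpace (ρ : LoopAffVir B A →ₗ⁅ℂ⁆ Module.End ℂ V) (μ : Module.Dual ℂ (ExtCartan H)) :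
    Submodule ℂ V where
  carrier := {v | ∀ h : ExtCartan H, ρ ((1 : A) ⊗ₜ[ℂ] cartanIncl B h) v = μ h • v}
  add_mem' hv hw h := by rw [map_add, hv h, hw h, smul_add]
  zero_mem' h := by simp
  smul_mem' r v hv h := by rw [map_smul, hv h, smul_comm]

open Classical in
/-- Integrable representations. The real root vectors are the `x ⊗ tⁿ` with `x` a root vector
of `g` and `n` any integer. -/
structure IsIntegrable (H : LieSubalgebra ℂ g) [H.IsCartanSubalgebra]
    (ρ : LoopAffVir B A →ₗ⁅ℂ⁆ Module.End ℂ V) : Prop where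
  isWeightModule : DirectSum.IsInternal
    (fun μ : Module.Dual ℂ (ExtCartan H) => weightSpace B ρ μ)
  finiteDimensional : ∀ μ : Module.Dual ℂ (ExtCartan H), FiniteDimensional ℂ (weightSpace B ρ μ)
  locallyNilpotent : ∀ α : H.root, ∀ x ∈ LieAlgebra.rootSpace H α.1, ∀ (n : ℤ) (a : A) (v : V),
    ∃ N : ℕ, (ρ (a ⊗ₜ[ℂ] AffVir.loop B n x) ^ N) v = 0

end Integrable

section DominantIntegral

/-- `θ` is the highest root: `θ - β` is a sum of simple roots for every root `β`. -/
def IsHighestRoot (b : (rootSystem H).Base) (θ : H.root) : Prop :=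
  ∀ β : H.root, (rootSystem H).root θ - (rootSystem H).root β ∈
    AddSubmonoid.closure ((rootSystem H).root '' b.support)

/-- The simple coroot `α₀^∨ = -θ^∨ + (2 / ⟨θ, θ⟩) K` of the affine algebra, for `θ` the highest
root. The factor is written through the coroot: `⟨θ^∨, θ^∨⟩ = 4 / ⟨θ, θ⟩`. -/
def affineCoroot (θ : H.root) : DerivedCartan H :=
  (-(rootSystem H).coroot θ,
    B.form ((rootSystem H).coroot θ : H) ((rootSystem H).coroot θ : H) / 2)

/-- A linear functional on `h'` is dominant integral if it takes values in the non-negative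
integers on the simple coroots `α₀^∨, …, αₙ^∨` of the affine algebra. -/
def IsDominantIntegral (b : (rootSystem H).Base) (μ : DerivedCartan H →ₗ[ℂ] ℂ) : Prop :=
  (∀ i ∈ b.support, ∃ k : ℕ, μ ((rootSystem H).coroot i, 0) = k) ∧
  ∀ θ : H.root, IsHighestRoot b θ → ∃ k : ℕ, μ (affineCoroot B θ) = k

/-- For `J` a finite intersection of maximal ideals, `M` one of them: `e` represents in `A ⧸ J` the
unit of the factor `A ⧸ M` of `A ⧸ J ≅ ∏ A ⧸ Mᵢ`. -/
def IsFactorUnit {A : Type*} [CommRing A] (J M : Ideal A) (e : A) : Prop :=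
  e - 1 ∈ M ∧ ∀ N : Ideal A, N.IsMaximal → J ≤ N → N ≠ M → e ∈ N

/-- Such representatives exist when `J` is the radical of a cofinite ideal. -/
theorem exists_isFactorUnit {A : Type*} [CommRing A] [Algebra ℂ A] (I : Ideal A)
    (hI : FiniteDimensional ℂ (A ⧸ I)) (M : Ideal A) (hM : M.IsMaximal) (hIM : I.radical ≤ M) :
    ∃ e : A, IsFactorUnit I.radical M e := by
  have hR : FiniteDimensional ℂ (A ⧸ I.radical) :=
    Module.Finite.of_surjective (Ideal.Quotient.factorₐ ℂ (Ideal.le_radical (I := I))).toLinearMap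
      (Ideal.Quotient.factor_surjective Ideal.le_radical)
  have : IsArtinianRing (A ⧸ I.radical) := IsArtinianRing.of_finite ℂ _
  have hfin : {N : Ideal A | N.IsMaximal ∧ I.radical ≤ N}.Finite := by
    refine ((IsArtinianRing.setOfPred_isMaximal_finite (A ⧸ I.radical)).image
      (Ideal.comap (Ideal.Quotient.mk I.radical))).subset ?_
    rintro N ⟨hN, hle⟩
    have hker : RingHom.ker (Ideal.Quotient.mk I.radical) ≤ N := by rwa [Ideal.mk_ker]
    refine ⟨N.map (Ideal.Quotient.mk I.radical), ?_, ?_⟩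
    · exact Ideal.IsMaximal.map_of_surjective_of_ker_le Ideal.Quotient.mk_surjective hker
    · rw [Ideal.comap_map_of_surjective' _ Ideal.Quotient.mk_surjective]
      exact sup_eq_left.mpr hker
  classical
  have := hfin.to_subtype
  obtain ⟨e, he⟩ := Ideal.exists_forall_sub_mem_ideal
    (I := fun N : {N : Ideal A | N.IsMaximal ∧ I.radical ≤ N} => N.1)
    (fun N N' hne => Ideal.isCoprime_iff_sup_eq.mpr
      (N.2.1.coprime_of_ne N'.2.1 (fun h => hne (Subtype.ext h))))
    (fun N => if N.1 = M then 1 else 0)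
  refine ⟨e, ?_, fun N hN hle hne => ?_⟩
  · simpa using he ⟨M, hM, hIM⟩
  · simpa [hne] using he ⟨N, hN, hle⟩

variable {A}

/-- The restriction `x ↦ ψ(e ⊗ x)` of `ψ` to `e ⊗ h'`. -/
def restrictFactor (ψ : A ⊗[ℂ] ExtCartan H →ₗ[ℂ] ℂ) (e : A) : DerivedCartan H →ₗ[ℂ] ℂ :=
  ψ ∘ₗ TensorProduct.mk ℂ A (ExtCartan H) e ∘ₗ LinearMap.inl ℂ (DerivedCartan H) (ℂ × ℂ)

/-- For `ψ` vanishing on `J ⊗ h'`, where `J` is the radical of a cofinite ideal: the restriction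
of `ψ` to each factor of `A ⧸ J ⊗ h' = ⊕ᵢ h'ᵢ` is dominant integral. -/
def IsDominantIntegralWrt (b : (rootSystem H).Base) (ψ : A ⊗[ℂ] ExtCartan H →ₗ[ℂ] ℂ)
    (J : Ideal A) : Prop :=
  ∀ M : Ideal A, M.IsMaximal → J ≤ M → ∀ e : A, IsFactorUnit J M e →
    IsDominantIntegral B b (restrictFactor ψ e)

end DominantIntegral

end Modules

end LoopAffineVirasoro

end

/-!
Lie algebra elements are graded by the eigenvalues of `h + c d₀` with `h` in the Cartan subalgebra.
If positive root vectors have positive degree, then `V(ψ)` is graded in degrees bounded above, and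
irreducibility says that a subspace stable under the Borel part and contained in the degrees below
the top one is zero. Applied to the vectors `(a ⊗ X) v` with `a` in an ideal, this shows that `I`
acts by zero on `V(ψ)`, so that everything factors through the finite dimensional `A ⧸ I` and the
graded pieces are finite dimensional; it also shows that `√I ⊗ X` acts by zero for `X` in the affine
Lie algebra `g ⊗ ℂ[t, t⁻¹] ⊕ ℂ K`.

As `A ⧸ √I` is a product of copies of `ℂ`, local nilpotency need only be checked for `e ⊗ X` with
`e` the unit of one factor, and `X ↦ e ⊗ X` is a representation of the affine Lie algebra. Dominance
makes the negative simple root vectors of the affine algebra act locally nilpotently. A root vector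
acts locally nilpotently as soon as the weights of `V(ψ)`, for the factor `e`, are bounded in the
direction of its root; the reflections coming from integrable `sl₂`-triples permute the weights, so
boundedness is invariant under the affine Weyl group. Every real root is conjugate to one of
positive level, in whose direction the weights are bounded because the degrees are.
-/

noncomputable section

namespace LoopAffineVirasoro

attribute [local instance 100] LieRing.ofAssociativeRing

section LocallyNilpotent

variable {R V : Type*} [CommRing R] [AddCommGroup V] [Module R V]

/-- An operator is locally nilpotent if each vector is killed by one of its powers. -/
def IsLocNilpotent (E : Module.End R V) : Prop := ∀ w : V, ∃ N : ℕ, (E ^ N) w = 0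

theorem isLocNilpotent_zero : IsLocNilpotent (0 : Module.End R V) := fun w => ⟨1, by simp⟩

theorem isLocNilpotent_iff_maxGenEigenspace_eq_top {E : Module.End R V} :
    IsLocNilpotent E ↔ E.maxGenEigenspace 0 = ⊤ := by
  simp only [IsLocNilpotent, Submodule.eq_top_iff', Module.End.mem_maxGenEigenspace, zero_smul,
    sub_zero]

theorem IsLocNilpotent.smul {S : Module.End R V} (hS : IsLocNilpotent S) (r : R) :
    IsLocNilpotent (r • S) := by
  intro w
  obtain ⟨m, hm⟩ := hS w
  exact ⟨m, by rw [smul_pow, LinearMap.smul_apply, hm, smul_zero]⟩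

theorem IsLocNilpotent.add {S T : Module.End R V} (hS : IsLocNilpotent S) (hT : IsLocNilpotent T)
    (hST : Commute S T) : IsLocNilpotent (S + T) := by
  intro w
  obtain ⟨m, hm⟩ := hS w
  obtain ⟨n, hn⟩ := hT w
  refine ⟨m + n, ?_⟩
  rw [hST.add_pow', LinearMap.sum_apply]
  refine Finset.sum_eq_zero fun p hp => ?_
  rw [Finset.HasAntidiagonal.mem_antidiagonal] at hp
  rw [LinearMap.smul_apply]
  rcases le_or_gt n p.2 with h | h
  · rw [Module.End.mul_apply, Module.End.pow_map_zero_of_le h hn, map_zero, smul_zero]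
  · rw [(hST.pow_pow p.1 p.2).eq, Module.End.mul_apply,
      Module.End.pow_map_zero_of_le (by omega : m ≤ p.1) hm, map_zero, smul_zero]

theorem apply_mem_maxGenEigenspace_zero_of_ad_pow {E X : Module.End R V} {w : V} {n : ℕ}
    (hX : ((LieAlgebra.ad R (Module.End R V) E) ^ n) X = 0)
    (hw : w ∈ E.maxGenEigenspace 0) : X w ∈ E.maxGenEigenspace 0 := by
  have hXE : X ∈ (LieModule.toEnd R (Module.End R V) (Module.End R V) E).maxGenEigenspace 0 :=
    Module.End.mem_maxGenEigenspace _ _ _ |>.2 ⟨n, by rw [zero_smul, sub_zero]; exact hX⟩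
  simpa using LieModule.lie_mem_maxGenEigenspace_toEnd (R := R) (L := Module.End R V) hXE hw

end LocallyNilpotent

section StableSpan

variable {R L V : Type*} [CommRing R] [LieRing L] [LieAlgebra R L] [AddCommGroup V] [Module R V]

theorem lieHom_apply_apply (ρ : L →ₗ⁅R⁆ Module.End R V) (x y : L) (w : V) :
    ρ x (ρ y w) = ρ ⁅x, y⁆ w + ρ y (ρ x w) := by
  simp [LieHom.map_lie, Ring.lie_def]

/-- The smallest subspace that contains `W` and is stable under the operators `ρ x`, `x ∈ N`. -/
def stableSpan (ρ : L →ₗ⁅R⁆ Module.End R V) (N : Submodule R L) (W : Submodule R V) :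
    Submodule R V :=
  sInf {T | W ≤ T ∧ ∀ x ∈ N, ∀ w ∈ T, ρ x w ∈ T}

variable (ρ : L →ₗ⁅R⁆ Module.End R V) {N P : Submodule R L} {W T : Submodule R V}

theorem le_stableSpan : W ≤ stableSpan ρ N W := le_sInf fun _ hT => hT.1

theorem stableSpan_le (hWT : W ≤ T) (hT : ∀ x ∈ N, ∀ w ∈ T, ρ x w ∈ T) : stableSpan ρ N W ≤ T :=
  sInf_le ⟨hWT, hT⟩

theorem apply_mem_stableSpan {x : L} (hx : x ∈ N) {w : V} (hw : w ∈ stableSpan ρ N W) :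
    ρ x w ∈ stableSpan ρ N W :=
  Submodule.mem_sInf.2 fun T hT => hT.2 x hx w (Submodule.mem_sInf.1 hw T hT)

-- This replaces the Poincaré–Birkhoff–Witt factorisation `U(L) = U(N) U(P)`.
theorem apply_mem_stableSpan_of_sup_eq_top (hNP : N ⊔ P = ⊤) (hW : ∀ x ∈ P, ∀ w ∈ W, ρ x w ∈ W)
    (x : L) {w : V} (hw : w ∈ stableSpan ρ N W) : ρ x w ∈ stableSpan ρ N W := by
  let U : Submodule R V := stableSpan ρ N W ⊓ ⨅ y ∈ P, (stableSpan ρ N W).comap (ρ y)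
  have mem_U {u : V} : u ∈ U ↔ u ∈ stableSpan ρ N W ∧ ∀ y ∈ P, ρ y u ∈ stableSpan ρ N W := by
    simp [U]
  have apply_mem {u : V} (hu : u ∈ U) (y : L) : ρ y u ∈ stableSpan ρ N W := by
    obtain ⟨n, hn, p, hp, rfl⟩ := Submodule.mem_sup.1 (hNP ▸ Submodule.mem_top : y ∈ N ⊔ P)
    rw [map_add, LinearMap.add_apply]
    exact add_mem (apply_mem_stableSpan ρ hn (mem_U.1 hu).1) ((mem_U.1 hu).2 p hp)
  have stableSpan_le_U : stableSpan ρ N W ≤ U := by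
    refine stableSpan_le ρ (fun w hw => mem_U.2 ⟨le_stableSpan ρ hw, fun y hy =>
      le_stableSpan ρ (hW y hy w hw)⟩) fun n hn u hu => mem_U.2 ⟨apply_mem hu n, fun y _ => ?_⟩
    rw [lieHom_apply_apply]
    exact add_mem (apply_mem hu _) (apply_mem_stableSpan ρ hn (apply_mem hu y))
  exact apply_mem (stableSpan_le_U hw) x

end StableSpan

section Sl2

variable {K L M : Type*} [Field K] [LieRing L] [LieAlgebra K L]
  [AddCommGroup M] [Module K M] [LieRingModule L M] [LieModule K L M] {h e f : L}

open LieModule IsSl2Triple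

theorem lie_h_pow_toEnd_e (t : IsSl2Triple h e f) {w : M} {z : K} (hw : ⁅h, w⁆ = z • w) (n : ℕ) :
    ⁅h, (toEnd K L M e ^ n) w⁆ = (z + 2 * n) • (toEnd K L M e ^ n) w := by
  induction n with
  | zero => simpa using hw
  | succ n ih =>
    rw [pow_succ', Module.End.mul_apply, toEnd_apply_apply, leibniz_lie, ih,
      t.lie_h_e_smul K, smul_lie, lie_smul, ← add_smul]
    congr 1; push_cast; ring

theorem exists_hasPrimitiveVectorWith_pow (t : IsSl2Triple h e f)
    (he : IsLocNilpotent (toEnd K L M e)) {w : M} {z : K} (hw0 : w ≠ 0) (hw : ⁅h, w⁆ = z • w) :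
    ∃ r : ℕ, HasPrimitiveVectorWith t ((toEnd K L M e ^ r) w) (z + 2 * r) := by
  obtain ⟨r, hr, hr'⟩ := Nat.exists_not_and_succ_of_not_zero_of_exists
    (p := fun n => (toEnd K L M e ^ n) w = 0) (by simpa using hw0) (he w)
  refine ⟨r, hr, lie_h_pow_toEnd_e t hw r, ?_⟩
  rwa [← toEnd_apply_apply K, ← Module.End.mul_apply, ← pow_succ']

variable [CharZero K]

theorem exists_nat_eq_of_hasPrimitiveVectorWith {t : IsSl2Triple h e f} {m : M} {μ : K}
    (P : HasPrimitiveVectorWith t m μ) (hf : IsLocNilpotent (toEnd K L M f)) :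
    ∃ k : ℕ, μ = k ∧ ∀ s ≤ k, (toEnd K L M f ^ s) m ≠ 0 := by
  obtain ⟨k, hk, hk'⟩ := Nat.exists_not_and_succ_of_not_zero_of_exists
    (p := fun n => (toEnd K L M f ^ n) m = 0) (by simpa using P.ne_zero) (hf m)
  have h0 := P.lie_e_pow_succ_toEnd_f k
  rw [hk', lie_zero, eq_comm, smul_eq_zero_iff_left hk, mul_eq_zero, sub_eq_zero] at h0
  exact ⟨k, h0.resolve_left (Nat.cast_add_one_ne_zero k),
    fun s hs hs' => hk (Module.End.pow_map_zero_of_le hs hs')⟩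

theorem exists_nat_pow_ne_zero (t : IsSl2Triple h e f) (he : IsLocNilpotent (toEnd K L M e))
    (hf : IsLocNilpotent (toEnd K L M f)) {w : M} {z : K} (hw0 : w ≠ 0) (hw : ⁅h, w⁆ = z • w) :
    ∃ r k : ℕ, z + 2 * r = k ∧ ∀ s ≤ k, (toEnd K L M f ^ s) ((toEnd K L M e ^ r) w) ≠ 0 := by
  obtain ⟨r, P⟩ := exists_hasPrimitiveVectorWith_pow t he hw0 hw
  obtain ⟨k, hk, hne⟩ := exists_nat_eq_of_hasPrimitiveVectorWith P hf
  exact ⟨r, k, hk, hne⟩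

-- The two alternatives are the cases `0 ≤ z` and `z ≤ 0`, up to the choice of a string.
theorem exists_reflected_ne_zero (t : IsSl2Triple h e f) (he : IsLocNilpotent (toEnd K L M e))
    (hf : IsLocNilpotent (toEnd K L M f)) {w : M} {z : K} (hw0 : w ≠ 0) (hw : ⁅h, w⁆ = z • w) :
    ∃ r s : ℕ,
      ((s : K) - r = z ∧ (toEnd K L M f ^ s) ((toEnd K L M e ^ r) w) ≠ 0) ∨
      ((r : K) - s = z ∧ (toEnd K L M e ^ s) ((toEnd K L M f ^ r) w) ≠ 0) := by
  obtain ⟨r, k, hk, hne⟩ := exists_nat_pow_ne_zero t he hf hw0 hw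
  rcases le_or_gt r k with hrk | hkr
  · refine ⟨r, k - r, Or.inl ⟨?_, hne _ (Nat.sub_le k r)⟩⟩
    rw [Nat.cast_sub hrk]; linear_combination -hk
  · obtain ⟨r', k', hk', hne'⟩ := exists_nat_pow_ne_zero t.symm hf he hw0
      (by rw [neg_lie, hw, neg_smul] : ⁅-h, w⁆ = (-z) • w)
    have hsum : k + k' = 2 * r + 2 * r' := by
      have : ((k + k' : ℕ) : K) = ((2 * r + 2 * r' : ℕ) : K) := by
        push_cast; linear_combination -hk - hk'
      exact_mod_cast this
    refine ⟨r', k' - r', Or.inr ⟨?_, hne' _ (Nat.sub_le k' r')⟩⟩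
    rw [Nat.cast_sub (by omega)]; linear_combination hk'

end Sl2

section Base

variable {ι R M N : Type*} [Field R] [AddCommGroup M] [Module R M]
  [AddCommGroup N] [Module R N] {P : RootPairing ι R M N} (b : P.Base)

theorem exists_root'_apply_eq [P.IsRootSystem] (f : ι → R) :
    ∃ y : N, ∀ j ∈ b.support, P.root' j y = f j := by
  obtain ⟨y, hy⟩ := P.toLinearMap.flip.toPerfPair.surjective
    (b.toWeightBasis.constr R fun j : b.support => f j)
  refine ⟨y, fun j hj => ?_⟩
  have := b.toWeightBasis.constr_basis R (fun j : b.support => f j) ⟨j, hj⟩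
  rwa [← hy, RootPairing.Base.toWeightBasis_apply] at this

variable [CharZero R]

theorem exists_root_eq_neg (i : ι) : ∃ j, P.root j = -P.root i ∧ b.height j = -b.height i := by
  let := P.indexNeg
  refine ⟨-i, ?_, b.height_reflectionPerm_self i⟩
  rw [RootPairing.indexNeg_neg, RootPairing.root_reflectionPerm, RootPairing.reflection_apply_self]

theorem isPos_or_exists_root_eq_neg (i : ι) :
    b.IsPos i ∨ ∃ j, b.IsPos j ∧ P.root i = -P.root j := by
  obtain ⟨j, hj, hji⟩ := exists_root_eq_neg b i
  rcases (b.height_ne_zero i).lt_or_gt with hi | hi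
  · exact Or.inr ⟨j, b.isPos_iff.2 (by omega), by rw [hj, neg_neg]⟩
  · exact Or.inl hi

theorem exists_root_eq_sum_of_isPos {i : ι} (hi : b.IsPos i) :
    ∃ f : ι → ℕ, P.root i = ∑ j ∈ b.support, f j • P.root j ∧
      b.height i = ∑ j ∈ b.support, (f j : ℤ) := by
  obtain ⟨f, -, hf, hsum⟩ := b.exists_root_eq_sum_int i
  have hht := b.height_eq_sum hsum
  have hf0 : 0 ≤ f := by
    refine hf.elim le_of_lt fun hf => absurd hi (not_lt.2 ?_)
    exact hht ▸ Finset.sum_nonpos fun j _ => hf.le j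
  lift f to ι → ℕ using hf0
  exact ⟨f, by simpa only [natCast_zsmul] using hsum, hht⟩

theorem root_mem_closure_of_isPos {i : ι} (hi : b.IsPos i) :
    P.root i ∈ AddSubmonoid.closure (P.root '' b.support) := by
  obtain ⟨f, hf, -⟩ := exists_root_eq_sum_of_isPos b hi
  rw [hf]
  exact sum_mem fun j hj => nsmul_mem (AddSubmonoid.subset_closure (Set.mem_image_of_mem _ hj)) _

variable [P.IsRootSystem]

theorem exists_root'_apply_eq_height : ∃ y : N, ∀ i, P.root' i y = b.height i := by
  obtain ⟨y, hy⟩ := exists_root'_apply_eq b fun _ => 1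
  refine ⟨y, fun i => ?_⟩
  obtain ⟨f, -, -, hsum⟩ := b.exists_root_eq_sum_int i
  rw [b.height_eq_sum hsum, RootPairing.root', hsum, map_sum, LinearMap.sum_apply, Int.cast_sum]
  refine Finset.sum_congr rfl fun j hj => ?_
  rw [map_zsmul, LinearMap.smul_apply]
  exact (congrArg _ (hy j hj)).trans (by simp)

theorem eq_or_height_lt_of_sub_mem_closure {i j : ι}
    (hij : P.root j - P.root i ∈ AddSubmonoid.closure (P.root '' b.support)) :
    i = j ∨ b.height i < b.height j := by
  obtain ⟨y, hy⟩ := exists_root'_apply_eq_height b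
  have key : ∀ x ∈ AddSubmonoid.closure (P.root '' b.support),
      ∃ n : ℕ, P.toLinearMap x y = n ∧ (n = 0 → x = 0) := by
    intro x hx
    induction hx using AddSubmonoid.closure_induction with
    | zero => exact ⟨0, by simp⟩
    | add x y _ _ hx hy =>
      obtain ⟨n, hn, hn'⟩ := hx
      obtain ⟨m, hm, hm'⟩ := hy
      refine ⟨n + m, by rw [map_add, LinearMap.add_apply, hn, hm]; push_cast; ring, fun h => ?_⟩
      rw [hn' (by omega), hm' (by omega), add_zero]
    | mem x hx =>
      obtain ⟨j, hj, rfl⟩ := hx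
      exact ⟨1, (hy j).trans (by rw [b.height_one_of_mem_support hj]; simp), by simp⟩
  obtain ⟨n, hn, hn0⟩ := key _ hij
  have hn' : b.height j - b.height i = n := by
    have : P.root' j y - P.root' i y = n := by
      rwa [map_sub, LinearMap.sub_apply] at hn
    rw [hy, hy] at this
    exact_mod_cast this
  rcases n.eq_zero_or_pos with rfl | hpos
  · exact Or.inl (P.root.injective (sub_eq_zero.1 (hn0 rfl))).symm
  · exact Or.inr (by omega)

theorem exists_parabolic_coweight [Finite ι] {j : ι} (hj : j ∈ b.support) :
    ∃ y : N, P.root' j y = 0 ∧ ∀ i, b.IsPos i → ∃ n : ℕ,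
      P.root' i y = n ∧ (n : ℤ) ≤ b.height i ∧ (n = 0 → i = j) := by
  classical
  obtain ⟨y, hy⟩ := exists_root'_apply_eq b fun k => if k = j then 0 else 1
  refine ⟨y, by simpa using hy j hj, fun i hi => ?_⟩
  obtain ⟨f, hf, hht⟩ := exists_root_eq_sum_of_isPos b hi
  refine ⟨∑ k ∈ b.support, if k = j then 0 else f k, ?_, ?_, fun h0 => ?_⟩
  · rw [RootPairing.root', hf, map_sum, LinearMap.sum_apply, Nat.cast_sum]
    refine Finset.sum_congr rfl fun k hk => ?_
    rw [map_nsmul, LinearMap.smul_apply]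
    refine (congrArg _ (hy k hk)).trans ?_
    split_ifs <;> simp
  · rw [hht, Nat.cast_sum]
    refine Finset.sum_le_sum fun k _ => ?_
    split_ifs <;> simp
  · have hfk : ∀ k ∈ b.support, k ≠ j → f k = 0 := fun k hk hkj => by
      simpa [hkj] using Finset.sum_eq_zero_iff.1 h0 k hk
    have hij : P.root i = f j • P.root j := by
      rw [hf, Finset.sum_eq_single_of_mem j hj fun k hk hkj => by rw [hfk k hk hkj, zero_smul]]
    have : IsAddTorsionFree M := .of_isTorsionFree R _
    have : IsAddTorsionFree N := .of_isTorsionFree R _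
    rcases b.eq_one_or_neg_one_of_mem_support_of_smul_mem j hj (f j)
      ⟨i, by rw [hij, Nat.cast_smul_eq_nsmul]⟩ with h | h
    · rw [Nat.cast_eq_one.1 h, one_smul] at hij
      exact P.root.injective hij
    · exact absurd h (by norm_cast)

end Base

section HighestRoot

open LieAlgebra LieAlgebra.IsKilling LieModule

variable {K g : Type*} [Field K] [LieRing g] [LieAlgebra K g]
  {H : LieSubalgebra K g} [LieRing.IsNilpotent H]

theorem lie_eq_zero_or_exists_weight [LinearWeights K H g] {χ₁ χ₂ : Module.Dual K H}
    {x y : g} (hx : x ∈ rootSpace H χ₁) (hy : y ∈ rootSpace H χ₂) :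
    ⁅x, y⁆ = 0 ∨ ∃ χ : Weight K H g, χ.toLinear = χ₁ + χ₂ ∧ ⁅x, y⁆ ∈ rootSpace H χ := by
  have hxy : ⁅x, y⁆ ∈ rootSpace H ((χ₁ : H → K) + χ₂) :=
    lie_mem_genWeightSpace_of_mem_genWeightSpace hx hy
  by_cases h : rootSpace H ((χ₁ : H → K) + χ₂) = ⊥
  · rw [h] at hxy
    exact Or.inl ((LieSubmodule.mem_bot _).1 hxy)
  · exact Or.inr ⟨⟨_, h⟩, by ext; rfl, hxy⟩

variable [FiniteDimensional K g] [IsTriangularizable K H g]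

theorem eq_top_of_rootSpace_le {T : Submodule K g}
    (hT : ∀ χ : Weight K H g, (rootSpace H χ).toSubmodule ≤ T) : T = ⊤ := by
  rw [eq_top_iff, ← LieSubmodule.top_toSubmodule (R := K) (L := H),
    ← iSup_genWeightSpace_eq_top' K H g, LieSubmodule.iSup_toSubmodule]
  exact iSup_le hT

variable [CharZero K] [IsKilling K g] [H.IsCartanSubalgebra]

theorem weight_eq_zero_or_root (χ : Weight K H g) :
    χ.toLinear = 0 ∨ ∃ i : H.root, (rootSystem H).root i = χ.toLinear := by
  by_cases h : χ.IsZero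
  · left; ext x; simp [h.eq]
  · exact Or.inr ⟨⟨χ, by simpa using h⟩, rfl⟩

variable (b : (rootSystem H).Base)

/-- The nilpotent subalgebra `n₋` spanned by the negative root spaces. -/
def negNilradical : Submodule K g := ⨆ i : H.root, ⨆ _ : b.IsPos i,
  (rootSpace H (-(rootSystem H).root i)).toSubmodule

/-- The Borel subalgebra `h ⊕ n₊`. -/
def posBorel : Submodule K g := H.toSubmodule ⊔ ⨆ i : H.root, ⨆ _ : b.IsPos i,
  (rootSpace H i.1).toSubmodule

/-- The sum of the weight spaces of `g` whose weight `χ` satisfies `χ ≤ θ` in the order given by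
the simple roots. -/
def weightSpacesLE (θ : Module.Dual K H) : Submodule K g :=
  ⨆ χ : Weight K H g,
    ⨆ _ : θ - χ.toLinear ∈ AddSubmonoid.closure ((rootSystem H).root '' b.support),
      (rootSpace H χ).toSubmodule

theorem negNilradical_sup_posBorel : negNilradical b ⊔ posBorel b = ⊤ := by
  refine eq_top_of_rootSpace_le (H := H) fun χ => ?_
  rcases weight_eq_zero_or_root χ with hχ | ⟨i, hi⟩
  · have hχ : (χ : H → K) = 0 := congrArg DFunLike.coe hχ
    rw [hχ]
    exact le_sup_of_le_right (le_sup_of_le_left fun x hx => by simpa using hx)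
  have hi : ⇑((rootSystem H).root i) = χ := congrArg DFunLike.coe hi
  rw [← hi]
  rcases isPos_or_exists_root_eq_neg b i with hi | ⟨j, hj, hij⟩
  · exact le_sup_of_le_right (le_sup_of_le_right (le_iSup₂_of_le i hi le_rfl))
  · rw [hij]
    exact le_sup_of_le_left (le_iSup₂_of_le j hj le_rfl)

theorem lie_mem_rootSpace_of_forall_height_le {θ : H.root} (hθ : ∀ i, b.height i ≤ b.height θ)
    {x : g} (hx : x ∈ posBorel b) {w : g} (hw : w ∈ rootSpace H θ.1) :
    ⁅x, w⁆ ∈ rootSpace H θ.1 := by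
  suffices posBorel b ≤ (rootSpace H θ.1).toSubmodule.comap ((toEnd K g g).toLinearMap.flip w) from
    this hx
  refine sup_le (fun x hx => LieSubmodule.lie_mem (x := (⟨x, hx⟩ : H)) _ hw)
    (iSup₂_le fun i hi x hx => ?_)
  obtain ⟨y, hy⟩ := exists_root'_apply_eq_height b
  have hθpos : 0 < b.height θ := hi.trans_le (hθ i)
  rcases lie_eq_zero_or_exists_weight (χ₁ := (rootSystem H).root i) (χ₂ := (rootSystem H).root θ)
    hx hw with h | ⟨χ, hχ, -⟩
  · change ⁅x, w⁆ ∈ rootSpace H θ.1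
    rw [h]
    exact zero_mem _
  rcases weight_eq_zero_or_root χ with h | ⟨k, hk⟩
  · have hsum : (rootSystem H).root' i y + (rootSystem H).root' θ y = 0 :=
      LinearMap.congr_fun (h ▸ hχ).symm y
    rw [hy, hy] at hsum
    have : b.height i + b.height θ = 0 := by exact_mod_cast hsum
    have : 0 < b.height i := hi
    omega
  · have := b.height_add (hk.trans hχ)
    have := hθ k
    have : 0 < b.height i := hi
    omega

theorem lie_mem_weightSpacesLE {θ : Module.Dual K H} {x : g} (hx : x ∈ negNilradical b) {w : g}
    (hw : w ∈ weightSpacesLE b θ) : ⁅x, w⁆ ∈ weightSpacesLE b θ := by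
  suffices ∀ χ : Weight K H g,
      θ - χ.toLinear ∈ AddSubmonoid.closure ((rootSystem H).root '' b.support) →
      ∀ w ∈ rootSpace H χ, negNilradical b ≤
        (weightSpacesLE b θ).comap ((toEnd K g g).toLinearMap.flip w) from
    (iSup₂_le fun χ hχ w hw => this χ hχ w hw hx :
      weightSpacesLE b θ ≤ (weightSpacesLE b θ).comap (toEnd K g g x)) hw
  refine fun χ hχ w hw => iSup₂_le fun i hi x hx => ?_
  rcases lie_eq_zero_or_exists_weight (χ₁ := -(rootSystem H).root i) (χ₂ := χ.toLinear)
    hx hw with h | ⟨χ', hχ', h⟩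
  · change ⁅x, w⁆ ∈ weightSpacesLE b θ
    rw [h]
    exact zero_mem _
  · refine le_iSup₂_of_le (f := fun (χ : Weight K H g) _ => (rootSpace H χ).toSubmodule)
      χ' ?_ le_rfl h
    rw [hχ', show θ - (-(rootSystem H).root i + χ.toLinear) =
      (θ - χ.toLinear) + (rootSystem H).root i by abel]
    exact add_mem hχ (root_mem_closure_of_isPos b hi)

end HighestRoot

section IsHighestRoot

open LieAlgebra LieAlgebra.IsKilling LieModule

variable {g : Type*} [LieRing g] [LieAlgebra ℂ g] [FiniteDimensional ℂ g] [LieAlgebra.IsSimple ℂ g]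
  {H : LieSubalgebra ℂ g} [H.IsCartanSubalgebra] {b : (rootSystem H).Base}

theorem weightSpacesLE_eq_top {θ : H.root} (hθ : ∀ i, b.height i ≤ b.height θ) :
    weightSpacesLE b ((rootSystem H).root θ) = ⊤ := by
  let W := (rootSpace H θ.1).toSubmodule
  let ideal : LieIdeal ℂ g :=
    { stableSpan (LieAlgebra.ad ℂ g) (negNilradical b) W with
      lie_mem := fun hm => apply_mem_stableSpan_of_sup_eq_top _ (negNilradical_sup_posBorel b)
        (fun _ hx _ hw => lie_mem_rootSpace_of_forall_height_le b hθ hx hw) _ hm }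
  have ideal_le : ideal.toSubmodule ≤ weightSpacesLE b ((rootSystem H).root θ) :=
    stableSpan_le _ (le_iSup₂_of_le θ.1 (by rw [rootSystem_root_apply, sub_self]; exact zero_mem _)
      le_rfl) fun _ hx _ hw => lie_mem_weightSpacesLE b hx hw
  have ideal_ne_bot : ideal ≠ ⊥ := by
    obtain ⟨x, hx, hx0⟩ := θ.1.exists_ne_zero
    intro h
    have hx' : x ∈ ideal := le_stableSpan (LieAlgebra.ad ℂ g) hx
    rw [h] at hx'
    exact hx0 ((LieSubmodule.mem_bot _).1 hx')
  rw [eq_top_iff, ← LieSubmodule.top_toSubmodule (R := ℂ) (L := g),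
    ← (LieAlgebra.IsSimple.eq_bot_or_eq_top (R := ℂ) ideal).resolve_left ideal_ne_bot]
  exact ideal_le

theorem isHighestRoot_of_forall_height_le {θ : H.root} (hθ : ∀ i, b.height i ≤ b.height θ) :
    IsHighestRoot b θ := by
  intro β
  by_contra hβ
  have le_iSup_ne : weightSpacesLE b ((rootSystem H).root θ) ≤
      (⨆ χ, ⨆ _ : χ ≠ β.1, rootSpace H (χ : Weight ℂ H g)).toSubmodule :=
    iSup₂_le fun χ hχ => (LieSubmodule.toSubmodule_le_toSubmodule _ _).2
      (le_iSup₂_of_le χ (by rintro rfl; exact hβ hχ) le_rfl)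
  rw [weightSpacesLE_eq_top hθ, top_le_iff, LieSubmodule.toSubmodule_eq_top] at le_iSup_ne
  have hdisj := iSupIndep_genWeightSpace' ℂ H g β.1
  rw [le_iSup_ne, disjoint_top] at hdisj
  exact β.1.2 hdisj

theorem nonempty_root : Nonempty H.root := by
  have := (inferInstance : (rootSystem H).IsIrreducible).nontrivial
  by_contra hne
  rw [not_nonempty_iff] at hne
  have := RootPairing.IsRootSystem.span_root_eq_top (P := rootSystem H)
  rw [Set.range_eq_empty, Submodule.span_empty] at this
  exact bot_ne_top this

variable (b) in
theorem exists_isHighestRoot : ∃ θ : H.root, IsHighestRoot b θ := by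
  have := nonempty_root (H := H)
  obtain ⟨θ, hθ⟩ := Finite.exists_max fun i => b.height i
  exact ⟨θ, isHighestRoot_of_forall_height_le hθ⟩

theorem IsHighestRoot.eq_or_height_lt {θ : H.root} (hθ : IsHighestRoot b θ) (i : H.root) :
    i = θ ∨ b.height i < b.height θ :=
  eq_or_height_lt_of_sub_mem_closure b (hθ i)

theorem IsHighestRoot.height_le {θ : H.root} (hθ : IsHighestRoot b θ) (i : H.root) :
    b.height i ≤ b.height θ :=
  (hθ.eq_or_height_lt i).elim (fun h => h ▸ le_rfl) le_of_lt

theorem IsHighestRoot.isPos {θ : H.root} (hθ : IsHighestRoot b θ) : b.IsPos θ := by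
  obtain ⟨j, -, hj⟩ := exists_root_eq_neg b θ
  have := hθ.height_le j
  have := b.height_ne_zero θ
  exact b.isPos_iff.2 (by omega)

end IsHighestRoot

theorem fg_of_le {R M : Type*} [Ring R] [IsNoetherianRing R] [AddCommGroup M] [Module R M]
    {S T : Submodule R M} (hT : T.FG) (hST : S ≤ T) : S.FG :=
  have := isNoetherian_of_fg_of_noetherian T hT
  Submodule.FG.of_le_of_isNoetherian hST

section Homogeneous

open LieAlgebra.IsKilling LieAlgebra

variable {g : Type*} [LieRing g] [LieAlgebra ℂ g] (B : InvariantForm g) {H : LieSubalgebra ℂ g}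

/-- The affine part `g ⊗ ℂ[t, t⁻¹] ⊕ ℂ K`. -/
def affinePart : LieIdeal ℂ (AffVir B) where
  carrier := {X | X.virPart = 0 ∧ X.cPart = 0}
  add_mem' hX hY := ⟨by rw [AffVir.add_virPart, hX.1, hY.1, add_zero],
    by rw [AffVir.add_cPart, hX.2, hY.2, add_zero]⟩
  zero_mem' := ⟨rfl, rfl⟩
  smul_mem' r X hX := ⟨by rw [AffVir.smul_virPart, hX.1, smul_zero],
    by rw [AffVir.smul_cPart, hX.2, mul_zero]⟩
  lie_mem {X Y} hY :=
    ⟨by rw [AffVir.lie_virPart, hY.1, map_zero], by rw [AffVir.lie_cPart, hY.1, map_zero]⟩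

/-- The element `h + c d₀` of `AffVir B`, whose eigenvalues define a grading. -/
def gradingElement (h : H) (c : ℂ) : AffVir B :=
  AffVir.loop B 0 (h : g) + c • AffVir.d B 0

variable {B}

theorem loop_mem_affinePart (m : ℤ) (x : g) : AffVir.loop B m x ∈ affinePart B := ⟨rfl, rfl⟩

theorem K_mem_affinePart : AffVir.K B ∈ affinePart B := ⟨rfl, rfl⟩

theorem AffVir.eq_lsum_add_linearCombination (X : AffVir B) :
    X = Finsupp.lsum ℂ (loop B) X.loopPart + X.kPart • K B +
      Finsupp.linearCombination ℂ (d B) X.virPart + X.cPart • C B := by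
  have loop_sum (f : ℤ →₀ g) : Finsupp.lsum ℂ (loop B) f = ⟨f, 0, 0, 0⟩ := by
    induction f using Finsupp.induction_linear with
    | zero => exact map_zero _
    | add f f' hf hf' => rw [map_add, hf, hf']; ext1 <;> simp
    | single m x => exact Finsupp.lsum_single ..
  have vir_sum (u : ℤ →₀ ℂ) : Finsupp.linearCombination ℂ (d B) u = ⟨0, 0, u, 0⟩ := by
    induction u using Finsupp.induction_linear with
    | zero => exact map_zero _
    | add u u' hu hu' => rw [map_add, hu, hu']; ext1 <;> simp
    | single m r => rw [Finsupp.linearCombination_single]; ext1 <;> simp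
  rw [loop_sum, vir_sum]
  ext1 <;> simp

theorem cartanIncl_mk (h : H) (k s c : ℂ) : cartanIncl B ((h, k), s, c) =
    gradingElement B h s + k • AffVir.K B + c • AffVir.C B := by
  simp only [gradingElement, cartanIncl, LinearMap.coe_mk, AddHom.coe_mk]
  abel

theorem gradingElement_eq_cartanIncl (h : H) (c : ℂ) :
    gradingElement B h c = cartanIncl B ((h, 0), c, 0) := by
  simp [cartanIncl_mk]

variable [FiniteDimensional ℂ g] [H.IsCartanSubalgebra]

variable (B) in
/-- The homogeneous elements `x ⊗ tᵐ` (with `x` in a root space or in `H`), `dₘ`, `K` and `C` of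
`AffVir B`; the pair `(wt, m)` is the weight with respect to `H ⊕ ℂ d₀`. -/
inductive IsHomogeneous : Module.Dual ℂ H → ℤ → AffVir B → Prop
  | loop (χ : LieModule.Weight ℂ H g) (m : ℤ) (x : g) (hx : x ∈ rootSpace H χ) :
    IsHomogeneous χ.toLinear m (AffVir.loop B m x)
  | d (m : ℤ) : IsHomogeneous 0 m (AffVir.d B m)
  | K : IsHomogeneous 0 0 (AffVir.K B)
  | C : IsHomogeneous 0 0 (AffVir.C B)

theorem IsHomogeneous.mem_affinePart_or {wt : Module.Dual ℂ H} {m : ℤ} {X : AffVir B}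
    (hX : IsHomogeneous B wt m X) : X ∈ affinePart B ∨ wt = 0 := by
  cases hX with
  | loop χ m x hx => exact Or.inl (loop_mem_affinePart m x)
  | d m => exact Or.inr rfl
  | K => exact Or.inr rfl
  | C => exact Or.inr rfl

theorem loop_mem_of_rootSpace {S : Submodule ℂ (AffVir B)} {m : ℤ}
    (hS : ∀ χ : LieModule.Weight ℂ H g, ∀ x ∈ rootSpace H χ, AffVir.loop B m x ∈ S) (x : g) :
    AffVir.loop B m x ∈ S := by
  have : S.comap (AffVir.loop B m) = ⊤ := eq_top_of_rootSpace_le (H := H) hS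
  exact (this ▸ Submodule.mem_top : x ∈ S.comap (AffVir.loop B m))

variable (B H) in
theorem affinePart_le_span_isHomogeneous : (affinePart B).toSubmodule ≤ Submodule.span ℂ
    {X | X ∈ affinePart B ∧ ∃ (wt : Module.Dual ℂ H) (m : ℤ), IsHomogeneous B wt m X} := by
  rintro X ⟨hvir, hc⟩
  rw [X.eq_lsum_add_linearCombination, hvir, hc, map_zero, zero_smul, add_zero, add_zero]
  refine add_mem (Submodule.finsuppSum_mem _ _ _ _ fun m _ => loop_mem_of_rootSpace (H := H) ?_ _)
    (Submodule.smul_mem _ _ (Submodule.subset_span ⟨K_mem_affinePart, _, _, .K⟩))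
  exact fun χ x hx => Submodule.subset_span ⟨loop_mem_affinePart m x, _, _, .loop χ m x hx⟩

variable (B H) in
theorem span_isHomogeneous_eq_top : Submodule.span ℂ
    {X | ∃ (wt : Module.Dual ℂ H) (m : ℤ), IsHomogeneous B wt m X} = ⊤ := by
  refine eq_top_iff.2 fun X _ => ?_
  rw [X.eq_lsum_add_linearCombination]
  refine add_mem (add_mem ?_ (Submodule.finsuppSum_mem _ _ _ _ fun m _ => ?_)) ?_
  · exact Submodule.span_mono (fun _ h => h.2) (affinePart_le_span_isHomogeneous B H
      (add_mem (Submodule.finsuppSum_mem _ _ _ _ fun m _ => loop_mem_affinePart m _)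
        (Submodule.smul_mem _ _ K_mem_affinePart)))
  · exact Submodule.smul_mem _ _ (Submodule.subset_span ⟨_, _, .d m⟩)
  · exact Submodule.smul_mem _ _ (Submodule.subset_span ⟨_, _, .C⟩)

theorem IsHomogeneous.mem_range_cartanIncl {X : AffVir B}
    (hX : IsHomogeneous B (0 : Module.Dual ℂ H) 0 X) :
    X ∈ LinearMap.range (cartanIncl B : ExtCartan H →ₗ[ℂ] AffVir B) := by
  generalize hwt : (0 : Module.Dual ℂ H) = wt, hm : (0 : ℤ) = m at hX
  cases hX with
  | loop χ m x hx =>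
    have hχ : (χ : H → ℂ) = 0 := by ext y; exact (LinearMap.congr_fun hwt y).symm
    rw [hχ] at hx
    have hxH : x ∈ H := by simpa using hx
    exact ⟨((⟨x, hxH⟩, 0), 0, 0), by simp [cartanIncl, ← hm]⟩
  | d m => exact ⟨((0, 0), 1, 0), by simp [cartanIncl, ← hm]⟩
  | K => exact ⟨((0, 1), 0, 0), by simp [cartanIncl]⟩
  | C => exact ⟨((0, 0), 0, 1), by simp [cartanIncl]⟩

variable (B) in
/-- The span of the homogeneous elements of degree `z`, where an element of weight `(wt, m)` has
degree `wt h + c m`. -/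
def degreePart (h : H) (c z : ℂ) : Submodule ℂ (AffVir B) :=
  Submodule.span ℂ {X | ∃ (wt : Module.Dual ℂ H) (m : ℤ), IsHomogeneous B wt m X ∧ wt h + c * m = z}

theorem IsHomogeneous.mem_degreePart {wt : Module.Dual ℂ H} {m : ℤ} {X : AffVir B}
    (hX : IsHomogeneous B wt m X) {h : H} {c z : ℂ} (hz : wt h + c * m = z) :
    X ∈ degreePart B h c z := Submodule.subset_span ⟨wt, m, hX, hz⟩

variable (B) in
theorem fg_degreePart (h : H) {c : ℂ} (hc : c ≠ 0) (z : ℂ) : (degreePart B h c z).FG := by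
  let degrees : Set ℤ := (fun m : ℤ => z - c * m) ⁻¹'
    insert 0 (Set.range fun χ : LieModule.Weight ℂ H g => χ h)
  have degrees_finite : degrees.Finite := ((Set.finite_range _).insert 0).preimage
    fun m _ m' _ hmm' => by simpa [hc] using hmm'
  let S := (⨆ m ∈ degrees_finite.toFinset,
    LinearMap.range (AffVir.loop B m) ⊔ Submodule.span ℂ {AffVir.d B m}) ⊔
    Submodule.span ℂ {AffVir.K B, AffVir.C B}
  have le_S {m : ℤ} (hm : m ∈ degrees) :
      LinearMap.range (AffVir.loop B m) ⊔ Submodule.span ℂ {AffVir.d B m} ≤ S :=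
    le_sup_of_le_left (le_iSup₂_of_le m (degrees_finite.mem_toFinset.2 hm) le_rfl)
  have S_fg : S.FG := (Submodule.fg_biSup _ _ fun m _ => (Module.Finite.iff_fg.1 inferInstance).sup
    (Submodule.fg_span_singleton _)).sup (Submodule.fg_span (by simp))
  refine fg_of_le S_fg (Submodule.span_le.2 ?_)
  rintro X ⟨wt, m, ⟨χ, m, x, hx⟩ | m | _ | _, hz⟩
  · exact le_S (Or.inr ⟨χ, by rw [← hz]; simp⟩) (Submodule.mem_sup_left ⟨x, rfl⟩)
  · exact le_S (Or.inl (by rw [← hz]; simp))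
      (Submodule.mem_sup_right (Submodule.mem_span_singleton_self _))
  · exact Submodule.mem_sup_right (Submodule.subset_span (by simp))
  · exact Submodule.mem_sup_right (Submodule.subset_span (by simp))

variable [LieAlgebra.IsSimple ℂ g]

theorem IsHomogeneous.lie_gradingElement {wt : Module.Dual ℂ H} {m : ℤ} {X : AffVir B}
    (hX : IsHomogeneous B wt m X) (h : H) (c : ℂ) :
    ⁅gradingElement B h c, X⁆ = (wt h + c * m) • X := by
  rw [gradingElement, add_lie, smul_lie]
  cases hX with
  | loop χ m x hx =>
    have hhx : ⁅(h : g), x⁆ = χ h • x := lie_eq_smul_of_mem_rootSpace hx h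
    simp [AffVir.loop_lie_loop, AffVir.d_lie_loop, hhx, add_smul, mul_smul]
  | d m =>
    rw [← lie_skew, AffVir.d_lie_loop, AffVir.d_lie_d]
    simp [mul_smul]
  | K => simp [← lie_skew _ (AffVir.K B), AffVir.K_lie]
  | C => simp [← lie_skew _ (AffVir.C B), AffVir.C_lie]

theorem IsHomogeneous.lie_cartanIncl {wt : Module.Dual ℂ H} {m : ℤ} {X : AffVir B}
    (hX : IsHomogeneous B wt m X) (y : ExtCartan H) :
    ⁅cartanIncl B y, X⁆ = (wt y.1.1 + y.2.1 * m) • X := by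
  obtain ⟨⟨h, k⟩, s, c⟩ := y
  rw [cartanIncl_mk, add_lie, add_lie, smul_lie, smul_lie, AffVir.K_lie, AffVir.C_lie,
    hX.lie_gradingElement]
  simp

end Homogeneous

section Grading

open LieAlgebra.IsKilling LieAlgebra

variable {g : Type*} [LieRing g] [LieAlgebra ℂ g] [FiniteDimensional ℂ g] [LieAlgebra.IsSimple ℂ g]
  {B : InvariantForm g} {H : LieSubalgebra ℂ g} [H.IsCartanSubalgebra]
  {b : (rootSystem H).Base}

variable (b) in
/-- The pairs `(wt, m)` that are weights of `n₊ ⊕ Vir⁺`. -/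
def IsPosWeight (wt : Module.Dual ℂ H) (m : ℤ) : Prop :=
  (0 < m ∧ (wt = 0 ∨ ∃ i, wt = (rootSystem H).root i)) ∨
    (m = 0 ∧ ∃ i, b.IsPos i ∧ wt = (rootSystem H).root i)

variable (b) in
theorem IsHomogeneous.trichotomy {wt : Module.Dual ℂ H} {m : ℤ} {X : AffVir B}
    (hX : IsHomogeneous B wt m X) :
    IsPosWeight b wt m ∨ (wt = 0 ∧ m = 0) ∨ IsPosWeight b (-wt) (-m) := by
  have hwt : wt = 0 ∨ ∃ i, wt = (rootSystem H).root i := by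
    cases hX with
    | loop χ m x hx =>
      exact (weight_eq_zero_or_root χ).imp_right fun ⟨i, hi⟩ => ⟨i, hi.symm⟩
    | d m => exact Or.inl rfl
    | K => exact Or.inl rfl
    | C => exact Or.inl rfl
  rcases lt_trichotomy m 0 with hm | rfl | hm
  · refine Or.inr (Or.inr (Or.inl ⟨neg_pos.2 hm, hwt.imp neg_eq_zero.2 ?_⟩))
    rintro ⟨i, rfl⟩
    exact (exists_root_eq_neg b i).imp fun j hj => hj.1.symm
  · rcases hwt with rfl | ⟨i, rfl⟩
    · exact Or.inr (Or.inl ⟨rfl, rfl⟩)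
    · rcases isPos_or_exists_root_eq_neg b i with hi | ⟨j, hj, hij⟩
      · exact Or.inl (Or.inr ⟨rfl, i, hi, rfl⟩)
      · exact Or.inr (Or.inr (Or.inr ⟨neg_zero, j, hj, by rw [hij, neg_neg]⟩))
  · exact Or.inl (Or.inl ⟨hm, hwt⟩)

theorem IsHomogeneous.mem_posPart {wt : Module.Dual ℂ H} {m : ℤ} {X : AffVir B}
    (hX : IsHomogeneous B wt m X) (hp : IsPosWeight b wt m) : X ∈ posPart B b := by
  rcases hp with ⟨hm, -⟩ | ⟨rfl, i, hi, hwt⟩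
  · cases hX with
    | loop χ m x hx => exact Submodule.subset_span (Or.inl (Or.inr ⟨m, hm, x, rfl⟩))
    | d m => exact Submodule.subset_span (Or.inr ⟨m, hm, rfl⟩)
    | K => exact absurd hm (lt_irrefl _)
    | C => exact absurd hm (lt_irrefl _)
  · have hne := (rootSystem H).ne_zero i
    cases hX with
    | loop χ m x hx =>
      have hχ : (χ : H → ℂ) = i.1 := by ext y; exact LinearMap.congr_fun hwt y
      rw [hχ] at hx
      exact Submodule.subset_span (Or.inl (Or.inl ⟨i, hi, x, hx, rfl⟩))
    | d m => exact absurd hwt.symm hne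
    | K => exact absurd hwt.symm hne
    | C => exact absurd hwt.symm hne

theorem IsPosWeight.exists_int_eq {h : H} {k : H.root → ℤ}
    (hk : ∀ i, (rootSystem H).root i h = k i) (c : ℤ) {wt : Module.Dual ℂ H} {m : ℤ}
    (hp : IsPosWeight b wt m) : ∃ z : ℤ, wt h + c * m = z ∧ ((0 < m ∧ z = c * m) ∨
      ∃ i, wt = (rootSystem H).root i ∧ z = k i + c * m ∧ (0 < m ∨ m = 0 ∧ b.IsPos i)) := by
  rcases hp with ⟨hm, rfl | ⟨i, rfl⟩⟩ | ⟨rfl, i, hi, rfl⟩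
  · exact ⟨c * m, by simp, Or.inl ⟨hm, rfl⟩⟩
  · exact ⟨k i + c * m, by rw [hk]; push_cast; ring, Or.inr ⟨i, rfl, rfl, Or.inl hm⟩⟩
  · exact ⟨k i + c * 0, by rw [hk]; push_cast; ring, Or.inr ⟨i, rfl, rfl, Or.inr ⟨rfl, hi⟩⟩⟩

variable (b) in
/-- The grading by the eigenvalues of `h + c d₀` is weakly positive if the degrees occurring
in `n₊ ⊕ Vir⁺` are non-negative integers. -/
def IsWeaklyPositive (h : H) (c : ℂ) : Prop :=
  ∀ (wt : Module.Dual ℂ H) (m : ℤ), IsPosWeight b wt m → ∃ n : ℕ, wt h + c * m = n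

variable (b) in
/-- The grading by the eigenvalues of `h + c d₀` is strictly positive if the degrees occurring
in `n₊ ⊕ Vir⁺` are positive integers, as for the principal grading. -/
def IsStrictlyPositive (h : H) (c : ℂ) : Prop :=
  ∀ (wt : Module.Dual ℂ H) (m : ℤ), IsPosWeight b wt m → ∃ n : ℕ, wt h + c * m = (n + 1 : ℕ)

variable (b) in
/-- The grading by the eigenvalues of `h + c d₀` cuts out the minimal parabolic subalgebra of the
root `(α, l)`: it is weakly positive and this is the only positive weight of degree zero. -/
structure IsMinimalParabolic (α : Module.Dual ℂ H) (l : ℤ) (h : H) (c : ℂ) : Prop where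
  isWeaklyPositive : IsWeaklyPositive b h c
  degree_eq_zero : α h + c * l = 0
  eq_of_degree_eq_zero : ∀ (wt : Module.Dual ℂ H) (m : ℤ), IsPosWeight b wt m →
    wt h + c * m = 0 → wt = α ∧ m = l

theorem IsWeaklyPositive.exists_nat_eq_neg {h : H} {c : ℂ} (hc : IsWeaklyPositive b h c)
    {wt : Module.Dual ℂ H} {m : ℤ} (hn : IsPosWeight b (-wt) (-m)) :
    ∃ n : ℕ, wt h + c * m = -(n : ℂ) := by
  obtain ⟨n, hn⟩ := hc _ _ hn
  refine ⟨n, ?_⟩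
  rw [← hn, LinearMap.neg_apply]
  push_cast
  ring

theorem IsStrictlyPositive.isWeaklyPositive {h : H} {c : ℂ} (hc : IsStrictlyPositive b h c) :
    IsWeaklyPositive b h c := fun _ _ hp => (hc _ _ hp).imp' (· + 1) fun _ hn => hn

theorem IsStrictlyPositive.exists_nat_eq_neg {h : H} {c : ℂ} (hc : IsStrictlyPositive b h c)
    {wt : Module.Dual ℂ H} {m : ℤ} (hn : IsPosWeight b (-wt) (-m)) :
    ∃ n : ℕ, wt h + c * m = -((n + 1 : ℕ) : ℂ) := by
  obtain ⟨n, hn⟩ := hc _ _ hn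
  refine ⟨n, ?_⟩
  rw [← hn, LinearMap.neg_apply]
  push_cast
  ring

theorem IsStrictlyPositive.ne_zero {h : H} {c : ℂ} (hc : IsStrictlyPositive b h c) : c ≠ 0 := by
  rintro rfl
  obtain ⟨n, hn⟩ := hc 0 1 (Or.inl ⟨one_pos, Or.inl rfl⟩)
  rw [LinearMap.zero_apply, zero_mul, add_zero] at hn
  exact n.succ_ne_zero (by exact_mod_cast hn.symm)

theorem isMinimalParabolic_of_exists_int {α : Module.Dual ℂ H} {l : ℤ} {h : H} {c : ℂ}
    (h0 : α h + c * l = 0) (hpos : ∀ (wt : Module.Dual ℂ H) (m : ℤ), IsPosWeight b wt m →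
      ∃ z : ℤ, wt h + c * m = z ∧ 0 ≤ z ∧ (z = 0 → wt = α ∧ m = l)) :
    IsMinimalParabolic b α l h c where
  isWeaklyPositive wt m hp := by
    obtain ⟨z, hz, hz0, -⟩ := hpos wt m hp
    lift z to ℕ using hz0
    exact ⟨z, by simpa using hz⟩
  degree_eq_zero := h0
  eq_of_degree_eq_zero wt m hp hdeg := by
    obtain ⟨z, hz, -, huniq⟩ := hpos wt m hp
    exact huniq (by exact_mod_cast hz.symm.trans hdeg)

section HighestRoot

variable {θ : H.root} (hθ : IsHighestRoot b θ)

include hθ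

theorem IsHighestRoot.neg_height_le (i : H.root) : -b.height θ ≤ b.height i := by
  obtain ⟨j, -, hj⟩ := exists_root_eq_neg b i
  have := hθ.height_le j
  omega

theorem IsHighestRoot.isStrictlyPositive {h : H}
    (hh : ∀ i, (rootSystem H).root i h = b.height i) :
    IsStrictlyPositive b h ((b.height θ + 1 : ℤ) : ℂ) := by
  intro wt m hp
  have hθpos : 0 < b.height θ := hθ.isPos
  obtain ⟨z, hz, hcase⟩ := hp.exists_int_eq hh (b.height θ + 1)
  have z_pos : 0 < z := by
    rcases hcase with ⟨hm, rfl⟩ | ⟨i, -, rfl, hm | ⟨rfl, hi⟩⟩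
    · positivity
    · nlinarith [hθ.neg_height_le i]
    · simpa using b.isPos_iff.1 hi
  obtain ⟨n, rfl⟩ := Int.eq_succ_of_zero_lt z_pos
  exact ⟨n, by rw [hz]; push_cast; ring⟩

theorem IsHighestRoot.exists_isMinimalParabolic_simple {j : H.root} (hj : j ∈ b.support) :
    ∃ (h : H) (c : ℂ), IsMinimalParabolic b ((rootSystem H).root j) 0 h c := by
  obtain ⟨h, hj0, hh⟩ := exists_parabolic_coweight b hj
  have hθpos : 0 < b.height θ := hθ.isPos
  have hk (i : H.root) : ∃ k : ℤ, (rootSystem H).root i h = k ∧ -b.height θ ≤ k ∧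
      (b.IsPos i → 0 ≤ k ∧ (k = 0 → i = j)) := by
    obtain ⟨i', hi', hii'⟩ := exists_root_eq_neg b i
    have := hθ.height_le i'
    rcases (b.height_ne_zero i).lt_or_gt with hi | hi
    · obtain ⟨n, hn, hle, -⟩ := hh i' (b.isPos_iff.2 (by omega))
      refine ⟨-n, ?_, by omega, fun hi_pos => absurd (b.isPos_iff.1 hi_pos) hi.not_gt⟩
      rw [← neg_eq_iff_eq_neg.2 hi', LinearMap.neg_apply, Int.cast_neg, Int.cast_natCast]
      exact congrArg Neg.neg hn
    · obtain ⟨n, hn, -, hn0⟩ := hh i hi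
      exact ⟨n, by simpa using hn, by omega, fun _ => ⟨by omega, fun h => hn0 (by omega)⟩⟩
  choose k hk hk_ge hk_pos using hk
  refine ⟨h, (b.height θ + 1 : ℤ), isMinimalParabolic_of_exists_int (by simpa using hj0)
    fun wt m hp => ?_⟩
  obtain ⟨z, hz, hcase⟩ := hp.exists_int_eq hk (b.height θ + 1)
  refine ⟨z, hz, ?_⟩
  rcases hcase with ⟨hm, rfl⟩ | ⟨i, rfl, rfl, hm | ⟨rfl, hi⟩⟩
  · have : 0 < (b.height θ + 1) * m := by positivity
    exact ⟨this.le, fun h => absurd h this.ne'⟩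
  · have : 0 < k i + (b.height θ + 1) * m := by nlinarith [hk_ge i]
    exact ⟨this.le, fun h => absurd h this.ne'⟩
  · obtain ⟨h1, h2⟩ := hk_pos i hi
    exact ⟨by simpa using h1, fun h => ⟨by rw [h2 (by simpa using h)], rfl⟩⟩

theorem IsHighestRoot.exists_isMinimalParabolic_affine :
    ∃ (h : H) (c : ℂ), IsMinimalParabolic b (-(rootSystem H).root θ) 1 h c := by
  obtain ⟨h, hh⟩ := exists_root'_apply_eq_height b
  have hθpos : 0 < b.height θ := hθ.isPos
  refine ⟨h, b.height θ, isMinimalParabolic_of_exists_int ?_ fun wt m hp => ?_⟩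
  · rw [LinearMap.neg_apply, show (rootSystem H).root θ h = _ from hh θ]
    simp
  obtain ⟨z, hz, hcase⟩ := hp.exists_int_eq hh (b.height θ)
  refine ⟨z, hz, ?_⟩
  rcases hcase with ⟨hm, rfl⟩ | ⟨i, rfl, rfl, hm | ⟨rfl, hi⟩⟩
  · have : 0 < b.height θ * m := by positivity
    exact ⟨this.le, fun h => absurd h this.ne'⟩
  · refine ⟨by nlinarith [hθ.neg_height_le i], fun h => ?_⟩
    obtain rfl : m = 1 := by nlinarith [hθ.neg_height_le i]
    obtain ⟨i', hi', hii'⟩ := exists_root_eq_neg b i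
    have : i' = θ := (hθ.eq_or_height_lt i').resolve_right (by omega)
    exact ⟨by rw [← this, hi', neg_neg], rfl⟩
  · have : 0 < b.height i := hi
    exact ⟨by omega, fun h => by omega⟩

end HighestRoot

variable (b) in
theorem exists_isStrictlyPositive : ∃ (h : H) (c : ℂ), IsStrictlyPositive b h c := by
  obtain ⟨θ, hθ⟩ := exists_isHighestRoot b
  obtain ⟨h, hh⟩ := exists_root'_apply_eq_height b
  exact ⟨h, _, hθ.isStrictlyPositive hh⟩

end Grading

section LinearAlgebra

theorem apply_mem_of_mem_iSup {R V : Type*} [CommRing R] [AddCommGroup V] [Module R V]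
    {ι : Sort*} {S : ι → Submodule R V} {T : Submodule R V} {f : Module.End R V}
    (h : ∀ i, ∀ w ∈ S i, f w ∈ T) {w : V} (hw : w ∈ ⨆ i, S i) : f w ∈ T :=
  (iSup_le fun i w hw => h i w hw : ⨆ i, S i ≤ T.comap f) hw

theorem eigenspace_eq_bot_of_iSup_eq_top {R V : Type*} [CommRing R] [IsDomain R]
    [AddCommGroup V] [Module R V] [Module.IsTorsionFree R V] {ι : Sort*} {f : Module.End R V}
    {c : ι → R} (h : ⨆ i, f.eigenspace (c i) = ⊤) {z : R} (hz : ∀ i, z ≠ c i) :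
    f.eigenspace z = ⊥ := by
  refine disjoint_self.1 ((f.eigenspaces_iSupIndep z).mono_right ?_)
  refine le_top.trans (h ▸ iSup_le fun i => ?_)
  exact le_iSup₂ (f := fun y (_ : y ≠ z) => f.eigenspace y) (c i) (hz i).symm

theorem eq_of_le_of_iSupIndep {α ι : Type*} [CompleteLattice α] [IsModularLattice α]
    {E U : ι → α} (hE : iSupIndep E) (hUE : ∀ i, U i ≤ E i) (hU : ⨆ i, U i = ⊤) (i : ι) :
    U i = E i := by
  refine eq_of_le_of_inf_le_of_sup_le (z := ⨆ j, ⨆ _ : j ≠ i, E j) (hUE i)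
    ((hE i).eq_bot.le.trans bot_le) (le_top.trans (hU ▸ iSup_le fun j => ?_))
  rcases eq_or_ne j i with rfl | hj
  · exact le_sup_left
  · exact le_sup_of_le_right (le_iSup₂_of_le j hj (hUE j))

end LinearAlgebra

section LieIdeals

variable {R L V : Type*} [CommRing R] [LieRing L] [LieAlgebra R L] [AddCommGroup V] [Module R V]
  (ρ : L →ₗ⁅R⁆ Module.End R V) (N : LieIdeal R L)

/-- The subspace of the vectors `ρ x v` with `x` in the ideal `N`. -/
def idealOrbit (v : V) : Submodule R V :=
  N.toSubmodule.map ((ρ : L →ₗ[R] Module.End R V).flip v)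

variable {N}

theorem apply_mem_idealOrbit {n : L} (hn : n ∈ N) (v : V) : ρ n v ∈ idealOrbit ρ N v := ⟨n, hn, rfl⟩

theorem apply_mem_idealOrbit_of_apply_eq_smul {v : V} {x : L} {r : R} (hx : ρ x v = r • v) {w : V}
    (hw : w ∈ idealOrbit ρ N v) : ρ x w ∈ idealOrbit ρ N v := by
  obtain ⟨n, hn, rfl⟩ := hw
  change ρ x (ρ n v) ∈ _
  rw [lieHom_apply_apply, hx, map_smul]
  exact add_mem (apply_mem_idealOrbit ρ (N.lie_mem hn) v)
    (Submodule.smul_mem _ r (apply_mem_idealOrbit ρ hn v))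

theorem apply_eq_zero_of_cyclic {v : V}
    (hcyclic : ∀ U : Submodule R V, v ∈ U → (∀ x, ∀ u ∈ U, ρ x u ∈ U) → U = ⊤)
    (hv : ∀ n ∈ N, ρ n v = 0) {n : L} (hn : n ∈ N) : ρ n = 0 := by
  let U : Submodule R V := ⨅ n ∈ N, LinearMap.ker (ρ n)
  have mem_U {u : V} : u ∈ U ↔ ∀ n ∈ N, ρ n u = 0 := by simp [U]
  have hU : U = ⊤ := hcyclic U (mem_U.2 hv) fun x u hu => mem_U.2 fun n hn => by
    rw [lieHom_apply_apply, mem_U.1 hu n hn, map_zero, add_zero,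
      mem_U.1 hu _ (lie_mem_left R L N n x hn)]
  ext w
  exact mem_U.1 (hU ▸ Submodule.mem_top) n hn

end LieIdeals

section CurrentAlgebra

variable {R A L V : Type*} [CommRing R] [CommRing A] [Algebra R A] [LieRing L] [LieAlgebra R L]
  [AddCommGroup V] [Module R V]

variable (A) in
/-- The subspace of `A ⊗ L` spanned by the `a ⊗ X` with `X ∈ P`. -/
def currentSpan (P : Submodule R L) : Submodule R (A ⊗[R] L) :=
  Submodule.map₂ (TensorProduct.mk R A L) ⊤ P

theorem currentSpan_sup_eq_top {N P : Submodule R L} (hNP : N ⊔ P = ⊤) :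
    currentSpan A N ⊔ currentSpan A P = ⊤ := by
  rw [currentSpan, currentSpan, ← Submodule.map₂_sup_right, hNP,
    TensorProduct.map₂_mk_top_top_eq_top]

/-- The ideal `J ⊗ P` of `A ⊗ L`. -/
def currentIdeal (J : Ideal A) (P : LieIdeal R L) : LieIdeal R (A ⊗[R] L) where
  toSubmodule := Submodule.map₂ (TensorProduct.mk R A L) (J.restrictScalars R) P.toSubmodule
  lie_mem {x y} hy := by
    have hle : Submodule.map₂ (TensorProduct.mk R A L) (J.restrictScalars R) P.toSubmodule ≤
        (Submodule.map₂ (TensorProduct.mk R A L) (J.restrictScalars R) P.toSubmodule).comap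
          (LieModule.toEnd R (A ⊗[R] L) (A ⊗[R] L) x) := Submodule.map₂_le.2 fun a ha X hX => ?_
    · exact hle hy
    change ⁅x, a ⊗ₜ[R] X⁆ ∈ Submodule.map₂ _ _ _
    induction x using TensorProduct.induction_on with
    | zero => rw [zero_lie]; exact zero_mem _
    | add x y hx hy => rw [add_lie]; exact add_mem hx hy
    | tmul a' Y =>
      rw [LieAlgebra.ExtendScalars.bracket_tmul]
      exact Submodule.apply_mem_map₂ _ (J.mul_mem_left a' ha) (P.lie_mem hX)

theorem tmul_mem_currentIdeal {J : Ideal A} {P : LieIdeal R L} {a : A} (ha : a ∈ J) {X : L}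
    (hX : X ∈ P) : a ⊗ₜ X ∈ currentIdeal J P := Submodule.apply_mem_map₂ _ ha hX

variable (ρ : A ⊗[R] L →ₗ⁅R⁆ Module.End R V)

theorem apply_apply_tmul (a a' : A) (X Y : L) (w : V) :
    ρ (a ⊗ₜ X) (ρ (a' ⊗ₜ Y) w) = ρ ((a * a') ⊗ₜ ⁅X, Y⁆) w + ρ (a' ⊗ₜ Y) (ρ (a ⊗ₜ X) w) := by
  rw [lieHom_apply_apply, LieAlgebra.ExtendScalars.bracket_tmul]

theorem apply_tmul_mem_of_mem_span {S : Set L} {T : Submodule R V} {a : A} {w : V}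
    (h : ∀ X ∈ S, ρ (a ⊗ₜ X) w ∈ T) {X : L} (hX : X ∈ Submodule.span R S) : ρ (a ⊗ₜ X) w ∈ T := by
  have hS : Submodule.span R S ≤ T.comap ((ρ : A ⊗[R] L →ₗ[R] Module.End R V).flip w ∘ₗ
    TensorProduct.mk R A L a) := Submodule.span_le.2 h
  exact hS hX

theorem apply_mem_of_mem_currentSpan {P : Submodule R L} {T : Submodule R V} {w : V}
    (h : ∀ a : A, ∀ X ∈ P, ρ (a ⊗ₜ X) w ∈ T) {x : A ⊗[R] L} (hx : x ∈ currentSpan A P) :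
    ρ x w ∈ T := by
  have hP : currentSpan A P ≤ T.comap ((ρ : A ⊗[R] L →ₗ[R] Module.End R V).flip w) :=
    Submodule.map₂_le.2 fun a _ X hX => h a X hX
  exact hP hx

theorem apply_mem_eigenspace (a : A) {D X : L} {s z : R} (hX : ⁅D, X⁆ = s • X) {w : V}
    (hw : w ∈ (ρ ((1 : A) ⊗ₜ D)).eigenspace z) :
    ρ (a ⊗ₜ X) w ∈ (ρ ((1 : A) ⊗ₜ D)).eigenspace (z + s) := by
  rw [Module.End.mem_eigenspace_iff] at hw ⊢
  rw [apply_apply_tmul, hw, hX, one_mul, map_smul, TensorProduct.tmul_smul, map_smul,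
    LinearMap.smul_apply, add_smul, add_comm]

end CurrentAlgebra

section GradedPiece

variable {g : Type*} [LieRing g] [LieAlgebra ℂ g] {B : InvariantForm g} {H : LieSubalgebra ℂ g}
  {A : Type*} [CommRing A] [Algebra ℂ A] {V : Type*} [AddCommGroup V] [Module ℂ V]
  (ρ : LoopAffVir B A →ₗ⁅ℂ⁆ Module.End ℂ V) (ψ : A ⊗[ℂ] ExtCartan H →ₗ[ℂ] ℂ) (h : H) (c : ℂ)

/-- The eigenspace of `h + c d₀` that lies `n` degrees below the highest weight `ψ`. -/
def gradedPiece (n : ℕ) : Submodule ℂ V :=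
  (ρ ((1 : A) ⊗ₜ gradingElement B h c)).eigenspace (ψ ((1 : A) ⊗ₜ ((h, 0), c, 0)) - n)

theorem iSupIndep_gradedPiece : iSupIndep (gradedPiece ρ ψ h c) :=
  (Module.End.eigenspaces_iSupIndep _).comp fun m n hmn => by simpa using hmn

variable {ρ ψ h c} [FiniteDimensional ℂ g] [LieAlgebra.IsSimple ℂ g] [H.IsCartanSubalgebra]

theorem apply_mem_gradedPiece (a : A) {n k : ℕ} {wt : Module.Dual ℂ H} {m : ℤ} {X : AffVir B}
    (hX : IsHomogeneous B wt m X) (hk : wt h + c * m = -(k : ℂ)) {w : V}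
    (hw : w ∈ gradedPiece ρ ψ h c n) : ρ (a ⊗ₜ X) w ∈ gradedPiece ρ ψ h c (n + k) := by
  have := apply_mem_eigenspace ρ a (hX.lie_gradingElement h c) hw
  rw [hk] at this
  rw [gradedPiece]
  convert this using 2
  push_cast
  ring

end GradedPiece

section HighestWeight

open LieAlgebra.IsKilling LieAlgebra

variable {g : Type*} [LieRing g] [LieAlgebra ℂ g] [FiniteDimensional ℂ g] [LieAlgebra.IsSimple ℂ g]
  {B : InvariantForm g} {H : LieSubalgebra ℂ g} [H.IsCartanSubalgebra] {A : Type*} [CommRing A]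
  [Algebra ℂ A] {V : Type*} [AddCommGroup V] [Module ℂ V]

variable (B) in
/-- The span of the homogeneous elements of `AffVir B` whose weight is the negative of one of
`n₊ ⊕ Vir⁺`. -/
def negPart (b : (rootSystem H).Base) : Submodule ℂ (AffVir B) :=
  Submodule.span ℂ {X | ∃ (wt : Module.Dual ℂ H) (m : ℤ),
    IsHomogeneous B wt m X ∧ IsPosWeight b (-wt) (-m)}

variable (B) in
/-- The Borel part `h̄ ⊕ n₊ ⊕ Vir⁺` of `AffVir B`. -/
def borelPart (b : (rootSystem H).Base) : Submodule ℂ (AffVir B) :=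
  posPart B b ⊔ LinearMap.range (cartanIncl B : ExtCartan H →ₗ[ℂ] AffVir B)

theorem negPart_sup_borelPart (b : (rootSystem H).Base) : negPart B b ⊔ borelPart B b = ⊤ := by
  rw [eq_top_iff, ← span_isHomogeneous_eq_top B H, Submodule.span_le]
  rintro X ⟨wt, m, hX⟩
  rcases hX.trichotomy b with h | ⟨rfl, rfl⟩ | h
  · exact Submodule.mem_sup_right (Submodule.mem_sup_left (hX.mem_posPart h))
  · exact Submodule.mem_sup_right (Submodule.mem_sup_right hX.mem_range_cartanIncl)
  · exact Submodule.mem_sup_left (Submodule.subset_span ⟨wt, m, hX, h⟩)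

/-- An irreducible highest weight representation of `A ⊗ AffVir B` of highest weight `ψ`, with
highest weight vector `v`. -/
structure IsIrrHighestWeight (b : (rootSystem H).Base) (ψ : A ⊗[ℂ] ExtCartan H →ₗ[ℂ] ℂ)
    (ρ : LoopAffVir B A →ₗ⁅ℂ⁆ Module.End ℂ V) (v : V) : Prop where
  pos : ∀ a : A, ∀ X ∈ posPart B b, ρ (a ⊗ₜ X) v = 0
  weight : ∀ (a : A) (y : ExtCartan H), ρ (a ⊗ₜ cartanIncl B y) v = ψ (a ⊗ₜ y) • v
  cyclic : ∀ U : Submodule ℂ V, v ∈ U → (∀ x, ∀ u ∈ U, ρ x u ∈ U) → U = ⊤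
  simple : ∀ U : Submodule ℂ V, (∀ x, ∀ u ∈ U, ρ x u ∈ U) → U ≠ ⊤ → U = ⊥

namespace IsIrrHighestWeight

variable {b : (rootSystem H).Base} {ψ : A ⊗[ℂ] ExtCartan H →ₗ[ℂ] ℂ}
  {ρ : LoopAffVir B A →ₗ⁅ℂ⁆ Module.End ℂ V} {v : V} (hv : IsIrrHighestWeight b ψ ρ v)

include hv

theorem exists_apply_eq_smul (a : A) {X : AffVir B} (hX : X ∈ borelPart B b) :
    ∃ r : ℂ, ρ (a ⊗ₜ X) v = r • v := by
  obtain ⟨Y, hY, _, ⟨y, rfl⟩, rfl⟩ := Submodule.mem_sup.1 hX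
  refine ⟨ψ (a ⊗ₜ y), ?_⟩
  rw [TensorProduct.tmul_add, map_add, LinearMap.add_apply, hv.pos a Y hY, hv.weight, zero_add]

theorem eq_top_of_neg_stable {T : Submodule ℂ V} (hvT : v ∈ T)
    (hT : ∀ (a : A) (wt : Module.Dual ℂ H) m X, IsHomogeneous B wt m X →
      IsPosWeight b (-wt) (-m) → ∀ w ∈ T, ρ (a ⊗ₜ X) w ∈ T) : T = ⊤ := by
  have hspan : ∀ x ∈ currentSpan A (borelPart B b), ∀ w ∈ Submodule.span ℂ {v},
      ρ x w ∈ Submodule.span ℂ {v} := by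
    refine fun x hx w hw => apply_mem_of_mem_currentSpan ρ (fun a X hX => ?_) hx
    obtain ⟨r, rfl⟩ := Submodule.mem_span_singleton.1 hw
    obtain ⟨s, hs⟩ := hv.exists_apply_eq_smul a hX
    rw [map_smul, hs]
    exact Submodule.smul_mem _ _ (Submodule.smul_mem _ _ (Submodule.mem_span_singleton_self v))
  have hU : stableSpan ρ (currentSpan A (negPart B b)) (Submodule.span ℂ {v}) = ⊤ :=
    hv.cyclic _ (le_stableSpan ρ (Submodule.mem_span_singleton_self v)) fun x _ hu =>
      apply_mem_stableSpan_of_sup_eq_top ρ (currentSpan_sup_eq_top (negPart_sup_borelPart b))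
        hspan x hu
  rw [eq_top_iff, ← hU]
  refine stableSpan_le ρ ((Submodule.span_singleton_le_iff_mem _ _).2 hvT) fun x hx w hw =>
    apply_mem_of_mem_currentSpan ρ (fun a X hX => apply_tmul_mem_of_mem_span ρ ?_ hX) hx
  rintro X ⟨wt, m, hX, hn⟩
  exact hT a wt m X hX hn w hw

theorem mem_gradedPiece_zero (h : H) (c : ℂ) : v ∈ gradedPiece ρ ψ h c 0 := by
  rw [gradedPiece, Module.End.mem_eigenspace_iff, gradingElement_eq_cartanIncl, hv.weight,
    Nat.cast_zero, sub_zero]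

variable {h : H} {c : ℂ}

theorem iSup_gradedPiece (hc : IsWeaklyPositive b h c) : ⨆ n, gradedPiece ρ ψ h c n = ⊤ := by
  refine hv.eq_top_of_neg_stable (Submodule.mem_iSup_of_mem 0 (hv.mem_gradedPiece_zero h c))
    fun a wt m X hX hneg w hw => apply_mem_of_mem_iSup (fun n w hw => ?_) hw
  obtain ⟨k, hk⟩ := hc.exists_nat_eq_neg hneg
  exact Submodule.mem_iSup_of_mem (n + k) (apply_mem_gradedPiece a hX hk hw)

theorem eigenspace_eq_bot (hc : IsWeaklyPositive b h c) {z : ℂ}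
    (hz : ∀ n : ℕ, z ≠ ψ ((1 : A) ⊗ₜ ((h, 0), c, 0)) - n) :
    (ρ ((1 : A) ⊗ₜ gradingElement B h c)).eigenspace z = ⊥ :=
  eigenspace_eq_bot_of_iSup_eq_top (hv.iSup_gradedPiece hc) hz

theorem eq_bot_of_iSup_gradedPiece_succ (h : H) (c : ℂ)
    (htop : ⨆ n, gradedPiece ρ ψ h c (n + 1) = ⊤) : (⊤ : Submodule ℂ V) = ⊥ := by
  have hv0 : v = 0 := by
    refine Submodule.disjoint_def.1 (iSupIndep_gradedPiece ρ ψ h c 0) v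
      (hv.mem_gradedPiece_zero h c) ?_
    have hle : ⨆ n, gradedPiece ρ ψ h c (n + 1) ≤ ⨆ j, ⨆ _ : j ≠ 0, gradedPiece ρ ψ h c j :=
      iSup_le fun n => le_iSup₂_of_le (n + 1) n.succ_ne_zero le_rfl
    exact hle (htop ▸ Submodule.mem_top)
  refine (hv.cyclic ⊥ (by rw [hv0]; exact zero_mem _) fun x u hu => ?_).symm
  rw [(Submodule.mem_bot ℂ).1 hu, map_zero]
  exact zero_mem _

theorem eq_bot_of_borel_stable (hc : IsStrictlyPositive b h c) {W : Submodule ℂ V}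
    (hstable : ∀ a : A, ∀ X ∈ borelPart B b, ∀ w ∈ W, ρ (a ⊗ₜ X) w ∈ W)
    (hW : W ≤ ⨆ n, gradedPiece ρ ψ h c (n + 1)) : W = ⊥ := by
  let U := stableSpan ρ (currentSpan A (negPart B b)) W
  have hU_le : U ≤ ⨆ n, gradedPiece ρ ψ h c (n + 1) := by
    refine stableSpan_le ρ hW fun x hx w hw =>
      apply_mem_of_mem_currentSpan ρ (fun a X hX => apply_tmul_mem_of_mem_span ρ ?_ hX) hx
    rintro X ⟨wt, m, hX, hn⟩
    refine apply_mem_of_mem_iSup (fun n w hw => ?_) hw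
    obtain ⟨k, hk⟩ := hc.isWeaklyPositive.exists_nat_eq_neg hn
    refine Submodule.mem_iSup_of_mem (n + k) ?_
    rw [show n + k + 1 = n + 1 + k by omega]
    exact apply_mem_gradedPiece a hX hk hw
  have hU : ∀ x, ∀ u ∈ U, ρ x u ∈ U := fun x _ hu =>
    apply_mem_stableSpan_of_sup_eq_top ρ (currentSpan_sup_eq_top (negPart_sup_borelPart b))
      (fun x hx w hw => apply_mem_of_mem_currentSpan ρ (fun a X hX => hstable a X hX w hw) hx) x hu
  by_cases htop : U = ⊤
  · have := hv.eq_bot_of_iSup_gradedPiece_succ h c (top_le_iff.1 (htop ▸ hU_le))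
    exact le_bot_iff.1 (this ▸ le_top)
  · exact le_bot_iff.1 (hv.simple U hU htop ▸ le_stableSpan ρ)

variable {J : Ideal A} {P : LieIdeal ℂ (AffVir B)}

theorem idealOrbit_currentIdeal_le (hc : IsStrictlyPositive b h c)
    (hP : P.toSubmodule ≤ Submodule.span ℂ
      {X | X ∈ P ∧ ∃ (wt : Module.Dual ℂ H) (m : ℤ), IsHomogeneous B wt m X})
    (hψ : ∀ a ∈ J, ∀ y : ExtCartan H, cartanIncl B y ∈ P → ψ (a ⊗ₜ y) = 0) :
    idealOrbit ρ (currentIdeal J P) v ≤ ⨆ n, gradedPiece ρ ψ h c (n + 1) := by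
  refine Submodule.map_le_iff_le_comap.2 (Submodule.map₂_le.2 fun a ha X hX => ?_)
  change ρ (a ⊗ₜ X) v ∈ ⨆ n, gradedPiece ρ ψ h c (n + 1)
  refine apply_tmul_mem_of_mem_span ρ ?_ (hP hX)
  rintro X ⟨hXP, wt, m, hX⟩
  rcases hX.trichotomy b with hp | ⟨rfl, rfl⟩ | hn
  · rw [hv.pos a X (hX.mem_posPart hp)]
    exact zero_mem _
  · obtain ⟨y, rfl⟩ := hX.mem_range_cartanIncl
    rw [hv.weight, hψ a ha y hXP, zero_smul]
    exact zero_mem _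
  · obtain ⟨k, hk⟩ := hc.exists_nat_eq_neg hn
    have := apply_mem_gradedPiece a hX hk (hv.mem_gradedPiece_zero h c)
    rw [zero_add] at this
    exact Submodule.mem_iSup_of_mem k this

theorem apply_eq_zero_of_ideal (hP : P.toSubmodule ≤ Submodule.span ℂ
      {X | X ∈ P ∧ ∃ (wt : Module.Dual ℂ H) (m : ℤ), IsHomogeneous B wt m X})
    (hψ : ∀ a ∈ J, ∀ y : ExtCartan H, cartanIncl B y ∈ P → ψ (a ⊗ₜ y) = 0)
    {a : A} (ha : a ∈ J) {X : AffVir B} (hX : X ∈ P) : ρ (a ⊗ₜ X) = 0 := by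
  obtain ⟨h, c, hc⟩ := exists_isStrictlyPositive b
  have horbit : idealOrbit ρ (currentIdeal J P) v = ⊥ := by
    refine hv.eq_bot_of_borel_stable hc (fun a X hX w hw => ?_)
      (hv.idealOrbit_currentIdeal_le hc hP hψ)
    obtain ⟨r, hr⟩ := hv.exists_apply_eq_smul a hX
    exact apply_mem_idealOrbit_of_apply_eq_smul ρ hr hw
  refine apply_eq_zero_of_cyclic ρ hv.cyclic (fun n hn => ?_) (tmul_mem_currentIdeal ha hX)
  exact (Submodule.mem_bot ℂ).1 (horbit ▸ apply_mem_idealOrbit ρ hn v)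

end IsIrrHighestWeight

end HighestWeight

section Finiteness

theorem exists_fg_forall_sub_mem {K M : Type*} [Field K] [AddCommGroup M] [Module K M]
    (N : Submodule K M) [FiniteDimensional K (M ⧸ N)] :
    ∃ S : Submodule K M, S.FG ∧ ∀ x, ∃ s ∈ S, x - s ∈ N := by
  obtain ⟨σ, hσ⟩ := N.mkQ.exists_rightInverse_of_surjective N.range_mkQ
  refine ⟨LinearMap.range σ, Module.Finite.iff_fg.1 inferInstance,
    fun x => ⟨σ (N.mkQ x), ⟨_, rfl⟩, ?_⟩⟩
  have hσx : N.mkQ (σ (N.mkQ x)) = N.mkQ x := LinearMap.congr_fun hσ (N.mkQ x)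
  rw [← Submodule.Quotient.mk_eq_zero, ← N.mkQ_apply, map_sub, hσx, sub_self]

variable {K A L V : Type*} [Field K] [CommRing A] [Algebra K A] [LieRing L] [LieAlgebra K L]
  [AddCommGroup V] [Module K V] {ρ : A ⊗[K] L →ₗ⁅K⁆ Module.End K V}

variable (ρ) in
/-- The span of the vectors `ρ (a ⊗ X) w` with `a : A`, `X ∈ P` and `w ∈ W`. -/
def currentImage (P : Submodule K L) (W : Submodule K V) : Submodule K V :=
  Submodule.map₂ (ρ : A ⊗[K] L →ₗ[K] Module.End K V) (currentSpan A P) W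

theorem apply_tmul_mem_currentImage (a : A) {P : Submodule K L} {X : L} (hX : X ∈ P)
    {W : Submodule K V} {w : V} (hw : w ∈ W) : ρ (a ⊗ₜ X) w ∈ currentImage ρ P W :=
  Submodule.apply_mem_map₂ _ (Submodule.apply_mem_map₂ _ Submodule.mem_top hX) hw

theorem fg_currentImage {N : Submodule K A} [FiniteDimensional K (A ⧸ N)]
    (hN : ∀ a ∈ N, ∀ X, ρ (a ⊗ₜ X) = 0) {P : Submodule K L} (hP : P.FG) {W : Submodule K V}
    (hW : W.FG) : (currentImage ρ P W).FG := by
  obtain ⟨S, hS, hSN⟩ := exists_fg_forall_sub_mem N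
  have hle : (currentSpan A P).map (ρ : A ⊗[K] L →ₗ[K] Module.End K V) ≤
      (Submodule.map₂ (TensorProduct.mk K A L) S P).map (ρ : A ⊗[K] L →ₗ[K] Module.End K V) := by
    refine Submodule.map_le_iff_le_comap.2 (Submodule.map₂_le.2 fun a _ X hX => ?_)
    obtain ⟨s, hs, has⟩ := hSN a
    refine ⟨s ⊗ₜ X, Submodule.apply_mem_map₂ _ hs hX, ?_⟩
    have := hN _ has X
    rw [TensorProduct.sub_tmul, map_sub, sub_eq_zero] at this
    exact this.symm
  refine fg_of_le (((hS.map₂ (TensorProduct.mk K A L) hP).map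
    (ρ : A ⊗[K] L →ₗ[K] Module.End K V)).map₂ (LinearMap.id : Module.End K V →ₗ[K] _) hW)
    (Submodule.map₂_le.2 fun x hx w hw => ?_)
  exact Submodule.apply_mem_map₂ (LinearMap.id : Module.End K V →ₗ[K] _)
    (hle (Submodule.mem_map_of_mem hx)) hw

end Finiteness

section WeightModule

open LieAlgebra.IsKilling LieAlgebra

variable {g : Type*} [LieRing g] [LieAlgebra ℂ g] [FiniteDimensional ℂ g] {B : InvariantForm g}
  {H : LieSubalgebra ℂ g} [H.IsCartanSubalgebra] [LieAlgebra.IsSimple ℂ g]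

theorem cartanIncl_lie_cartanIncl (y y' : ExtCartan H) :
    ⁅cartanIncl B y, cartanIncl B y'⁆ = 0 := by
  obtain ⟨⟨h, k⟩, s, c⟩ := y
  obtain ⟨⟨h', k'⟩, s', c'⟩ := y'
  have lie_coe : ⁅(h : g), (h' : g)⁆ = 0 := by
    rw [← LieSubalgebra.coe_bracket, trivial_lie_zero H H h h', ZeroMemClass.coe_zero]
  have lie_K (X : AffVir B) : ⁅X, AffVir.K B⁆ = 0 := by rw [← lie_skew, AffVir.K_lie, neg_zero]
  have lie_C (X : AffVir B) : ⁅X, AffVir.C B⁆ = 0 := by rw [← lie_skew, AffVir.C_lie, neg_zero]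
  have loop_lie_d (x : g) : ⁅AffVir.loop B 0 x, AffVir.d B 0⁆ = 0 := by
    rw [← lie_skew, AffVir.d_lie_loop, Int.cast_zero, zero_smul, neg_zero]
  simp [cartanIncl, lie_K, lie_C, loop_lie_d, AffVir.loop_lie_loop, AffVir.d_lie_loop, lie_coe,
    AffVir.K_lie, AffVir.C_lie]

variable {A : Type*} [CommRing A] [Algebra ℂ A] {V : Type*} [AddCommGroup V] [Module ℂ V]
  {ρ : LoopAffVir B A →ₗ⁅ℂ⁆ Module.End ℂ V}

variable (ρ) in
theorem iSupIndep_weightSpace :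
    iSupIndep fun μ : Module.Dual ℂ (ExtCartan H) => weightSpace B ρ μ := by
  have commute (y y' : ExtCartan H) :
      Commute (ρ ((1 : A) ⊗ₜ cartanIncl B y)) (ρ ((1 : A) ⊗ₜ cartanIncl B y')) := by
    rw [commute_iff_lie_eq, ← LieHom.map_lie, LieAlgebra.ExtendScalars.bracket_tmul,
      cartanIncl_lie_cartanIncl, TensorProduct.tmul_zero, map_zero]
  have hind := Module.End.independent_iInf_maxGenEigenspace_of_forall_mapsTo
    (fun y : ExtCartan H => ρ ((1 : A) ⊗ₜ[ℂ] cartanIncl B y))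
    (fun y y' => Module.End.mapsTo_maxGenEigenspace_of_comm (commute y' y))
  refine (hind.comp (f := fun μ : Module.Dual ℂ (ExtCartan H) => (μ : ExtCartan H → ℂ))
    DFunLike.coe_injective).mono fun μ w hw => (Submodule.mem_iInf _).2 fun y => ?_
  refine (Module.End.mem_maxGenEigenspace _ _ _).2 ⟨1, ?_⟩
  rw [pow_one, LinearMap.sub_apply, hw y, LinearMap.smul_apply, Module.End.one_apply, sub_self]

namespace IsIrrHighestWeight

variable {b : (rootSystem H).Base} {ψ : A ⊗[ℂ] ExtCartan H →ₗ[ℂ] ℂ} {v : V}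
  (hv : IsIrrHighestWeight b ψ ρ v)

include hv

theorem iSup_weightSpace : ⨆ μ : Module.Dual ℂ (ExtCartan H), weightSpace B ρ μ = ⊤ := by
  refine hv.eq_top_of_neg_stable (Submodule.mem_iSup_of_mem
    (ψ ∘ₗ TensorProduct.mk ℂ A (ExtCartan H) 1) fun y => hv.weight 1 y)
    fun a wt m X hX _ w hw => apply_mem_of_mem_iSup (fun μ w hw => ?_) hw
  let shift : Module.Dual ℂ (ExtCartan H) :=
    wt ∘ₗ LinearMap.fst ℂ H ℂ ∘ₗ LinearMap.fst ℂ (DerivedCartan H) (ℂ × ℂ) +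
      (m : ℂ) • (LinearMap.fst ℂ ℂ ℂ ∘ₗ LinearMap.snd ℂ (DerivedCartan H) (ℂ × ℂ))
  have shift_apply (y : ExtCartan H) : shift y = wt y.1.1 + y.2.1 * m := by
    simp [shift, mul_comm]
  refine Submodule.mem_iSup_of_mem (μ + shift) fun y => ?_
  rw [LinearMap.add_apply, shift_apply]
  exact Module.End.mem_eigenspace_iff.1 (apply_mem_eigenspace ρ a (hX.lie_cartanIncl y)
    (Module.End.mem_eigenspace_iff.2 (hw y)))

variable {h : H} {c : ℂ}

theorem gradedPiece_le (hc : IsStrictlyPositive b h c) (n : ℕ) :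
    gradedPiece ρ ψ h c n ≤ Submodule.span ℂ {v} ⊔
      ⨆ j : Fin n, currentImage ρ (degreePart B h c (-(n - j : ℕ))) (gradedPiece ρ ψ h c j) := by
  let U : ℕ → Submodule ℂ V := fun n => gradedPiece ρ ψ h c n ⊓ (Submodule.span ℂ {v} ⊔
    ⨆ j : Fin n, currentImage ρ (degreePart B h c (-(n - j : ℕ))) (gradedPiece ρ ψ h c j))
  suffices hU : ⨆ n, U n = ⊤ from
    (eq_of_le_of_iSupIndep (iSupIndep_gradedPiece ρ ψ h c) (fun _ => inf_le_left) hU n).ge.trans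
      inf_le_right
  refine hv.eq_top_of_neg_stable (Submodule.mem_iSup_of_mem 0 ⟨hv.mem_gradedPiece_zero h c,
    Submodule.mem_sup_left (Submodule.mem_span_singleton_self v)⟩)
    fun a wt m X hX hneg w hw => apply_mem_of_mem_iSup (fun j w hw => ?_) hw
  obtain ⟨k, hk⟩ := hc.exists_nat_eq_neg hneg
  refine Submodule.mem_iSup_of_mem (j + (k + 1)) ⟨apply_mem_gradedPiece a hX hk hw.1,
    Submodule.mem_sup_right (Submodule.mem_iSup_of_mem (⟨j, by omega⟩ : Fin (j + (k + 1))) ?_)⟩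
  refine apply_tmul_mem_currentImage a (hX.mem_degreePart ?_) hw.1
  rw [hk, Nat.add_sub_cancel_left]

variable {I : Ideal A} [FiniteDimensional ℂ (A ⧸ I)]

theorem fg_gradedPiece (hc : IsStrictlyPositive b h c) (hI : ∀ a ∈ I, ∀ X, ρ (a ⊗ₜ X) = 0) (n : ℕ) :
    (gradedPiece ρ ψ h c n).FG := by
  have : FiniteDimensional ℂ (A ⧸ I.restrictScalars ℂ) := ‹_›
  induction n using Nat.strong_induction_on with
  | _ n ih =>
    exact fg_of_le ((Submodule.fg_span_singleton v).sup (Submodule.fg_iSup _ fun j : Fin n =>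
      fg_currentImage (N := I.restrictScalars ℂ) hI (fg_degreePart B h hc.ne_zero _) (ih j j.2)))
      (hv.gradedPiece_le hc n)

theorem finiteDimensional_weightSpace (hI : ∀ a ∈ I, ∀ X, ρ (a ⊗ₜ X) = 0)
    (μ : Module.Dual ℂ (ExtCartan H)) : FiniteDimensional ℂ (weightSpace B ρ μ) := by
  obtain ⟨h, c, hc⟩ := exists_isStrictlyPositive b
  have hle : weightSpace B ρ μ ≤
      (ρ ((1 : A) ⊗ₜ gradingElement B h c)).eigenspace (μ ((h, 0), c, 0)) := fun w hw => by
    rw [Module.End.mem_eigenspace_iff, gradingElement_eq_cartanIncl]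
    exact hw _
  by_cases hμ : ∃ n : ℕ, μ ((h, 0), c, 0) = ψ ((1 : A) ⊗ₜ ((h, 0), c, 0)) - n
  · obtain ⟨n, hn⟩ := hμ
    have : FiniteDimensional ℂ (gradedPiece ρ ψ h c n) :=
      Module.Finite.iff_fg.2 (hv.fg_gradedPiece hc hI n)
    rw [hn] at hle
    exact Submodule.finiteDimensional_of_le (S₂ := gradedPiece ρ ψ h c n) hle
  · rw [hv.eigenspace_eq_bot hc.isWeaklyPositive (not_exists.1 hμ)] at hle
    exact Submodule.finiteDimensional_of_le hle

end IsIrrHighestWeight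

end WeightModule

section AdNilpotent

theorem mem_maxGenEigenspace_zero_of_apply_mem {R M : Type*} [CommRing R] [AddCommGroup M]
    [Module R M] {f : Module.End R M} {w : M} (hw : f w ∈ f.maxGenEigenspace 0) :
    w ∈ f.maxGenEigenspace 0 := by
  simp only [Module.End.mem_maxGenEigenspace, zero_smul, sub_zero] at hw ⊢
  obtain ⟨n, hn⟩ := hw
  exact ⟨n + 1, by rwa [pow_succ, Module.End.mul_apply]⟩

theorem isLocNilpotent_ad_loop {g : Type*} [LieRing g] [LieAlgebra ℂ g] {B : InvariantForm g}
    {y : g} (hy : IsNilpotent (LieAlgebra.ad ℂ g y)) (m : ℤ) :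
    IsLocNilpotent (LieAlgebra.ad ℂ (AffVir B) (AffVir.loop B m y)) := by
  rw [isLocNilpotent_iff_maxGenEigenspace_eq_top, Submodule.eq_top_iff']
  set N := (LieAlgebra.ad ℂ (AffVir B) (AffVir.loop B m y)).maxGenEigenspace 0
  have mem_N {Z : AffVir B} (hZ : ⁅AffVir.loop B m y, Z⁆ ∈ N) : Z ∈ N :=
    mem_maxGenEigenspace_zero_of_apply_mem hZ
  have K_mem : AffVir.K B ∈ N :=
    mem_N (by rw [← lie_skew, AffVir.K_lie, neg_zero]; exact zero_mem _)
  have C_mem : AffVir.C B ∈ N :=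
    mem_N (by rw [← lie_skew, AffVir.C_lie, neg_zero]; exact zero_mem _)
  have loop_mem_of_pow (n : ℕ) : ∀ (l : ℤ) (x : g), (LieAlgebra.ad ℂ g y ^ n) x = 0 →
      AffVir.loop B l x ∈ N := by
    induction n with
    | zero =>
      intro l x hx
      rw [show x = 0 from hx, map_zero]
      exact zero_mem _
    | succ n ih =>
      intro l x hx
      refine mem_N ?_
      rw [AffVir.loop_lie_loop]
      exact add_mem (ih _ _ (by rwa [pow_succ] at hx)) (Submodule.smul_mem _ _ K_mem)
  obtain ⟨n, hn⟩ := hy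
  have loop_mem (l : ℤ) (x : g) : AffVir.loop B l x ∈ N := loop_mem_of_pow n l x (by simp [hn])
  have d_mem (l : ℤ) : AffVir.d B l ∈ N := by
    refine mem_N ?_
    rw [← lie_skew, AffVir.d_lie_loop]
    exact neg_mem (Submodule.smul_mem _ _ (loop_mem _ y))
  intro X
  rw [X.eq_lsum_add_linearCombination]
  exact add_mem (add_mem (add_mem (Submodule.finsuppSum_mem _ _ _ _ fun l _ => loop_mem l _)
    (Submodule.smul_mem _ _ K_mem))
    (Submodule.finsuppSum_mem _ _ _ _ fun l _ => Submodule.smul_mem _ _ (d_mem l)))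
    (Submodule.smul_mem _ _ C_mem)

theorem ad_pow_apply_tmul {R A L V : Type*} [CommRing R] [CommRing A] [Algebra R A] [LieRing L]
    [LieAlgebra R L] [AddCommGroup V] [Module R V] (ρ : A ⊗[R] L →ₗ⁅R⁆ Module.End R V)
    (e a : A) (X Z : L) (n : ℕ) :
    (LieAlgebra.ad R (Module.End R V) (ρ (e ⊗ₜ X)) ^ n) (ρ (a ⊗ₜ Z)) =
      ρ ((e ^ n * a) ⊗ₜ (LieAlgebra.ad R L X ^ n) Z) := by
  induction n with
  | zero => simp
  | succ n ih =>
    rw [pow_succ', Module.End.mul_apply, ih, LieAlgebra.ad_apply, ← LieHom.map_lie,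
      LieAlgebra.ExtendScalars.bracket_tmul, ← LieAlgebra.ad_apply R, ← Module.End.mul_apply,
      ← pow_succ', ← mul_assoc, ← pow_succ']

end AdNilpotent

section RealRoots

open LieAlgebra.IsKilling LieAlgebra

variable {g : Type*} [LieRing g] [LieAlgebra ℂ g] [FiniteDimensional ℂ g] (B : InvariantForm g)
  {H : LieSubalgebra ℂ g} [H.IsCartanSubalgebra]

theorem root_isNonZero (i : H.root) : i.1.IsNonZero := by
  obtain ⟨α, hα⟩ := i
  simpa using hα

variable [LieAlgebra.IsSimple ℂ g]

/-- Root vectors `x` and `y` of the roots `i` and `-i` forming an `sl₂`-triple with the coroot. -/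
structure IsRootPair (i : H.root) (x y : g) : Prop where
  mem_pos : x ∈ rootSpace H i.1
  mem_neg : y ∈ rootSpace H (-i.1)
  isSl2Triple : IsSl2Triple ((rootSystem H).coroot i : g) x y

theorem exists_isRootPair (i : H.root) : ∃ x y, IsRootPair i x y := by
  obtain ⟨h, x, y, ht, hx, hy⟩ := exists_isSl2Triple_of_weight_isNonZero (root_isNonZero i)
  obtain rfl : h = ((rootSystem H).coroot i : g) := ht.h_eq_coroot (root_isNonZero i) hx hy
  exact ⟨x, y, hx, hy, ht⟩

/-- The coroot of the real root `(i, m)` of the affine algebra. -/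
def realCoroot (i : H.root) (m : ℤ) : ExtCartan H :=
  (((rootSystem H).coroot i,
    m * (B.form ((rootSystem H).coroot i : g) ((rootSystem H).coroot i : g) / 2)), 0, 0)

variable {i : H.root}

theorem isHomogeneous_loop_root (m : ℤ) {x : g} (hx : x ∈ rootSpace H i.1) :
    IsHomogeneous B ((rootSystem H).root i) m (AffVir.loop B m x) :=
  .loop i.1 m x hx

theorem isHomogeneous_loop_neg_root (m : ℤ) {x : g} (hx : x ∈ rootSpace H (-i.1)) :
    IsHomogeneous B (-(rootSystem H).root i) m (AffVir.loop B m x) :=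
  .loop (-i.1) m x hx

variable {B}

theorem cartanIncl_realCoroot (m : ℤ) : cartanIncl B (realCoroot B i m) =
    AffVir.loop B 0 ((rootSystem H).coroot i : g) + (m * (B.form ((rootSystem H).coroot i : g)
      ((rootSystem H).coroot i : g) / 2)) • AffVir.K B := by
  simp [realCoroot, cartanIncl]

theorem cartanIncl_realCoroot_mem_affinePart (m : ℤ) :
    cartanIncl B (realCoroot B i m) ∈ affinePart B := by
  rw [cartanIncl_realCoroot]
  exact add_mem (loop_mem_affinePart _ _) (Submodule.smul_mem _ _ K_mem_affinePart)

theorem cartanIncl_realCoroot_lie_loop (m l : ℤ) (z : g) :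
    ⁅cartanIncl B (realCoroot B i m), AffVir.loop B l z⁆ =
      AffVir.loop B l ⁅((rootSystem H).coroot i : g), z⁆ := by
  rw [cartanIncl_realCoroot, add_lie, smul_lie, AffVir.K_lie, AffVir.loop_lie_loop]
  simp

namespace IsRootPair

variable {x y : g} (hxy : IsRootPair i x y)
include hxy

theorem exists_eq_smul {x' : g} (hx' : x' ∈ rootSpace H i.1) : ∃ r : ℂ, x' = r • x := by
  obtain ⟨r, hr⟩ := (finrank_eq_one_iff_of_nonzero' (⟨x, hxy.mem_pos⟩ : rootSpace H i.1)
    fun h => hxy.isSl2Triple.e_ne_zero (congrArg Subtype.val h)).1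
    (finrank_rootSpace_eq_one i.1 (root_isNonZero i)) ⟨x', hx'⟩
  exact ⟨r, (congrArg Subtype.val hr).symm⟩

variable (B) in
theorem form_apply : B.form x y =
    B.form ((rootSystem H).coroot i : g) ((rootSystem H).coroot i : g) / 2 := by
  have : B.form ((rootSystem H).coroot i : g) ((rootSystem H).coroot i : g) = 2 * B.form x y :=
    calc B.form ((rootSystem H).coroot i : g) ((rootSystem H).coroot i : g)
        = B.form ⁅x, y⁆ ((rootSystem H).coroot i : g) := by rw [hxy.isSl2Triple.lie_e_f]
      _ = B.form x ⁅y, ((rootSystem H).coroot i : g)⁆ := B.invariant _ _ _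
      _ = 2 * B.form x y := by
        rw [← lie_skew, hxy.isSl2Triple.lie_lie_smul_f ℂ, neg_neg, map_smul, smul_eq_mul]
  rw [this, mul_div_cancel_left₀ _ two_ne_zero]

variable (B) in
theorem isSl2Triple_loop (m : ℤ) : IsSl2Triple
    (⟨cartanIncl B (realCoroot B i m), cartanIncl_realCoroot_mem_affinePart m⟩ : affinePart B)
    ⟨AffVir.loop B m x, loop_mem_affinePart m x⟩
    ⟨AffVir.loop B (-m) y, loop_mem_affinePart (-m) y⟩ where
  h_ne_zero h := by
    have : (cartanIncl B (realCoroot B i m)).loopPart 0 = 0 :=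
      congrArg (fun X : affinePart B => X.1.loopPart 0) h
    rw [cartanIncl_realCoroot] at this
    simp at this
  lie_e_f := Subtype.ext <| by
    change ⁅AffVir.loop B m x, AffVir.loop B (-m) y⁆ = cartanIncl B (realCoroot B i m)
    rw [AffVir.loop_lie_loop, hxy.isSl2Triple.lie_e_f, add_neg_cancel, if_pos rfl,
      hxy.form_apply, cartanIncl_realCoroot]
  lie_h_e_nsmul := Subtype.ext <| by
    change ⁅cartanIncl B (realCoroot B i m), AffVir.loop B m x⁆ = 2 • AffVir.loop B m x
    rw [cartanIncl_realCoroot_lie_loop, hxy.isSl2Triple.lie_h_e_nsmul, map_nsmul]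
  lie_h_f_nsmul := Subtype.ext <| by
    change ⁅cartanIncl B (realCoroot B i m), AffVir.loop B (-m) y⁆ = -(2 • AffVir.loop B (-m) y)
    rw [cartanIncl_realCoroot_lie_loop, hxy.isSl2Triple.lie_h_f_nsmul, map_neg, map_nsmul]

end IsRootPair

end RealRoots

section Factor

variable {g : Type*} [LieRing g] [LieAlgebra ℂ g] {B : InvariantForm g} {A : Type*} [CommRing A]
  [Algebra ℂ A] {V : Type*} [AddCommGroup V] [Module ℂ V]

/-- Modulo the annihilator of `V`, the element `e` is the unit of a factor `ℂ` of `A`, with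
projection `χ`, as far as the action of the affine part is concerned. -/
structure IsFactorOf (ρ : LoopAffVir B A →ₗ⁅ℂ⁆ Module.End ℂ V) (e : A) (χ : A →ₐ[ℂ] ℂ) : Prop where
  unit : χ e = 1
  act : ∀ a : A, ∀ X ∈ affinePart B, ρ ((a * e) ⊗ₜ X) = χ a • ρ (e ⊗ₜ X)

namespace IsFactorOf

variable {ρ : LoopAffVir B A →ₗ⁅ℂ⁆ Module.End ℂ V} {e : A} {χ : A →ₐ[ℂ] ℂ}
  (he : IsFactorOf ρ e χ)
include he

theorem apply_apply (a : A) (X : AffVir B) {Y : AffVir B} (hY : Y ∈ affinePart B) (w : V) :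
    ρ (a ⊗ₜ X) (ρ (e ⊗ₜ Y) w) = χ a • ρ (e ⊗ₜ ⁅X, Y⁆) w + ρ (e ⊗ₜ Y) (ρ (a ⊗ₜ X) w) := by
  rw [apply_apply_tmul, he.act a _ ((affinePart B).lie_mem hY), LinearMap.smul_apply]

theorem commute_sub_smul (a : A) (X : AffVir B) {Y : AffVir B} (hY : Y ∈ affinePart B) :
    Commute (ρ ((a - χ a • e) ⊗ₜ X)) (ρ (e ⊗ₜ Y)) := by
  ext w
  rw [Module.End.mul_apply, Module.End.mul_apply, he.apply_apply _ _ hY, map_sub, map_smul,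
    he.unit, smul_eq_mul, mul_one, sub_self, zero_smul, zero_add]

/-- The representation of the affine algebra through the factor `e` of `A`. -/
def affineRep : affinePart B →ₗ⁅ℂ⁆ Module.End ℂ V where
  toLinearMap := (ρ : LoopAffVir B A →ₗ[ℂ] Module.End ℂ V) ∘ₗ TensorProduct.mk ℂ A (AffVir B) e ∘ₗ
    (affinePart B).toSubmodule.subtype
  map_lie' {X Y} := by
    ext w
    have := he.apply_apply e X Y.2 w
    rw [he.unit, one_smul] at this
    exact eq_sub_of_add_eq this.symm

theorem exists_apply_pow_eq_smul {a : A} {Z Y : AffVir B} {r s : ℂ} {w : V}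
    (hw : ρ (a ⊗ₜ Z) w = s • w) (hY : Y ∈ affinePart B) (hZY : ⁅Z, Y⁆ = r • Y) (n : ℕ) :
    ∃ s' : ℂ, ρ (a ⊗ₜ Z) ((ρ (e ⊗ₜ Y) ^ n) w) = s' • (ρ (e ⊗ₜ Y) ^ n) w := by
  induction n with
  | zero => exact ⟨s, hw⟩
  | succ n ih =>
    obtain ⟨s', hs'⟩ := ih
    refine ⟨χ a * r + s', ?_⟩
    rw [pow_succ', Module.End.mul_apply, he.apply_apply a Z hY, hZY, hs', TensorProduct.tmul_smul,
      map_smul, map_smul, LinearMap.smul_apply, smul_smul, ← add_smul]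

variable [FiniteDimensional ℂ g] [LieAlgebra.IsSimple ℂ g] {H : LieSubalgebra ℂ g}
  [H.IsCartanSubalgebra] {i : H.root} {x y : g} {m : ℤ} {w : V}

theorem apply_pow_succ_eq_zero (hxy : IsRootPair i x y) (hx : ρ (e ⊗ₜ AffVir.loop B m x) w = 0)
    {k : ℕ} (hw : ρ (e ⊗ₜ cartanIncl B (realCoroot B i m)) w = (k : ℂ) • w) :
    ρ (e ⊗ₜ AffVir.loop B m x) ((ρ (e ⊗ₜ AffVir.loop B (-m) y) ^ (k + 1)) w) = 0 := by
  let := LieRingModule.compLieHom V he.affineRep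
  let := LieModule.compLieHom V he.affineRep
  rcases eq_or_ne w 0 with rfl | hw0
  · simp
  have hprim : (hxy.isSl2Triple_loop B m).HasPrimitiveVectorWith w (k : ℂ) := ⟨hw0, hw, hx⟩
  have := hprim.lie_e_pow_succ_toEnd_f k
  rwa [sub_self, mul_zero, zero_smul] at this

theorem exists_reflected_ne_zero (hxy : IsRootPair i x y)
    (hE : IsLocNilpotent (ρ (e ⊗ₜ AffVir.loop B m x)))
    (hF : IsLocNilpotent (ρ (e ⊗ₜ AffVir.loop B (-m) y))) (hw0 : w ≠ 0) {z : ℂ}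
    (hw : ρ (e ⊗ₜ cartanIncl B (realCoroot B i m)) w = z • w) : ∃ r s : ℕ,
      ((s : ℂ) - r = z ∧ (ρ (e ⊗ₜ AffVir.loop B (-m) y) ^ s)
        ((ρ (e ⊗ₜ AffVir.loop B m x) ^ r) w) ≠ 0) ∨
      ((r : ℂ) - s = z ∧ (ρ (e ⊗ₜ AffVir.loop B m x) ^ s)
        ((ρ (e ⊗ₜ AffVir.loop B (-m) y) ^ r) w) ≠ 0) := by
  let := LieRingModule.compLieHom V he.affineRep
  let := LieModule.compLieHom V he.affineRep
  exact LoopAffineVirasoro.exists_reflected_ne_zero (hxy.isSl2Triple_loop B m) hE hF hw0 hw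

end IsFactorOf

end Factor

section LocalNilpotency

open LieAlgebra.IsKilling LieAlgebra

variable {g : Type*} [LieRing g] [LieAlgebra ℂ g] [FiniteDimensional ℂ g] [LieAlgebra.IsSimple ℂ g]
  {B : InvariantForm g} {H : LieSubalgebra ℂ g} [H.IsCartanSubalgebra]

theorem posPart_le_span_isHomogeneous (b : (rootSystem H).Base) : posPart B b ≤ Submodule.span ℂ
    {X | ∃ (wt : Module.Dual ℂ H) (m : ℤ), IsHomogeneous B wt m X ∧ IsPosWeight b wt m} := by
  refine Submodule.span_le.2 ?_
  rintro X ((⟨i, hi, x, hx, rfl⟩ | ⟨n, hn, x, rfl⟩) | ⟨n, hn, rfl⟩)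
  · exact Submodule.subset_span ⟨_, 0, .loop i.1 0 x hx, Or.inr ⟨rfl, i, hi, rfl⟩⟩
  · refine loop_mem_of_rootSpace (H := H) (fun χ x hx => ?_) x
    have hχ : χ.toLinear = 0 ∨ ∃ i, χ.toLinear = (rootSystem H).root i :=
      (weight_eq_zero_or_root χ).imp_right fun ⟨i, hi⟩ => ⟨i, hi.symm⟩
    exact Submodule.subset_span ⟨_, n, .loop χ n x hx, Or.inl ⟨hn, hχ⟩⟩
  · exact Submodule.subset_span ⟨_, n, .d n, Or.inl ⟨hn, Or.inl rfl⟩⟩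

theorem IsRootPair.exists_eq_smul_loop {i : H.root} {x y : g} (hxy : IsRootPair i x y) {m : ℤ}
    {X : AffVir B} (hX : IsHomogeneous B ((rootSystem H).root i) m X) :
    ∃ r : ℂ, X = r • AffVir.loop B m x := by
  have root_ne_zero := (rootSystem H).ne_zero i
  generalize hwt : (rootSystem H).root i = wt at hX
  cases hX with
  | loop χ m x' hx' =>
    have hχ : (χ : H → ℂ) = i.1 := by ext z; exact (LinearMap.congr_fun hwt z).symm
    rw [hχ] at hx'
    obtain ⟨r, rfl⟩ := hxy.exists_eq_smul hx'
    exact ⟨r, map_smul _ _ _⟩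
  | d m => exact absurd hwt root_ne_zero
  | K => exact absurd hwt root_ne_zero
  | C => exact absurd hwt root_ne_zero

variable {A : Type*} [CommRing A] [Algebra ℂ A] {V : Type*} [AddCommGroup V] [Module ℂ V]
  {ρ : LoopAffVir B A →ₗ⁅ℂ⁆ Module.End ℂ V} {ψ : A ⊗[ℂ] ExtCartan H →ₗ[ℂ] ℂ}

theorem pow_apply_mem_gradedPiece (a : A) {h : H} {c : ℂ} {n k : ℕ} {wt : Module.Dual ℂ H} {m : ℤ}
    {X : AffVir B} (hX : IsHomogeneous B wt m X) (hk : wt h + c * m = -(k : ℂ)) {w : V}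
    (hw : w ∈ gradedPiece ρ ψ h c n) (p : ℕ) :
    (ρ (a ⊗ₜ X) ^ p) w ∈ gradedPiece ρ ψ h c (n + p * k) := by
  induction p with
  | zero => simpa using hw
  | succ p ih =>
    rw [pow_succ', Module.End.mul_apply, add_mul, one_mul, ← add_assoc]
    exact apply_mem_gradedPiece a hX hk ih

namespace IsIrrHighestWeight

variable {b : (rootSystem H).Base} {v : V} (hv : IsIrrHighestWeight b ψ ρ v)
include hv

theorem isLocNilpotent_of_pow_apply_eq_zero {y : g} (hy : IsNilpotent (LieAlgebra.ad ℂ g y))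
    (a : A) (m : ℤ) {n : ℕ} (hn : (ρ (a ⊗ₜ AffVir.loop B m y) ^ n) v = 0) :
    IsLocNilpotent (ρ (a ⊗ₜ AffVir.loop B m y)) := by
  rw [isLocNilpotent_iff_maxGenEigenspace_eq_top]
  refine hv.eq_top_of_neg_stable ((Module.End.mem_maxGenEigenspace _ _ _).2
    ⟨n, by simpa using hn⟩) fun a' wt l X _ _ w hw => ?_
  obtain ⟨k, hk⟩ := isLocNilpotent_ad_loop hy m X
  exact apply_mem_maxGenEigenspace_zero_of_ad_pow
    (by rw [ad_pow_apply_tmul, hk, TensorProduct.tmul_zero, map_zero]) hw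

theorem apply_K (a : A) (w : V) : ρ (a ⊗ₜ AffVir.K B) w = ψ (a ⊗ₜ ((0, 1), 0, 0)) • w := by
  have htop : (ρ (a ⊗ₜ AffVir.K B)).eigenspace (ψ (a ⊗ₜ ((0, 1), 0, 0))) = ⊤ := by
    refine hv.eq_top_of_neg_stable (Module.End.mem_eigenspace_iff.2 ?_)
      fun a' wt m X _ _ w hw => Module.End.mem_eigenspace_iff.2 ?_
    · rw [← hv.weight]
      simp [cartanIncl]
    · rw [apply_apply_tmul, Module.End.mem_eigenspace_iff.1 hw, AffVir.K_lie,
        TensorProduct.tmul_zero, map_zero, LinearMap.zero_apply, zero_add, map_smul]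
  exact Module.End.mem_eigenspace_iff.1 (htop ▸ Submodule.mem_top)

theorem eq_zero_of_singular {h : H} {c : ℂ} (hc : IsStrictlyPositive b h c) {w : V}
    (hw : w ∈ ⨆ n, gradedPiece ρ ψ h c (n + 1))
    (hpos : ∀ a : A, ∀ X ∈ posPart B b, ρ (a ⊗ₜ X) w = 0)
    (hcartan : ∀ (a : A) (y : ExtCartan H), ∃ s : ℂ, ρ (a ⊗ₜ cartanIncl B y) w = s • w) :
    w = 0 := by
  refine Submodule.span_singleton_eq_bot.1 (hv.eq_bot_of_borel_stable hc
    (fun a X hX u hu => ?_) ((Submodule.span_singleton_le_iff_mem _ _).2 hw))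
  obtain ⟨r, rfl⟩ := Submodule.mem_span_singleton.1 hu
  obtain ⟨Y, hY, _, ⟨y, rfl⟩, rfl⟩ := Submodule.mem_sup.1 hX
  obtain ⟨s, hs⟩ := hcartan a y
  rw [TensorProduct.tmul_add, map_add, LinearMap.add_apply, map_smul, map_smul, hpos a Y hY,
    smul_zero, zero_add, hs]
  exact Submodule.smul_mem _ _ (Submodule.smul_mem _ _ (Submodule.mem_span_singleton_self w))

theorem apply_eq_zero_of_mem_gradedPiece_zero {h : H} {c : ℂ} (hc : IsWeaklyPositive b h c) (a : A)
    {wt : Module.Dual ℂ H} {m : ℤ} {X : AffVir B} (hX : IsHomogeneous B wt m X)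
    (hpos : IsPosWeight b wt m) (hne : wt h + c * m ≠ 0) {w : V}
    (hw : w ∈ gradedPiece ρ ψ h c 0) : ρ (a ⊗ₜ X) w = 0 := by
  obtain ⟨n, hn⟩ := hc wt m hpos
  have hXw := apply_mem_eigenspace ρ a (hX.lie_gradingElement h c) hw
  rw [hv.eigenspace_eq_bot hc fun n' hn' => hne ?_] at hXw
  · exact (Submodule.mem_bot ℂ).1 hXw
  · rw [hn] at hn' ⊢
    have hsum : ((n + n' : ℕ) : ℂ) = (0 : ℕ) := by push_cast at hn' ⊢; linear_combination hn'
    have : n + n' = 0 := by exact_mod_cast hsum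
    rw [(by omega : n = 0), Nat.cast_zero]

variable {e : A} {χ : A →ₐ[ℂ] ℂ} (he : IsFactorOf ρ e χ) {i : H.root} {x y : g}
  (hxy : IsRootPair i x y) {m : ℤ} {h : H} {c : ℂ}
  (hpar : IsMinimalParabolic b ((rootSystem H).root i) m h c)
include he hxy hpar

-- Only the root vectors of the root `(i, m)` itself can act nontrivially, and those only through
-- the factor `e`: the operators `a - χ(a) e` commute with the negative root vector.
theorem apply_pow_eq_zero_of_mem_posPart {n : ℕ}
    (hn : ρ (e ⊗ₜ AffVir.loop B m x) ((ρ (e ⊗ₜ AffVir.loop B (-m) y) ^ n) v) = 0)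
    (a : A) {X : AffVir B} (hX : X ∈ posPart B b) :
    ρ (a ⊗ₜ X) ((ρ (e ⊗ₜ AffVir.loop B (-m) y) ^ n) v) = 0 := by
  refine (Submodule.mem_bot ℂ).1
    (apply_tmul_mem_of_mem_span ρ ?_ (posPart_le_span_isHomogeneous b hX))
  rintro X ⟨wt, l, hX, hpos⟩
  rw [Submodule.mem_bot]
  by_cases hdeg : wt h + c * l = 0
  · obtain ⟨rfl, rfl⟩ := hpar.eq_of_degree_eq_zero wt l hpos hdeg
    obtain ⟨r, hr⟩ := hxy.exists_eq_smul_loop hX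
    have hcomm := LinearMap.congr_fun
      ((he.commute_sub_smul a X (loop_mem_affinePart (-l) y)).pow_right n).eq v
    rw [Module.End.mul_apply, Module.End.mul_apply, hv.pos _ X (hX.mem_posPart hpos), map_zero,
      TensorProduct.sub_tmul, map_sub, LinearMap.sub_apply, sub_eq_zero] at hcomm
    rw [hcomm, ← TensorProduct.smul_tmul', map_smul, LinearMap.smul_apply, hr,
      TensorProduct.tmul_smul, map_smul, LinearMap.smul_apply, hn, smul_zero, smul_zero]
  · refine hv.apply_eq_zero_of_mem_gradedPiece_zero hpar.isWeaklyPositive a hX hpos hdeg ?_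
    have hF : (-(rootSystem H).root i) h + c * (-m : ℤ) = -((0 : ℕ) : ℂ) := by
      have := hpar.degree_eq_zero
      rw [LinearMap.neg_apply]
      push_cast
      linear_combination -this
    simpa using pow_apply_mem_gradedPiece e (isHomogeneous_loop_neg_root B (-m) hxy.mem_neg) hF
      (hv.mem_gradedPiece_zero h c) n

theorem isLocNilpotent_of_isMinimalParabolic (hpos : IsPosWeight b ((rootSystem H).root i) m)
    {k : ℕ} (hk : ψ (e ⊗ₜ realCoroot B i m) = k) :
    IsLocNilpotent (ρ (e ⊗ₜ AffVir.loop B (-m) y)) := by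
  have hF := isHomogeneous_loop_neg_root B (-m) hxy.mem_neg
  have singular : (ρ (e ⊗ₜ AffVir.loop B (-m) y) ^ (k + 1)) v = 0 := by
    obtain ⟨h', c', hc'⟩ := exists_isStrictlyPositive b
    obtain ⟨n, hn⟩ := hc'.exists_nat_eq_neg
      (by rwa [neg_neg, neg_neg] : IsPosWeight b (- -(rootSystem H).root i) (- -m))
    refine hv.eq_zero_of_singular hc' ?_
      (fun a X hX => hv.apply_pow_eq_zero_of_mem_posPart he hxy hpar ?_ a hX)
      fun a z => he.exists_apply_pow_eq_smul (hv.weight a z) (loop_mem_affinePart _ _)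
        (hF.lie_cartanIncl z) (k + 1)
    · have := pow_apply_mem_gradedPiece e hF hn (hv.mem_gradedPiece_zero h' c') (k + 1)
      rw [show 0 + (k + 1) * (n + 1) = k * (n + 1) + n + 1 by ring] at this
      exact Submodule.mem_iSup_of_mem _ this
    · refine he.apply_pow_succ_eq_zero hxy (hv.pos e _ ?_) (by rw [hv.weight, hk])
      exact (isHomogeneous_loop_root B m hxy.mem_pos).mem_posPart hpos
  exact hv.isLocNilpotent_of_pow_apply_eq_zero (isNilpotent_ad_of_mem_rootSpace (K := ℂ) H
    (root_isNonZero i).neg hxy.mem_neg) e (-m) singular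

end IsIrrHighestWeight

end LocalNilpotency

section AffineWeylGroup

variable {ι R M N : Type*} [CommRing R] [AddCommGroup M] [Module R M] [AddCommGroup N] [Module R N]
  {P : RootPairing ι R M N}

theorem reflectionPerm_reflectionPerm (i j k : ι) :
    P.reflectionPerm (P.reflectionPerm j i) k =
      P.reflectionPerm j (P.reflectionPerm i (P.reflectionPerm j k)) := by
  apply P.root.injective
  simp only [RootPairing.root_reflectionPerm, RootPairing.reflection_reflectionPerm,
    LinearEquiv.mul_apply]

variable [CharZero R]

theorem exists_pairing_ne_zero [P.IsIrreducible] {Z : Set ι} (hZ : Z.Nonempty)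
    (hZP : ∀ i ∈ Z, ∀ j, P.reflectionPerm j i ∈ Z) (θ : ι) : ∃ i ∈ Z, P.pairing i θ ≠ 0 := by
  by_contra! horth
  have span_eq_top : Submodule.span R (P.root '' Z) = ⊤ := by
    have := P.ne_zero
    refine RootPairing.IsIrreducible.eq_top_of_invtSubmodule_reflection (P := P) _ (fun j => ?_) ?_
    · rw [Module.End.mem_invtSubmodule]
      refine Submodule.span_le.2 ?_
      rintro - ⟨i, hi, rfl⟩
      exact Submodule.subset_span ⟨_, hZP i hi j, P.root_reflectionPerm j i⟩
    · obtain ⟨i, hi⟩ := hZ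
      exact fun hbot => P.ne_zero i
        (Submodule.span_eq_bot.1 hbot _ (Set.mem_image_of_mem P.root hi))
  have span_le_ker : Submodule.span R (P.root '' Z) ≤ LinearMap.ker (P.coroot' θ) := by
    refine Submodule.span_le.2 ?_
    rintro - ⟨i, hi, rfl⟩
    exact horth i hi
  have : P.coroot' θ (P.root θ) = 0 := span_le_ker (span_eq_top ▸ Submodule.mem_top)
  rw [RootPairing.root_coroot'_eq_pairing, RootPairing.pairing_same] at this
  exact two_ne_zero this

variable [P.IsCrystallographic]

-- The reflection in `θ` and the affine reflection in `(-θ, 1)` compose to a translation in the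
-- direction of the coroot of `θ`.
theorem shift_of_affine_reflection {p : ι → ℤ → Prop} {θ : ι}
    (hfin : ∀ i m, p i m → p (P.reflectionPerm θ i) m)
    (haff : ∀ i m, p i m → p (P.reflectionPerm θ i) (m + P.pairingIn ℤ i θ)) {i : ι} {m : ℤ} (k : ℤ)
    (hp : p i (m + k * P.pairingIn ℤ i θ)) : p i m := by
  have down (n : ℤ) (hn : p i (n - P.pairingIn ℤ i θ)) : p i n := by
    have := hfin _ _ (haff _ _ hn)
    rwa [P.reflectionPerm_self, sub_add_cancel] at this
  have up (n : ℤ) (hn : p i (n + P.pairingIn ℤ i θ)) : p i n := by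
    have := haff _ _ (hfin _ _ hn)
    rwa [P.reflectionPerm_self, ← RootPairing.pairingIn_reflectionPerm,
      RootPairing.pairingIn_reflectionPerm_self_right, add_neg_cancel_right] at this
  induction k with
  | zero => simpa using hp
  | succ k ih => exact ih (up _ (by rwa [add_one_mul, ← add_assoc] at hp))
  | pred k ih => exact ih (down _ (by rwa [sub_one_mul, ← add_sub_assoc] at hp))

variable [Finite ι] [IsDomain R] [P.IsReduced] (b : P.Base)

theorem forall_reflectionPerm_of_simple {p : ι → Prop}
    (hsimple : ∀ j ∈ b.support, ∀ i, p i → p (P.reflectionPerm j i)) (j : ι) :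
    ∀ i, p i → p (P.reflectionPerm j i) := by
  induction j using b.induction_reflect with
  | h₀ j ih =>
    intro i hi
    rw [reflectionPerm_reflectionPerm, P.reflectionPerm_self]
    exact ih i hi
  | h₁ j hj => exact hsimple j hj
  | h₂ j k hj hk =>
    intro i hi
    rw [reflectionPerm_reflectionPerm]
    exact hsimple k hk _ (hj _ (hsimple k hk _ hi))

variable [P.IsIrreducible]

/-- Every real root of an affine root system is conjugate to one of positive level under the affine
Weyl group. -/
theorem affineWeyl_induction {p : ι → ℤ → Prop} (θ : ι) (hpos : ∀ i m, 0 < m → p i m)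
    (hsimple : ∀ j ∈ b.support, ∀ i m, p i m → p (P.reflectionPerm j i) m)
    (haff : ∀ i m, p i m → p (P.reflectionPerm θ i) (m + P.pairingIn ℤ i θ)) (i : ι) (m : ℤ) :
    p i m := by
  have hfin (j i : ι) (m : ℤ) (hp : p i m) : p (P.reflectionPerm j i) m :=
    forall_reflectionPerm_of_simple b (p := (p · m)) (fun j hj i => hsimple j hj i m) j i hp
  by_contra hbad
  obtain ⟨i', ⟨m', hm'⟩, hne⟩ := exists_pairing_ne_zero (Z := {i | ∃ m, ¬ p i m}) ⟨i, m, hbad⟩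
    (fun i ⟨m, hm⟩ j => ⟨m, fun hp => hm (P.reflectionPerm_self j i ▸ hfin j _ _ hp)⟩) θ
  refine hm' (shift_of_affine_reflection (hfin θ) haff
    ((|m'| + 1) * P.pairingIn ℤ i' θ) (hpos _ _ ?_))
  have hz : P.pairingIn ℤ i' θ ≠ 0 := fun h => hne (by
    rw [← P.algebraMap_pairingIn ℤ, h, map_zero])
  have hsq : 1 ≤ P.pairingIn ℤ i' θ ^ 2 := Int.add_one_le_iff.2 (sq_pos_of_ne_zero hz)
  nlinarith [neg_abs_le m', abs_nonneg m']

end AffineWeylGroup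

section BoundedDirections

open LieAlgebra.IsKilling LieAlgebra

variable {g : Type*} [LieRing g] [LieAlgebra ℂ g] {B : InvariantForm g} {H : LieSubalgebra ℂ g}
  {A : Type*} [CommRing A] [Algebra ℂ A] {V : Type*} [AddCommGroup V] [Module ℂ V]

/-- The joint eigenspaces of `e ⊗ H` and of `1 ⊗ (h + c d₀)`. They refine the weight spaces: the
weight is recorded for the factor `e` of `A` alone. -/
def factorWeightSpace (ρ : LoopAffVir B A →ₗ⁅ℂ⁆ Module.End ℂ V) (e : A) (h : H) (c : ℂ)
    (μ : Module.Dual ℂ H × ℂ) : Submodule ℂ V :=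
  (⨅ h' : H, (ρ (e ⊗ₜ AffVir.loop B 0 (h' : g))).eigenspace (μ.1 h')) ⊓
    (ρ ((1 : A) ⊗ₜ gradingElement B h c)).eigenspace μ.2

/-- The weight `(wt, m)` of the affine algebra in the coordinates of `factorWeightSpace`. -/
def affineWeight (h : H) (c : ℂ) (wt : Module.Dual ℂ H) (m : ℤ) : Module.Dual ℂ H × ℂ :=
  (wt, wt h + c * m)

theorem affineWeight_sub_zsmul (h : H) (c : ℂ) (wt wt' : Module.Dual ℂ H) (m m' k : ℤ) :
    affineWeight h c wt m - k • affineWeight h c wt' m' =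
      affineWeight h c (wt - k • wt') (m - k * m') := by
  refine Prod.ext rfl ?_
  simp only [affineWeight, Prod.snd_sub, Prod.smul_snd, LinearMap.sub_apply, LinearMap.smul_apply,
    zsmul_eq_mul]
  push_cast
  ring

theorem affineWeight_neg (h : H) (c : ℂ) (wt : Module.Dual ℂ H) (m : ℤ) :
    affineWeight h c (-wt) (-m) = -affineWeight h c wt m := by
  refine Prod.ext rfl ?_
  simp only [affineWeight, LinearMap.neg_apply, Prod.snd_neg]
  push_cast
  ring

/-- The weights in the direction `γ` are bounded: for each `μ`, `μ + N γ` is a weight for finitely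
many natural numbers `N` only. -/
def IsBoundedDirection (ρ : LoopAffVir B A →ₗ⁅ℂ⁆ Module.End ℂ V) (e : A) (h : H) (c : ℂ)
    (γ : Module.Dual ℂ H × ℂ) : Prop :=
  ∀ μ, ∃ N₀ : ℕ, ∀ N ≥ N₀, factorWeightSpace ρ e h c (μ + N • γ) = ⊥

variable {ρ : LoopAffVir B A →ₗ⁅ℂ⁆ Module.End ℂ V} {e : A} {h : H} {c : ℂ}
  {μ : Module.Dual ℂ H × ℂ} {w : V}

theorem mem_factorWeightSpace : w ∈ factorWeightSpace ρ e h c μ ↔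
    (∀ h' : H, ρ (e ⊗ₜ AffVir.loop B 0 (h' : g)) w = μ.1 h' • w) ∧
      w ∈ (ρ ((1 : A) ⊗ₜ gradingElement B h c)).eigenspace μ.2 := by
  rw [factorWeightSpace, Submodule.mem_inf, Submodule.mem_iInf]
  simp only [Module.End.mem_eigenspace_iff]

variable [FiniteDimensional ℂ g] [LieAlgebra.IsSimple ℂ g] [H.IsCartanSubalgebra]

theorem IsHomogeneous.loop_zero_lie {wt : Module.Dual ℂ H} {m : ℤ} {X : AffVir B}
    (hX : IsHomogeneous B wt m X) (h' : H) : ⁅AffVir.loop B 0 (h' : g), X⁆ = wt h' • X := by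
  simpa [gradingElement] using hX.lie_gradingElement h' 0

namespace IsFactorOf

variable {χ : A →ₐ[ℂ] ℂ} (he : IsFactorOf ρ e χ) {wt : Module.Dual ℂ H} {m : ℤ} {X : AffVir B}
  (hX : IsHomogeneous B wt m X)
include he hX

theorem apply_loop_zero (a : A) (h' : H) (w : V) :
    ρ (e ⊗ₜ AffVir.loop B 0 (h' : g)) (ρ (a ⊗ₜ X) w) =
      (χ a * wt h') • ρ (e ⊗ₜ X) w + ρ (a ⊗ₜ X) (ρ (e ⊗ₜ AffVir.loop B 0 (h' : g)) w) := by
  rw [apply_apply_tmul, hX.loop_zero_lie, TensorProduct.tmul_smul, map_smul, LinearMap.smul_apply]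
  congr 1
  rcases hX.mem_affinePart_or with hmem | rfl
  · rw [mul_comm e a, he.act a X hmem, LinearMap.smul_apply, smul_smul, mul_comm]
  · simp

theorem apply_mem_factorWeightSpace (hw : w ∈ factorWeightSpace ρ e h c μ) :
    ρ (e ⊗ₜ X) w ∈ factorWeightSpace ρ e h c (μ + affineWeight h c wt m) := by
  rw [mem_factorWeightSpace] at hw ⊢
  refine ⟨fun h' => ?_, apply_mem_eigenspace ρ e (hX.lie_gradingElement h c) hw.2⟩
  rw [he.apply_loop_zero hX, hw.1, he.unit, one_mul, map_smul, ← add_smul, add_comm]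
  rfl

theorem apply_mem_factorWeightSpace_of_eq_zero {a : A} (ha : χ a = 0)
    (hw : w ∈ factorWeightSpace ρ e h c μ) :
    ρ (a ⊗ₜ X) w ∈ factorWeightSpace ρ e h c (μ + (0, wt h + c * m)) := by
  rw [mem_factorWeightSpace] at hw ⊢
  refine ⟨fun h' => ?_, apply_mem_eigenspace ρ a (hX.lie_gradingElement h c) hw.2⟩
  rw [he.apply_loop_zero hX, hw.1, ha, zero_mul, zero_smul, zero_add, map_smul, Prod.fst_add,
    add_zero]

theorem pow_apply_mem_factorWeightSpace (hw : w ∈ factorWeightSpace ρ e h c μ) (n : ℕ) :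
    (ρ (e ⊗ₜ X) ^ n) w ∈ factorWeightSpace ρ e h c (μ + n • affineWeight h c wt m) := by
  induction n with
  | zero => simpa using hw
  | succ n ih =>
    rw [pow_succ', Module.End.mul_apply, succ_nsmul, ← add_assoc]
    exact he.apply_mem_factorWeightSpace hX ih

end IsFactorOf

variable {b : (rootSystem H).Base} {ψ : A ⊗[ℂ] ExtCartan H →ₗ[ℂ] ℂ} {v : V}

namespace IsIrrHighestWeight

variable (hv : IsIrrHighestWeight b ψ ρ v)
include hv

theorem isBoundedDirection_of_pos (hc : IsWeaklyPositive b h c) {γ : Module.Dual ℂ H × ℂ} {n : ℕ}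
    (hγ : γ.2 = (n + 1 : ℕ)) : IsBoundedDirection ρ e h c γ := by
  intro μ
  obtain ⟨N₀, hN₀⟩ : ∃ N₀ : ℕ, ∀ N ≥ N₀, ∀ k : ℕ,
      μ.2 + N * γ.2 ≠ ψ ((1 : A) ⊗ₜ ((h, 0), c, 0)) - k := by
    by_contra! hex
    obtain ⟨N₁, -, k₁, h₁⟩ := hex 0
    obtain ⟨N₂, hN₂, k₂, h₂⟩ := hex (N₁ + k₁ + 1)
    rw [hγ] at h₁ h₂
    have heq : N₂ * (n + 1) + k₂ = N₁ * (n + 1) + k₁ := by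
      have : ((N₂ * (n + 1) + k₂ : ℕ) : ℂ) = ((N₁ * (n + 1) + k₁ : ℕ) : ℂ) := by
        push_cast at h₁ h₂ ⊢
        linear_combination h₂ - h₁
      exact_mod_cast this
    nlinarith [Nat.mul_le_mul_right (n + 1) hN₂]
  refine ⟨N₀, fun N hN => le_bot_iff.1 (inf_le_right.trans ?_)⟩
  refine (hv.eigenspace_eq_bot hc fun k => ?_).le
  rw [Prod.snd_add, Prod.smul_snd, nsmul_eq_mul]
  exact hN₀ N hN k

theorem apply_realCoroot (hw : w ∈ factorWeightSpace ρ e h c μ) (i : H.root) (m : ℤ) :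
    ρ (e ⊗ₜ cartanIncl B (realCoroot B i m)) w = (μ.1 ((rootSystem H).coroot i) +
      m * (B.form ((rootSystem H).coroot i : g) ((rootSystem H).coroot i : g) / 2) *
        ψ (e ⊗ₜ ((0, 1), 0, 0))) • w := by
  rw [cartanIncl_realCoroot, TensorProduct.tmul_add, TensorProduct.tmul_smul, map_add, map_smul,
    LinearMap.add_apply, LinearMap.smul_apply, hv.apply_K, (mem_factorWeightSpace.1 hw).1,
    smul_smul, ← add_smul]

variable {χ : A →ₐ[ℂ] ℂ} (he : IsFactorOf ρ e χ)
include he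

theorem iSup_factorWeightSpace : ⨆ μ, factorWeightSpace ρ e h c μ = ⊤ := by
  refine hv.eq_top_of_neg_stable (Submodule.mem_iSup_of_mem
    (ψ ∘ₗ TensorProduct.mk ℂ A (ExtCartan H) e ∘ₗ LinearMap.inl ℂ (DerivedCartan H) (ℂ × ℂ) ∘ₗ
      LinearMap.inl ℂ H ℂ, ψ ((1 : A) ⊗ₜ ((h, 0), c, 0)))
    (mem_factorWeightSpace.2 ⟨fun h' => ?_, ?_⟩))
    fun a wt m X hX _ w hw => apply_mem_of_mem_iSup (fun μ w hw => ?_) hw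
  · have := hv.weight e ((h', 0), 0, 0)
    rwa [show cartanIncl B ((h', 0), 0, 0) = AffVir.loop B 0 (h' : g) by
      simp [cartanIncl]] at this
  · have := hv.mem_gradedPiece_zero h c
    rwa [gradedPiece, Nat.cast_zero, sub_zero] at this
  · have decompose : ρ (a ⊗ₜ X) w = ρ ((a - χ a • e) ⊗ₜ X) w + χ a • ρ (e ⊗ₜ X) w := by
      rw [TensorProduct.sub_tmul, map_sub, LinearMap.sub_apply, ← TensorProduct.smul_tmul',
        map_smul, LinearMap.smul_apply, sub_add_cancel]
    rw [decompose]
    refine add_mem (Submodule.mem_iSup_of_mem _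
      (he.apply_mem_factorWeightSpace_of_eq_zero hX ?_ hw))
      (Submodule.smul_mem _ _ (Submodule.mem_iSup_of_mem _
        (he.apply_mem_factorWeightSpace hX hw)))
    rw [map_sub, map_smul, he.unit, smul_eq_mul, mul_one, sub_self]

theorem isLocNilpotent_of_isBoundedDirection {wt : Module.Dual ℂ H} {m : ℤ} {X : AffVir B}
    (hX : IsHomogeneous B wt m X) (hγ : IsBoundedDirection ρ e h c (affineWeight h c wt m)) :
    IsLocNilpotent (ρ (e ⊗ₜ X)) := by
  rw [isLocNilpotent_iff_maxGenEigenspace_eq_top, eq_top_iff,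
    ← hv.iSup_factorWeightSpace he (h := h) (c := c)]
  refine iSup_le fun μ w hw => ?_
  obtain ⟨N, hN⟩ := hγ μ
  have hpow := he.pow_apply_mem_factorWeightSpace hX hw N
  rw [hN N le_rfl, Submodule.mem_bot] at hpow
  exact (Module.End.mem_maxGenEigenspace _ _ _).2 ⟨N, by simpa using hpow⟩

-- By `sl₂`-theory, a weight space on the `i`-string reflects to a nonzero weight space, so
-- unboundedness in the reflected direction would carry over to `γ`.
theorem isBoundedDirection_reflect {i : H.root} {x y : g} (hxy : IsRootPair i x y) {m : ℤ}
    (hE : IsLocNilpotent (ρ (e ⊗ₜ AffVir.loop B m x)))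
    (hF : IsLocNilpotent (ρ (e ⊗ₜ AffVir.loop B (-m) y))) {γ : Module.Dual ℂ H × ℂ} {z : ℤ}
    (hz : γ.1 ((rootSystem H).coroot i) = z) (hγ : IsBoundedDirection ρ e h c γ) :
    IsBoundedDirection ρ e h c (γ - z • affineWeight h c ((rootSystem H).root i) m) := by
  intro μ
  set α := affineWeight h c ((rootSystem H).root i) m with hα
  obtain ⟨s₀, hs₀⟩ : ∃ s₀ : ℂ, s₀ = μ.1 ((rootSystem H).coroot i) +
      m * (B.form ((rootSystem H).coroot i : g) ((rootSystem H).coroot i : g) / 2) *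
        ψ (e ⊗ₜ ((0, 1), 0, 0)) := ⟨_, rfl⟩
  obtain ⟨N₀, hN₀⟩ := hγ (μ - s₀ • α)
  refine ⟨N₀, fun N hN => ?_⟩
  by_contra hne
  obtain ⟨w, hw, hw0⟩ := (Submodule.ne_bot_iff _).1 hne
  have hα2 : α.1 ((rootSystem H).coroot i) = 2 := (rootSystem H).root_coroot_two i
  have hZ : ρ (e ⊗ₜ cartanIncl B (realCoroot B i m)) w = (s₀ - N * z) • w := by
    rw [hv.apply_realCoroot hw, hs₀]
    congr 1
    simp only [Prod.fst_add, Prod.smul_fst, Prod.fst_sub, LinearMap.add_apply, LinearMap.smul_apply,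
      LinearMap.sub_apply, hα2, hz, nsmul_eq_mul, zsmul_eq_mul]
    ring
  have bot (r s : ℕ) (hrs : (s : ℂ) - r = s₀ - N * z) :
      factorWeightSpace ρ e h c (μ + N • (γ - z • α) + r • α + s • -α) = ⊥ := by
    rw [← hN₀ N hN, show s₀ = s - r + N * z by rw [hrs, sub_add_cancel]]
    congr 1
    module
  have hEh := isHomogeneous_loop_root B m hxy.mem_pos
  have hFh := isHomogeneous_loop_neg_root B (-m) hxy.mem_neg
  obtain ⟨r, s, ⟨hrs, hne'⟩ | ⟨hrs, hne'⟩⟩ := he.exists_reflected_ne_zero hxy hE hF hw0 hZ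
  · have := he.pow_apply_mem_factorWeightSpace hFh
      (he.pow_apply_mem_factorWeightSpace hEh hw r) s
    rw [affineWeight_neg, ← hα, bot r s hrs, Submodule.mem_bot] at this
    exact hne' this
  · have := he.pow_apply_mem_factorWeightSpace hEh
      (he.pow_apply_mem_factorWeightSpace hFh hw r) s
    rw [affineWeight_neg, ← hα, add_right_comm, bot s r hrs, Submodule.mem_bot] at this
    exact hne' this

end IsIrrHighestWeight

end BoundedDirections

section Dominant

open LieAlgebra.IsKilling LieAlgebra

variable {g : Type*} [LieRing g] [LieAlgebra ℂ g] [FiniteDimensional ℂ g] [LieAlgebra.IsSimple ℂ g]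
  {B : InvariantForm g} {H : LieSubalgebra ℂ g} [H.IsCartanSubalgebra]

theorem affineWeight_reflectionPerm (h : H) (c : ℂ) (i j : H.root) (n m : ℤ) :
    affineWeight h c ((rootSystem H).root ((rootSystem H).reflectionPerm j i))
      (n - (rootSystem H).pairingIn ℤ i j * m) =
    affineWeight h c ((rootSystem H).root i) n -
      (rootSystem H).pairingIn ℤ i j • affineWeight h c ((rootSystem H).root j) m := by
  rw [affineWeight_sub_zsmul, RootPairing.root_reflectionPerm, RootPairing.reflection_apply_root,
    ← (rootSystem H).algebraMap_pairingIn ℤ, algebraMap_smul]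

theorem realCoroot_reflectionPerm_self (θ : H.root) :
    realCoroot B ((rootSystem H).reflectionPerm θ θ) 1 = (affineCoroot B θ, 0, 0) := by
  have hcoroot : (rootSystem H).coroot ((rootSystem H).reflectionPerm θ θ) =
      -(rootSystem H).coroot θ := by
    rw [RootPairing.coroot_reflectionPerm, RootPairing.coreflection_apply_self]
  simp [realCoroot, affineCoroot, hcoroot]

variable {A : Type*} [CommRing A] [Algebra ℂ A] {V : Type*} [AddCommGroup V] [Module ℂ V]
  {ρ : LoopAffVir B A →ₗ⁅ℂ⁆ Module.End ℂ V} {ψ : A ⊗[ℂ] ExtCartan H →ₗ[ℂ] ℂ}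
  {b : (rootSystem H).Base} {v : V} {e : A} {χ : A →ₐ[ℂ] ℂ}

namespace IsIrrHighestWeight

variable (hv : IsIrrHighestWeight b ψ ρ v) (he : IsFactorOf ρ e χ)
include hv he

theorem isBoundedDirection_reflectionPerm {h : H} {c : ℂ} (hc : IsStrictlyPositive b h c)
    {j : H.root} {m : ℤ} (hpos : IsPosWeight b ((rootSystem H).root j) m)
    (hpar : ∃ (h' : H) (c' : ℂ), IsMinimalParabolic b ((rootSystem H).root j) m h' c')
    (hk : ∃ k : ℕ, ψ (e ⊗ₜ realCoroot B j m) = k) (i : H.root) (n : ℤ)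
    (hP : IsBoundedDirection ρ e h c (affineWeight h c ((rootSystem H).root i) n)) :
    IsBoundedDirection ρ e h c
      (affineWeight h c ((rootSystem H).root ((rootSystem H).reflectionPerm j i))
        (n - (rootSystem H).pairingIn ℤ i j * m)) := by
  obtain ⟨x, y, hxy⟩ := exists_isRootPair j
  obtain ⟨h', c', hpar⟩ := hpar
  obtain ⟨k, hk⟩ := hk
  obtain ⟨l, hl⟩ := hc _ _ hpos
  rw [affineWeight_reflectionPerm]
  refine hv.isBoundedDirection_reflect he hxy ?_ ?_ ?_ hP
  · exact hv.isLocNilpotent_of_isBoundedDirection he (isHomogeneous_loop_root B m hxy.mem_pos)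
      (hv.isBoundedDirection_of_pos hc.isWeaklyPositive hl)
  · exact hv.isLocNilpotent_of_isMinimalParabolic he hxy hpar hpos hk
  · exact ((rootSystem H).algebraMap_pairingIn ℤ i j).symm

theorem isLocNilpotent_loop_of_dominant
    (hsimple : ∀ j ∈ b.support, ∃ k : ℕ, ψ (e ⊗ₜ (((rootSystem H).coroot j, 0), 0, 0)) = k)
    (haff : ∀ θ : H.root, IsHighestRoot b θ → ∃ k : ℕ, ψ (e ⊗ₜ (affineCoroot B θ, 0, 0)) = k)
    (i : H.root) (m : ℤ) {x : g} (hx : x ∈ rootSpace H i.1) :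
    IsLocNilpotent (ρ (e ⊗ₜ AffVir.loop B m x)) := by
  obtain ⟨θ, hθ⟩ := exists_isHighestRoot b
  obtain ⟨h, c, hc⟩ := exists_isStrictlyPositive b
  refine hv.isLocNilpotent_of_isBoundedDirection he (isHomogeneous_loop_root B m hx)
    (h := h) (c := c) ?_
  refine affineWeyl_induction b (p := fun i m =>
    IsBoundedDirection ρ e h c (affineWeight h c ((rootSystem H).root i) m)) θ
    (fun i m hm => ?_) (fun j hj i n hP => ?_) (fun i n hP => ?_) i m
  · obtain ⟨l, hl⟩ := hc ((rootSystem H).root i) m (Or.inl ⟨hm, Or.inr ⟨i, rfl⟩⟩)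
    exact hv.isBoundedDirection_of_pos hc.isWeaklyPositive hl
  · have := hv.isBoundedDirection_reflectionPerm he hc
      (Or.inr ⟨rfl, j, b.isPos_of_mem_support hj, rfl⟩) (hθ.exists_isMinimalParabolic_simple hj)
      (by simpa [realCoroot] using hsimple j hj) i n hP
    rwa [mul_zero, sub_zero] at this
  · have hneg : (rootSystem H).root ((rootSystem H).reflectionPerm θ θ) =
        -(rootSystem H).root θ := by
      rw [RootPairing.root_reflectionPerm, RootPairing.reflection_apply_self]
    have := hv.isBoundedDirection_reflectionPerm he hc (m := 1)
      (Or.inl ⟨one_pos, Or.inr ⟨_, rfl⟩⟩) (hneg ▸ hθ.exists_isMinimalParabolic_affine)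
      (realCoroot_reflectionPerm_self (B := B) θ ▸ haff θ hθ) i n hP
    rwa [reflectionPerm_reflectionPerm, RootPairing.reflectionPerm_self,
      RootPairing.pairingIn_reflectionPerm_self_right, mul_one, sub_neg_eq_add] at this

end IsIrrHighestWeight

end Dominant

section Factors

variable {ι K A : Type*} [Field K] [CommRing A] [Algebra K A]

theorem exists_algHom_apply_eq_zero_iff [IsAlgClosed K] (M : Ideal A) [hM : M.IsMaximal]
    [FiniteDimensional K (A ⧸ M)] : ∃ χ : A →ₐ[K] K, ∀ a, χ a = 0 ↔ a ∈ M := by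
  let : Field (A ⧸ M) := Ideal.Quotient.field M
  let f : (A ⧸ M) →ₐ[K] K := IsAlgClosed.lift
  refine ⟨f.comp (Ideal.Quotient.mkₐ K M), fun a => ?_⟩
  rw [AlgHom.comp_apply, map_eq_zero_iff f f.toRingHom.injective, Ideal.Quotient.mkₐ_eq_mk,
    Ideal.Quotient.eq_zero_iff_mem]

theorem finite_isMaximal_le (I : Ideal A) [IsArtinianRing (A ⧸ I)] :
    {M : Ideal A | M.IsMaximal ∧ I ≤ M}.Finite := by
  refine ((IsArtinianRing.setOfPred_isMaximal_finite (A ⧸ I)).image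
    (Ideal.comap (Ideal.Quotient.mk I))).subset fun M ⟨hM, hIM⟩ => ?_
  have hker : RingHom.ker (Ideal.Quotient.mk I) ≤ M := by rwa [Ideal.mk_ker]
  exact ⟨M.map (Ideal.Quotient.mk I),
    Ideal.IsMaximal.map_of_surjective_of_ker_le Ideal.Quotient.mk_surjective hker,
    (Ideal.comap_map_of_surjective' _ Ideal.Quotient.mk_surjective M).trans (sup_eq_left.2 hker)⟩

theorem mem_radical_of_forall_isMaximal {I : Ideal A} [IsArtinianRing (A ⧸ I)] {a : A}
    (h : ∀ M : Ideal A, M.IsMaximal → I ≤ M → a ∈ M) : a ∈ I.radical := by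
  rw [Ideal.radical_eq_sInf, Ideal.mem_sInf]
  rintro P ⟨hIP, hP⟩
  have : IsArtinianRing (A ⧸ P) := (Ideal.Quotient.factor_surjective hIP).isArtinianRing
  exact h P (Ideal.Quotient.maximal_of_isField P (IsArtinianRing.isField_of_isDomain _)) hIP

/-- Elements `e i` and characters `χ i` of `A`, dual to each other, such that the `χ i` identify
`A`, up to elements of `J`, with a product of copies of `K`. -/
structure IsDualSystem (J : Ideal A) (e : ι → A) (χ : ι → A →ₐ[K] K) : Prop where
  apply_self (i : ι) : χ i (e i) = 1
  apply_of_ne {i j : ι} (hij : i ≠ j) : χ j (e i) = 0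
  mem {a : A} (ha : ∀ i, χ i a = 0) : a ∈ J

namespace IsDualSystem

variable {J : Ideal A} {e : ι → A} {χ : ι → A →ₐ[K] K} (hs : IsDualSystem J e χ)
include hs

theorem mul_sub_smul_mem (i : ι) (a : A) : a * e i - χ i a • e i ∈ J := by
  refine hs.mem fun j => ?_
  rw [map_sub, map_mul, map_smul, smul_eq_mul]
  by_cases hij : i = j
  · rw [hij, sub_self]
  · rw [hs.apply_of_ne hij, mul_zero, mul_zero, sub_self]

theorem sub_sum_smul_mem [Fintype ι] (a : A) : a - ∑ i, χ i a • e i ∈ J := by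
  refine hs.mem fun j => ?_
  rw [map_sub, map_sum, Finset.sum_eq_single j, map_smul, hs.apply_self, smul_eq_mul, mul_one,
    sub_self]
  · intro i _ hij
    rw [map_smul, hs.apply_of_ne hij, smul_zero]
  · exact fun h => absurd (Finset.mem_univ j) h

end IsDualSystem

theorem exists_isDualSystem {A : Type*} [CommRing A] [Algebra ℂ A] (I : Ideal A)
    [hI : FiniteDimensional ℂ (A ⧸ I)] :
    ∃ (e : {M : Ideal A | M.IsMaximal ∧ I ≤ M} → A)
      (χ : {M : Ideal A | M.IsMaximal ∧ I ≤ M} → A →ₐ[ℂ] ℂ),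
      (∀ M, IsFactorUnit I.radical M.1 (e M)) ∧ IsDualSystem I.radical e χ := by
  have : IsArtinianRing (A ⧸ I) := IsArtinianRing.of_finite ℂ _
  have hrad (M : {M : Ideal A | M.IsMaximal ∧ I ≤ M}) : I.radical ≤ M.1 :=
    M.2.1.isPrime.radical_le_iff.2 M.2.2
  have hχ (M : {M : Ideal A | M.IsMaximal ∧ I ≤ M}) : ∃ χ : A →ₐ[ℂ] ℂ, ∀ a, χ a = 0 ↔ a ∈ M.1 := by
    have := M.2.1
    have : FiniteDimensional ℂ (A ⧸ M.1) := Module.Finite.of_surjective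
      (Ideal.Quotient.factorₐ ℂ M.2.2).toLinearMap (Ideal.Quotient.factor_surjective M.2.2)
    exact exists_algHom_apply_eq_zero_iff M.1
  choose χ hχ using hχ
  choose e he using fun M : {M : Ideal A | M.IsMaximal ∧ I ≤ M} =>
    exists_isFactorUnit I hI M.1 M.2.1 (hrad M)
  refine ⟨e, χ, he, fun M => ?_, fun {M N} hMN => ?_, fun {a} ha => ?_⟩
  · rw [← sub_eq_zero, ← map_one (χ M), ← map_sub]
    exact (hχ M _).2 (he M).1
  · exact (hχ N _).2 ((he M).2 N.1 N.2.1 (hrad N) fun h => hMN (Subtype.ext h.symm))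
  · exact mem_radical_of_forall_isMaximal fun M hM hIM => (hχ ⟨M, hM, hIM⟩ a).1 (ha _)

end Factors

section Irreducible

theorem universalEnvelopingAlgebra_smul_mem {R L W : Type*} [CommRing R] [LieRing L]
    [LieAlgebra R L] [AddCommGroup W] [Module R W] [Module (UniversalEnvelopingAlgebra R L) W]
    [IsScalarTower R (UniversalEnvelopingAlgebra R L) W] {U : Submodule R W}
    (hU : ∀ (x : L), ∀ w ∈ U, UniversalEnvelopingAlgebra.ι R x • w ∈ U)
    (u : UniversalEnvelopingAlgebra R L) {w : W} (hw : w ∈ U) : u • w ∈ U := by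
  let S : Subalgebra R (UniversalEnvelopingAlgebra R L) :=
    { carrier := {u | ∀ w ∈ U, u • w ∈ U}
      mul_mem' := fun ha hb w hw => by rw [mul_smul]; exact ha _ (hb _ hw)
      add_mem' := fun ha hb w hw => by rw [add_smul]; exact add_mem (ha _ hw) (hb _ hw)
      algebraMap_mem' := fun r w hw => by rw [algebraMap_smul]; exact U.smul_mem r hw }
  let f : L →ₗ⁅R⁆ S :=
    { toFun := fun x => ⟨UniversalEnvelopingAlgebra.ι R x, hU x⟩
      map_add' := fun x y => Subtype.ext (map_add (UniversalEnvelopingAlgebra.ι R) x y)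
      map_smul' := fun r x => Subtype.ext (map_smul (UniversalEnvelopingAlgebra.ι R) r x)
      map_lie' := fun {x y} => Subtype.ext (LieHom.map_lie (UniversalEnvelopingAlgebra.ι R) x y) }
  have hid : S.val.comp (UniversalEnvelopingAlgebra.lift R f) =
      AlgHom.id R (UniversalEnvelopingAlgebra R L) := by
    apply UniversalEnvelopingAlgebra.hom_ext
    ext x
    simp [f]
  have hu : (UniversalEnvelopingAlgebra.lift R f u : UniversalEnvelopingAlgebra R L) = u :=
    DFunLike.congr_fun hid u
  rw [← hu]
  exact (UniversalEnvelopingAlgebra.lift R f u).2 w hw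

open LieAlgebra.IsKilling

variable {g : Type*} [LieRing g] [LieAlgebra ℂ g] [FiniteDimensional ℂ g] [LieAlgebra.IsSimple ℂ g]
  (B : InvariantForm g) {H : LieSubalgebra ℂ g} [H.IsCartanSubalgebra]
  {A : Type*} [CommRing A] [Algebra ℂ A] (b : (rootSystem H).Base)
  (ψ : A ⊗[ℂ] ExtCartan H →ₗ[ℂ] ℂ)

/-- The highest weight vector of `V(ψ)`: the image of `1`. -/
def highestWeightVector : IrrHW B b ψ :=
  (vermaMax B b ψ).mkQ ((vermaIdeal B b ψ).mkQ 1)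

theorem smul_highestWeightVector (u : UniversalEnvelopingAlgebra ℂ (LoopAffVir B A)) :
    u • highestWeightVector B b ψ = (vermaMax B b ψ).mkQ ((vermaIdeal B b ψ).mkQ u) := by
  rw [highestWeightVector, ← map_smul, ← map_smul, smul_eq_mul, mul_one]

theorem smul_highestWeightVector_eq_zero {u : UniversalEnvelopingAlgebra ℂ (LoopAffVir B A)}
    (hu : u ∈ vermaIdeal B b ψ) : u • highestWeightVector B b ψ = 0 := by
  rw [smul_highestWeightVector, Submodule.mkQ_apply (vermaIdeal B b ψ),
    (Submodule.Quotient.mk_eq_zero _).2 hu, map_zero]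

theorem isIrrHighestWeight_irrHWAction :
    IsIrrHighestWeight b ψ (irrHWAction B b ψ) (highestWeightVector B b ψ) where
  pos a X hX := smul_highestWeightVector_eq_zero B b ψ
    (Submodule.subset_span (Or.inl ⟨a, X, hX, rfl⟩))
  weight a y := by
    have h := smul_highestWeightVector_eq_zero B b ψ
      (Submodule.subset_span (Or.inr ⟨a ⊗ₜ y, rfl⟩))
    rw [sub_smul, sub_eq_zero, algebraMap_smul, LinearMap.lTensor_tmul] at h
    exact h
  cyclic U hv hU := by
    refine Submodule.eq_top_iff'.2 fun w => ?_
    obtain ⟨w, rfl⟩ := Submodule.mkQ_surjective _ w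
    obtain ⟨u, rfl⟩ := Submodule.mkQ_surjective _ w
    rw [← smul_highestWeightVector]
    exact universalEnvelopingAlgebra_smul_mem hU u hv
  simple U hU htop := by
    let N : Submodule (UniversalEnvelopingAlgebra ℂ (LoopAffVir B A)) (IrrHW B b ψ) :=
      { U with smul_mem' := fun u w hw => universalEnvelopingAlgebra_smul_mem hU u hw }
    have hN : N.comap (vermaMax B b ψ).mkQ ≤ vermaMax B b ψ := by
      refine le_sSup fun h => htop (Submodule.eq_top_iff'.2 fun w => ?_)
      obtain ⟨w, rfl⟩ := Submodule.mkQ_surjective _ w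
      exact (h ▸ Submodule.mem_top : w ∈ N.comap (vermaMax B b ψ).mkQ)
    refine (Submodule.eq_bot_iff _).2 fun w hw => ?_
    obtain ⟨w, rfl⟩ := Submodule.mkQ_surjective _ w
    exact (Submodule.Quotient.mk_eq_zero _).2 (hN hw)

end Irreducible

section LocallyNilpotent

variable {R A L V : Type*} [CommRing R] [CommRing A] [Algebra R A] [LieRing L] [LieAlgebra R L]
  [AddCommGroup V] [Module R V]

/-- The submodule of those `a : A` for which `a ⊗ X` acts locally nilpotently. -/
def locNilpotentSubmodule (ρ : A ⊗[R] L →ₗ⁅R⁆ Module.End R V) (X : L) : Submodule R A where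
  carrier := {a | IsLocNilpotent (ρ (a ⊗ₜ X))}
  zero_mem' := by
    rw [Set.mem_ofPred_eq, TensorProduct.zero_tmul, map_zero]
    exact isLocNilpotent_zero
  add_mem' {a a'} ha ha' := by
    rw [Set.mem_ofPred_eq, TensorProduct.add_tmul, map_add]
    refine IsLocNilpotent.add ha ha' (LinearMap.ext fun w => ?_)
    rw [Module.End.mul_apply, Module.End.mul_apply, apply_apply_tmul, lie_self,
      TensorProduct.tmul_zero, map_zero, LinearMap.zero_apply, zero_add]
  smul_mem' r a ha := by
    rw [Set.mem_ofPred_eq, ← TensorProduct.smul_tmul', map_smul]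
    exact IsLocNilpotent.smul ha r

theorem mem_locNilpotentSubmodule {ρ : A ⊗[R] L →ₗ⁅R⁆ Module.End R V} {X : L} {a : A} :
    a ∈ locNilpotentSubmodule ρ X ↔ IsLocNilpotent (ρ (a ⊗ₜ X)) := Iff.rfl

end LocallyNilpotent

section Integrability

open LieAlgebra.IsKilling LieAlgebra

variable {g : Type*} [LieRing g] [LieAlgebra ℂ g] {B : InvariantForm g} {A : Type*} [CommRing A]
  [Algebra ℂ A] {V : Type*} [AddCommGroup V] [Module ℂ V] {ρ : LoopAffVir B A →ₗ⁅ℂ⁆ Module.End ℂ V}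

theorem IsDualSystem.isFactorOf {ι : Type*} {J : Ideal A} {e : ι → A} {χ : ι → A →ₐ[ℂ] ℂ}
    (hs : IsDualSystem J e χ) (hJ : ∀ a ∈ J, ∀ X ∈ affinePart B, ρ (a ⊗ₜ X) = 0) (i : ι) :
    IsFactorOf ρ (e i) (χ i) where
  unit := hs.apply_self i
  act a X hX := by
    have := hJ _ (hs.mul_sub_smul_mem i a) X hX
    rwa [TensorProduct.sub_tmul, map_sub, sub_eq_zero, ← TensorProduct.smul_tmul', map_smul] at this

variable [FiniteDimensional ℂ g] [LieAlgebra.IsSimple ℂ g] {H : LieSubalgebra ℂ g}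
  [H.IsCartanSubalgebra] {b : (rootSystem H).Base} {ψ : A ⊗[ℂ] ExtCartan H →ₗ[ℂ] ℂ} {v : V}

namespace IsIrrHighestWeight

variable (hv : IsIrrHighestWeight b ψ ρ v) {I : Ideal A}
include hv

theorem apply_eq_zero_of_mem (hd : ∀ a ∈ I, ψ (a ⊗ₜ[ℂ] (0, 1, 0)) = 0)
    (hC : ∀ a ∈ I, ψ (a ⊗ₜ[ℂ] (0, 0, 1)) = 0)
    (hh : ∀ a ∈ I, ∀ x : DerivedCartan H, ψ (a ⊗ₜ[ℂ] (x, 0, 0)) = 0) :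
    ∀ a ∈ I, ∀ X, ρ (a ⊗ₜ X) = 0 := by
  have hψ : ∀ a ∈ I, ∀ y : ExtCartan H, ψ (a ⊗ₜ y) = 0 := by
    rintro a ha ⟨x, s, c⟩
    have hsum : ((x, s, c) : ExtCartan H) = (x, 0, 0) + s • (0, 1, 0) + c • (0, 0, 1) := by
      ext <;> simp
    rw [hsum, TensorProduct.tmul_add, TensorProduct.tmul_add, TensorProduct.tmul_smul,
      TensorProduct.tmul_smul, map_add, map_add, map_smul, map_smul, hd a ha, hC a ha, hh a ha,
      smul_zero, smul_zero, add_zero, add_zero]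
  intro a ha X
  refine hv.apply_eq_zero_of_ideal (P := ⊤) ?_ (fun a ha y _ => hψ a ha y) ha
    (LieSubmodule.mem_top X)
  simpa using (span_isHomogeneous_eq_top B H).ge

theorem apply_affinePart_eq_zero_of_mem {J : Ideal A}
    (hh : ∀ a ∈ J, ∀ x : DerivedCartan H, ψ (a ⊗ₜ[ℂ] (x, 0, 0)) = 0) :
    ∀ a ∈ J, ∀ X ∈ affinePart B, ρ (a ⊗ₜ X) = 0 := by
  intro a ha X hX
  refine hv.apply_eq_zero_of_ideal (affinePart_le_span_isHomogeneous B H) ?_ ha hX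
  rintro a ha ⟨x, s, c⟩ ⟨hvir, hc⟩
  have hs : s = 0 := by simpa [cartanIncl] using hvir
  have hc : c = 0 := by simpa [cartanIncl] using hc
  rw [hs, hc]
  exact hh a ha x

variable [FiniteDimensional ℂ (A ⧸ I)]

theorem isLocNilpotent_loop
    (hh : ∀ a ∈ I.radical, ∀ x : DerivedCartan H, ψ (a ⊗ₜ[ℂ] (x, 0, 0)) = 0)
    (hdom : IsDominantIntegralWrt B b ψ I.radical) (i : H.root) {x : g} (hx : x ∈ rootSpace H i.1)
    (m : ℤ) (a : A) : IsLocNilpotent (ρ (a ⊗ₜ AffVir.loop B m x)) := by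
  have : IsArtinianRing (A ⧸ I) := IsArtinianRing.of_finite ℂ _
  have := (finite_isMaximal_le I).to_subtype
  cases nonempty_fintype {M : Ideal A | M.IsMaximal ∧ I ≤ M}
  have hrad := hv.apply_affinePart_eq_zero_of_mem hh
  obtain ⟨e, χ, he, hs⟩ := exists_isDualSystem I
  have hfactor (M) : e M ∈ locNilpotentSubmodule ρ (AffVir.loop B m x) := by
    obtain ⟨hsimple, haff⟩ :=
      hdom M.1 M.2.1 (M.2.1.isPrime.radical_le_iff.2 M.2.2) (e M) (he M)
    exact hv.isLocNilpotent_loop_of_dominant (hs.isFactorOf hrad M) hsimple haff i m hx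
  have hdiff : a - ∑ M, χ M a • e M ∈ locNilpotentSubmodule ρ (AffVir.loop B m x) := by
    rw [mem_locNilpotentSubmodule, hrad _ (hs.sub_sum_smul_mem a) _ (loop_mem_affinePart m x)]
    exact isLocNilpotent_zero
  rw [← mem_locNilpotentSubmodule, ← sub_add_cancel a (∑ M, χ M a • e M)]
  exact add_mem hdiff (Submodule.sum_mem _ fun M _ => Submodule.smul_mem _ _ (hfactor M))

end IsIrrHighestWeight

end Integrability

end LoopAffineVirasoro

end

theorem mainTheorem3_general {g : Type*} [LieRing g] [LieAlgebra ℂ g] [FiniteDimensional ℂ g]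
    [LieAlgebra.IsSimple ℂ g] (B : LoopAffineVirasoro.InvariantForm g)
    (H : LieSubalgebra ℂ g) [H.IsCartanSubalgebra]
    (b : (LieAlgebra.IsKilling.rootSystem H).Base)
    (A : Type*) [CommRing A] [Algebra ℂ A]
    (ψ : A ⊗[ℂ] LoopAffineVirasoro.ExtCartan H →ₗ[ℂ] ℂ)
    (I : Ideal A) (hI : FiniteDimensional ℂ (A ⧸ I))
    (hd : ∀ a ∈ I, ψ (a ⊗ₜ[ℂ] (0, 1, 0)) = 0)
    (hC : ∀ a ∈ I, ψ (a ⊗ₜ[ℂ] (0, 0, 1)) = 0)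
    (hh : ∀ a ∈ I.radical, ∀ x : LoopAffineVirasoro.DerivedCartan H, ψ (a ⊗ₜ[ℂ] (x, 0, 0)) = 0)
    (hdom : LoopAffineVirasoro.IsDominantIntegralWrt B b ψ I.radical) :
    LoopAffineVirasoro.IsIntegrable B H (LoopAffineVirasoro.irrHWAction B b ψ) := by
  have hv := LoopAffineVirasoro.isIrrHighestWeight_irrHWAction B b ψ
  have hzero := hv.apply_eq_zero_of_mem hd hC fun a ha => hh a (Ideal.le_radical ha)
  classical
  exact {
    isWeightModule := DirectSum.isInternal_submodule_of_iSupIndep_of_iSup_eq_top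
      (LoopAffineVirasoro.iSupIndep_weightSpace _) hv.iSup_weightSpace
    finiteDimensional := hv.finiteDimensional_weightSpace hzero
    locallyNilpotent := fun i _ hx m a => hv.isLocNilpotent_loop hh hdom i hx m a }

theorem mainTheorem3 {g : Type*} [LieRing g] [LieAlgebra ℂ g] [FiniteDimensional ℂ g]
    [LieAlgebra.IsSimple ℂ g] (B : LoopAffineVirasoro.InvariantForm g)
    (H : LieSubalgebra ℂ g) [H.IsCartanSubalgebra]
    (b : (LieAlgebra.IsKilling.rootSystem H).Base)
    (A : Type*) [CommRing A] [Algebra ℂ A] [Algebra.FiniteType ℂ A]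
    (ψ : A ⊗[ℂ] LoopAffineVirasoro.ExtCartan H →ₗ[ℂ] ℂ)
    (I : Ideal A) (hI : FiniteDimensional ℂ (A ⧸ I))
    (hd : ∀ a ∈ I, ψ (a ⊗ₜ[ℂ] (0, 1, 0)) = 0)
    (hC : ∀ a ∈ I, ψ (a ⊗ₜ[ℂ] (0, 0, 1)) = 0)
    (hh : ∀ a ∈ I.radical, ∀ x : LoopAffineVirasoro.DerivedCartan H, ψ (a ⊗ₜ[ℂ] (x, 0, 0)) = 0)
    (hdom : LoopAffineVirasoro.IsDominantIntegralWrt B b ψ I.radical) :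
    LoopAffineVirasoro.IsIntegrable B H (LoopAffineVirasoro.irrHWAction B b ψ) :=
  mainTheorem3_general B H b A ψ I hI hd hC hh hdom
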